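/- \textbf{Setting.} Let $\theta,\beta>0$, let $\{\lambda_j\}_{j\in\mathbb Z\setminus\{0\}}$ be real frequencies with $|\lambda_j-\lambda_l|\ge\theta$ for $j\ne l$ and $|\lambda_j|\ge\theta$ for all $j$, and let $q_j:\mathbb R\to\mathbb C$ ($j\neq0$) satisfy $$\sum_{j\ne 0}|q_j|_{W^{3,\infty}_\beta}<\infty,\qquad |g|_{W^{3,\infty}_\beta}=\sum_{l=0}^{3}\operatorname*{ess\,sup}_{x\in\mathbb R}e^{\beta|x|}|\partial^l g(x)|$$ (weak derivatives). Assume that $q(x,y)=\sum_{j\neq0}q_j(x)e^{2\pi i\lambda_j y}$ is real-valued (for a.e. $x$ and all $y\in\mathbb R$) and that the $q_j$ are not all zero almost everywhere. Put $q_\epsilon(x)=q(x,x/\epsilon)$ and $$\Lambda_{\rm eff}(x)=\frac1{(2\pi)^2}\sum_{j\ne0}\frac{|q_j(x)|^2}{\lambda_j^2}.$$ Let $H_V=-\partial_x^2+V$ on $L^2(\mathbb R)$ (with domain $H^2(\mathbb R)$ for bounded $V$). For a bounded, exponentially decaying potential $V$, let $f^V_\pm(\cdot;k)$ be the Jost solutions,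 i.e. the solutions of $$f^V_+(x;k)=e^{ikx}+\int_x^\infty\frac{\sin(k(y-x))}{k}V(y)f^V_+(y;k)\,dy,\qquad f^V_-(x;k)=e^{-ikx}-\int_{-\infty}^x\frac{\sin(k(y-x))}{k}V(y)f^V_-(y;k)\,dy,$$ and let $t^V(k)=-2ik/\mathcal W[f^V_+,f^V_-](k)$ be the transmission coefficient, where $\mathcal W[h_1,h_2]=h_1h_2'-h_2h_1'$. \textbf{Statement (edge bifurcation of point spectrum from the continuum).} There are constants $\epsilon_0>0$ and $C>0$ such that for every $0<\epsilon<\epsilon_0$ the transmission coefficient $t^{q_\epsilon}$ has a pole $k_\epsilon$ in the open upper half plane with $$\Big|k_\epsilon-i\frac{\epsilon^2}{2}\int_{\mathbb R}\Lambda_{\rm eff}\Big|\le C\epsilon^3 ,$$ the number $E_\epsilon=k_\epsilon^2$ is real and negative and satisfies $$\Big|E_\epsilon+\frac{\epsilon^4}{4}\Big(\int_{\mathbb R}\Lambda_{\rm eff}\Big)^2\Big|\le C\epsilon^5 ,$$ $E_\epsilon$ is a simple eigenvalue of $H_{q_\epsilon}$ (its eigenspace is one-dimensional), and every eigenfunction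 $u$ for $E_\epsilon$ satisfies $u(x)=\mathcal O\big(e^{-\sqrt{|E_\epsilon|}\,|x|}\big)$, i.e. there is $M$ with $|u(x)|\le M e^{-\sqrt{|E_\epsilon|}\,|x|}$ for a.e. $x\in\mathbb R$. -/

import Mathlib

open MeasureTheory
open scoped ENNReal ContDiff

namespace EdgeBifurcation

/-! ### Weak derivatives and exponentially weighted Sobolev norms -/

/-- `f'` is the weak (distributional) derivative of `f` on `ℝ`; both are locally integrable. -/
structure HasWeakDeriv (f f' : ℝ → ℂ) : Prop where
  locallyIntegrable : LocallyIntegrable f volume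
  locallyIntegrable_deriv : LocallyIntegrable f' volume
  integral_eq : ∀ φ : ℝ → ℝ, ContDiff ℝ ∞ φ → HasCompactSupport φ →
    ∫ x, deriv φ x • f x = -∫ x, φ x • f' x

/-- The norm `ess sup_x e^{β|x|} |g(x)|` of `L^∞_β`. -/
noncomputable def expNorm (β : ℝ) (g : ℝ → ℂ) : ℝ≥0∞ :=
  eLpNorm (fun x : ℝ => Real.exp (β * |x|) • g x) ∞ volume

/-- `d 0, …, d n` are `g` and its successive weak derivatives up to order `n`. -/
structure IsWeakDerivFamily (n : ℕ) (g : ℝ → ℂ) (d : ℕ → ℝ → ℂ) : Prop where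
  zero : d 0 = g
  measurable : ∀ l ≤ n, AEStronglyMeasurable (d l) volume
  succ : ∀ l < n, HasWeakDeriv (d l) (d (l + 1))

/-- The norm `∑_{l ≤ n} |∂^l g|_{L^∞_β}` of `W^{n,∞}_β`.  Weak derivatives are unique almost
everywhere, so the infimum is over equal values; it is `∞` when `g` does not have weak
derivatives up to order `n`. -/
noncomputable def sobolevNorm (n : ℕ) (β : ℝ) (g : ℝ → ℂ) : ℝ≥0∞ :=
  ⨅ (d : ℕ → ℝ → ℂ) (_ : IsWeakDerivFamily n g d), ∑ l ∈ Finset.range (n + 1), expNorm β (d l)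

/-! ### Two-scale potentials -/

/-- The index set `ℤ \ {0}`. -/
abbrev Idx : Type := {j : ℤ // j ≠ 0}

/-- `q(x,y) = ∑_{j ≠ 0} q_j(x) e^{2π i λ_j y}`. -/
noncomputable def twoScale (lam : Idx → ℝ) (q : Idx → ℝ → ℂ) (x y : ℝ) : ℂ :=
  ∑' j : Idx, q j x * Complex.exp (2 * Real.pi * Complex.I * lam j * y)

/-- The highly oscillatory potential `q_ε(x) = q(x, x/ε)`. -/
noncomputable def oscPotential (lam : Idx → ℝ) (q : Idx → ℝ → ℂ) (ε : ℝ) (x : ℝ) : ℂ :=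
  twoScale lam q x (x / ε)

/-- `Λ_eff(x) = (2π)^{-2} ∑_{j ≠ 0} |q_j(x)|² / λ_j²`. -/
noncomputable def effPotential (lam : Idx → ℝ) (q : Idx → ℝ → ℂ) (x : ℝ) : ℝ :=
  1 / (2 * Real.pi) ^ 2 * ∑' j : Idx, ‖q j x‖ ^ 2 / lam j ^ 2

/-! ### Jost solutions and the transmission coefficient -/

/-- `sin(k s)/k`, with its limiting value `s` at `k = 0`. -/
noncomputable def volterraKernel (k : ℂ) (s : ℝ) : ℂ :=
  if k = 0 then (s : ℂ) else Complex.sin (k * s) / k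

/-- `f` is a solution of the Volterra equation
`f(x) = e^{ikx} + ∫_x^∞ (sin(k(y-x))/k) V(y) f(y) dy`. -/
structure IsJostPlus (V : ℝ → ℂ) (k : ℂ) (f : ℝ → ℂ) : Prop where
  continuous : Continuous f
  integrable : ∀ x : ℝ,
    IntegrableOn (fun y : ℝ => volterraKernel k (y - x) * V y * f y) (Set.Ioi x) volume
  volterra : ∀ x : ℝ, f x = Complex.exp (Complex.I * k * x) +
    ∫ y in Set.Ioi x, volterraKernel k (y - x) * V y * f y

/-- `f` is a solution of the Volterra equation
`f(x) = e^{-ikx} - ∫_{-∞}^x (sin(k(y-x))/k) V(y) f(y) dy`. -/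
structure IsJostMinus (V : ℝ → ℂ) (k : ℂ) (f : ℝ → ℂ) : Prop where
  continuous : Continuous f
  integrable : ∀ x : ℝ,
    IntegrableOn (fun y : ℝ => volterraKernel k (y - x) * V y * f y) (Set.Iio x) volume
  volterra : ∀ x : ℝ, f x = Complex.exp (-(Complex.I * k * x)) -
    ∫ y in Set.Iio x, volterraKernel k (y - x) * V y * f y

/-- The Jost solution `f_+^V(·;k)`: the unique solution of its Volterra equation. -/
noncomputable def jostPlus (V : ℝ → ℂ) (k : ℂ) : ℝ → ℂ :=
  Classical.epsilon (IsJostPlus V k)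

/-- The Jost solution `f_-^V(·;k)`: the unique solution of its Volterra equation. -/
noncomputable def jostMinus (V : ℝ → ℂ) (k : ℂ) : ℝ → ℂ :=
  Classical.epsilon (IsJostMinus V k)

/-- The Wronskian `W[h₁,h₂] = h₁ h₂' - h₂ h₁'` at the point `x`. -/
noncomputable def wronskian (h₁ h₂ : ℝ → ℂ) (x : ℝ) : ℂ :=
  h₁ x * deriv h₂ x - h₂ x * deriv h₁ x

/-- The transmission coefficient `t^V(k) = -2ik / W[f_+^V, f_-^V]`.  The Wronskian of two
solutions of `(H_V - k²) u = 0` does not depend on the point; it is evaluated at `0`. -/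
noncomputable def transmission (V : ℝ → ℂ) (k : ℂ) : ℂ :=
  -(2 * Complex.I * k) / wronskian (jostPlus V k) (jostMinus V k) 0

/-- `f` has a pole at `z`: it is meromorphic there and its order is negative. -/
def HasPoleAt (f : ℂ → ℂ) (z : ℂ) : Prop :=
  MeromorphicAt f z ∧ meromorphicOrderAt f z < 0

/-! ### The Schrödinger operator on `L²(ℝ)` -/

/-- The complex Hilbert space `L²(ℝ)`. -/
abbrev L2 : Type := Lp ℂ 2 (volume : Measure ℝ)

theorem HasWeakDeriv.congr {f g f' g' : ℝ → ℂ} (h : HasWeakDeriv f f')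
    (hf : f =ᵐ[volume] g) (hf' : f' =ᵐ[volume] g') : HasWeakDeriv g g' where
  locallyIntegrable := h.locallyIntegrable.congr hf
  locallyIntegrable_deriv := h.locallyIntegrable_deriv.congr hf'
  integral_eq φ hφ hc := by
    have h1 : ∫ x, deriv φ x • f x = ∫ x, deriv φ x • g x :=
      integral_congr_ae (by filter_upwards [hf] with x hx; rw [hx])
    have h2 : ∫ x, φ x • f' x = ∫ x, φ x • g' x :=
      integral_congr_ae (by filter_upwards [hf'] with x hx; rw [hx])
    rw [← h1, ← h2, h.integral_eq φ hφ hc]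

theorem HasWeakDeriv.zero : HasWeakDeriv (fun _ => 0) (fun _ => 0) where
  locallyIntegrable := locallyIntegrable_zero
  locallyIntegrable_deriv := locallyIntegrable_zero
  integral_eq φ _ _ := by simp

theorem integrable_test_smul {f : ℝ → ℂ} (hf : LocallyIntegrable f volume) {φ : ℝ → ℝ}
    (hφ : Continuous φ) (hc : HasCompactSupport φ) : Integrable (fun x => φ x • f x) volume :=
  hf.integrable_smul_left_of_hasCompactSupport hφ hc

theorem HasWeakDeriv.add {f g f' g' : ℝ → ℂ} (hf : HasWeakDeriv f f') (hg : HasWeakDeriv g g') :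
    HasWeakDeriv (fun x => f x + g x) (fun x => f' x + g' x) where
  locallyIntegrable := hf.locallyIntegrable.add hg.locallyIntegrable
  locallyIntegrable_deriv := hf.locallyIntegrable_deriv.add hg.locallyIntegrable_deriv
  integral_eq φ hφ hc := by
    have hd : Continuous (deriv φ) := hφ.continuous_deriv (by simp)
    simp only [smul_add]
    rw [integral_add (integrable_test_smul hf.locallyIntegrable hd hc.deriv)
        (integrable_test_smul hg.locallyIntegrable hd hc.deriv),
      integral_add (integrable_test_smul hf.locallyIntegrable_deriv hφ.continuous hc)
        (integrable_test_smul hg.locallyIntegrable_deriv hφ.continuous hc),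
      hf.integral_eq φ hφ hc, hg.integral_eq φ hφ hc]
    ring

theorem HasWeakDeriv.const_smul {f f' : ℝ → ℂ} (hf : HasWeakDeriv f f') (c : ℂ) :
    HasWeakDeriv (fun x => c * f x) (fun x => c * f' x) where
  locallyIntegrable := hf.locallyIntegrable.smul c
  locallyIntegrable_deriv := hf.locallyIntegrable_deriv.smul c
  integral_eq φ hφ hc := by
    simp only [← mul_smul_comm]
    rw [integral_const_mul, integral_const_mul, hf.integral_eq φ hφ hc, mul_neg]

theorem HasWeakDeriv.unique {f g g' : ℝ → ℂ} (h : HasWeakDeriv f g) (h' : HasWeakDeriv f g') :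
    g =ᵐ[volume] g' := by
  refine ae_eq_of_integral_contDiff_smul_eq h.locallyIntegrable_deriv h'.locallyIntegrable_deriv ?_
  intro φ hφ hc
  have e := (h.integral_eq φ hφ hc).symm.trans (h'.integral_eq φ hφ hc)
  exact neg_injective e

/-- The graph of `H_V = -∂_x² + V` with domain `{u ∈ H²(ℝ) : V u ∈ L²(ℝ)}`
(which is `H²(ℝ)` when `V` is bounded): the pairs `(u, -u'' + V u)`. -/
noncomputable def schrodingerGraph (V : ℝ → ℂ) : Submodule ℂ (L2 × L2) where
  carrier := {p | ∃ u₁ u₂ : L2, HasWeakDeriv p.1 u₁ ∧ HasWeakDeriv u₁ u₂ ∧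
    ∀ᵐ x : ℝ, p.2 x = -u₂ x + V x * p.1 x}
  zero_mem' := by
    have z : HasWeakDeriv (0 : L2) (0 : L2) :=
      HasWeakDeriv.zero.congr (Lp.coeFn_zero ℂ 2 volume).symm (Lp.coeFn_zero ℂ 2 volume).symm
    refine ⟨0, 0, z, z, ?_⟩
    exact Filter.Eventually.of_forall fun x => by simp
  add_mem' := by
    rintro ⟨a, w⟩ ⟨b, v⟩ ⟨a₁, a₂, ha1, ha2, ha⟩ ⟨b₁, b₂, hb1, hb2, hb⟩
    refine ⟨a₁ + b₁, a₂ + b₂,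
      (ha1.add hb1).congr (Lp.coeFn_add a b).symm (Lp.coeFn_add a₁ b₁).symm,
      (ha2.add hb2).congr (Lp.coeFn_add a₁ b₁).symm (Lp.coeFn_add a₂ b₂).symm, ?_⟩
    filter_upwards [ha, hb, Lp.coeFn_add a b, Lp.coeFn_add a₂ b₂, Lp.coeFn_add w v]
      with x h1 h2 h3 h4 h5
    simp only [Prod.mk_add_mk, h3, h4, h5, Pi.add_apply] at h1 h2 ⊢
    rw [h1, h2]
    ring
  smul_mem' := by
    rintro c ⟨a, w⟩ ⟨a₁, a₂, ha1, ha2, ha⟩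
    refine ⟨c • a₁, c • a₂,
      (ha1.const_smul c).congr (Lp.coeFn_smul c a).symm (Lp.coeFn_smul c a₁).symm,
      (ha2.const_smul c).congr (Lp.coeFn_smul c a₁).symm (Lp.coeFn_smul c a₂).symm, ?_⟩
    filter_upwards [ha, Lp.coeFn_smul c a, Lp.coeFn_smul c a₂, Lp.coeFn_smul c w]
      with x h1 h3 h4 h5
    simp only [Prod.smul_mk, h3, h4, h5, Pi.smul_apply, smul_eq_mul] at h1 ⊢
    rw [h1]
    ring

/-- The Schrödinger operator `H_V = -∂_x² + V`, as an unbounded operator on `L²(ℝ)`. -/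
noncomputable def schrodingerOp (V : ℝ → ℂ) : L2 →ₗ.[ℂ] L2 :=
  (schrodingerGraph V).toLinearPMap

/-- `schrodingerOp V` has the graph it is meant to have. -/
theorem schrodingerOp_graph (V : ℝ → ℂ) : (schrodingerOp V).graph = schrodingerGraph V := by
  refine Submodule.toLinearPMap_graph_eq _ ?_
  rintro ⟨u, w⟩ ⟨u₁, u₂, h1, h2, h⟩ hu
  simp only at hu h1 h ⊢
  subst hu
  have z : HasWeakDeriv (0 : L2) (fun _ => 0) :=
    HasWeakDeriv.zero.congr (Lp.coeFn_zero ℂ 2 volume).symm (Filter.EventuallyEq.refl _ _)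
  have e1 := h1.unique z
  have e2 := (h2.congr e1 (Filter.EventuallyEq.refl _ _)).unique HasWeakDeriv.zero
  refine Lp.ext ?_
  filter_upwards [h, e2] with x hx hx2
  simp [hx, hx2]

/-- The eigenspace `{u ∈ dom T : T u = μ u}` of an unbounded operator `T`. -/
noncomputable def eigenspace (T : L2 →ₗ.[ℂ] L2) (μ : ℂ) : Submodule ℂ L2 :=
  T.graph.comap (LinearMap.prod LinearMap.id (μ • LinearMap.id))

/-- `E` is a simple eigenvalue of `T`: its eigenspace is one-dimensional. -/
def IsSimpleEigenvalue (T : L2 →ₗ.[ℂ] L2) (E : ℂ) : Prop :=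
  Module.finrank ℂ (eigenspace T E) = 1

theorem mem_eigenspace_iff (T : L2 →ₗ.[ℂ] L2) (μ : ℂ) (u : L2) :
    u ∈ eigenspace T μ ↔ ∃ h : u ∈ T.domain, T ⟨u, h⟩ = μ • u := by
  simp [eigenspace, LinearPMap.mem_graph_iff]

end EdgeBifurcation

namespace EdgeBifurcation

open Set Filter Topology

/-! Poles of the transmission coefficient in the upper half plane come from zeros of the Wronskian
W(k) of the two Jost solutions, so the matter is to find W at k = iκ with κ of order ε². The
potential V = q_ε is not small, but it oscillates fast, so its iterated antiderivatives are small.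
They yield S = O(ε) and P = O(ε²) with S' = V - R, P' = S - T and remainders R, T = O(ε²)
(`Corrector`, `SmoothProfile.corrector`). The modulated Jost solution m(x) = e^{-ikx} f_+(x)
satisfies m'' - 2κm' = Vm. In the unknowns Φ = e^{-P} m and Γ = e^{P}(m' - κm - Sm) the potential V
disappears, and an effective potential U = R - S² of size ε² takes its place
(`Corrector.halfLineSystem`). Perturbation theory around the constant solution (1, -κ), with
constants uniform as κ → 0, gives W(iκ) = 2κ + ∫U + O(ε⁴) (`Corrector.norm_jostWronskian_sub_le`).

The integral of U is computed by parts: ∫S(S - T) = ∫SP' = -∫(V - R)P, hence ∫U = ∫R + ∫VP - ∫RP -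
∫ST. The last two integrals are O(ε³), and so is ∫R by non-stationary phase. In ∫VP two modes of
different frequency interact weakly because of the frequency gap, while the diagonal contributes
|q_j|² times ε²/(2πiλ_j)². This sums to -ε²∫Λ_eff (`SmoothProfile.norm_integral_sub_sq_le`).
Altogether W(iκ) = 2(κ - (ε²/2)∫Λ_eff) + O(ε³).

For real V the function κ ↦ W(iκ) is real, and the intermediate value theorem yields a zero within
O(ε³) of (ε²/2)∫Λ_eff (`exists_zero_jostWronskian`). W is analytic and not identically zero, so this
is a pole of t (`hasPoleAt_transmission`). At the zero the two Jost solutions are proportional,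
which gives a solution decaying like e^{-κ|x|} at both ends. Any other L² eigenfunction has constant
and integrable Wronskian with it, so the eigenspace is a line (`simple_eigenvalue_of_boundState`).

The Volterra series has bounds that blow up as k → 0. It supplies only existence, uniqueness and
analyticity for Im k > 0. The Sobolev profiles are replaced by C² representatives; potentials that
agree almost everywhere have the same Jost solutions and the same operator. -/

/-! ### Tail integrals, and integrals depending on a holomorphic parameter. -/

theorem integrableOn_exp_neg_mul_Ioi {c : ℝ} (hc : 0 < c) (x : ℝ) :
    IntegrableOn (fun y : ℝ => Real.exp (-(c * y))) (Ioi x) := by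
  simpa only [neg_mul] using exp_neg_integrableOn_Ioi x hc

theorem integral_exp_neg_mul_Ioi {c : ℝ} (hc : 0 < c) (x : ℝ) :
    ∫ y in Ioi x, Real.exp (-(c * y)) = Real.exp (-(c * x)) / c := by
  have h := integral_exp_mul_Ioi (a := -c) (by linarith) x
  simp only [neg_mul] at h
  rw [h, neg_div_neg_eq]

theorem norm_integral_Ioi_le_of_exp_bound {g : ℝ → ℂ} {B c x : ℝ} (hc : 0 < c)
    (h : ∀ y, x < y → ‖g y‖ ≤ B * Real.exp (-(c * y))) :
    ‖∫ y in Ioi x, g y‖ ≤ B * (Real.exp (-(c * x)) / c) := by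
  rw [← integral_exp_neg_mul_Ioi hc x, ← integral_const_mul]
  refine norm_integral_le_of_norm_le ((integrableOn_exp_neg_mul_Ioi hc x).const_mul B) ?_
  exact (ae_restrict_iff' measurableSet_Ioi).2 (Eventually.of_forall fun y hy => h y hy)

theorem integrableOn_Ioi_of_exp_bound {g : ℝ → ℂ} {B c x : ℝ} (hc : 0 < c)
    (hg : Continuous g) (h : ∀ y, x < y → ‖g y‖ ≤ B * Real.exp (-(c * y))) :
    IntegrableOn g (Ioi x) := by
  refine Integrable.mono' ((integrableOn_exp_neg_mul_Ioi hc x).const_mul B)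
    hg.aestronglyMeasurable ?_
  exact (ae_restrict_iff' measurableSet_Ioi).2 (Eventually.of_forall fun y hy => h y hy)

theorem hasDerivAt_integral_Ioi {g : ℝ → ℂ} (hg : Continuous g)
    (hi : ∀ x, IntegrableOn g (Ioi x)) (x : ℝ) :
    HasDerivAt (fun x => ∫ y in Ioi x, g y) (-g x) x := by
  have e : (fun x => ∫ y in Ioi x, g y) = fun x => (∫ y in Ioi 0, g y) - ∫ y in (0 : ℝ)..x, g y := by
    funext z
    have := intervalIntegral.integral_Ioi_sub_Ioi' (hi 0) (hi z)
    rw [← this]; ring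
  rw [e]
  simpa using (intervalIntegral.integral_hasDerivAt_right (hg.intervalIntegrable 0 x)
    (hg.stronglyMeasurableAtFilter _ _) hg.continuousAt).const_sub (∫ y in Ioi 0, g y)

/-- An integral depending holomorphically on a parameter. -/
theorem differentiableOn_integral_of_dominated {α : Type*} [MeasurableSpace α] {μ : Measure α}
    {F : ℂ → α → ℂ} {U : Set ℂ} (hU : IsOpen U) {b : α → ℝ} (hb : Integrable b μ)
    (hm : ∀ k ∈ U, AEStronglyMeasurable (F k) μ)
    (hF : ∀ᵐ y ∂μ, (DifferentiableOn ℂ (fun k => F k y) U ∧ ∀ k ∈ U, ‖F k y‖ ≤ b y)) :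
    DifferentiableOn ℂ (fun k => ∫ y, F k y ∂μ) U := by
  intro k₀ hk₀
  obtain ⟨r, hr, hball⟩ := Metric.isOpen_iff.1 hU k₀ hk₀
  have hr2 : 0 < r / 2 := by positivity
  have hr4 : 0 < r / 4 := by positivity
  have hsub : ∀ k ∈ Metric.ball k₀ (r / 2), Metric.closedBall k (r / 4) ⊆ U := fun k hk z hz => by
    refine hball ?_
    rw [Metric.mem_ball] at *
    rw [Metric.mem_closedBall] at hz
    calc dist z k₀ ≤ dist z k + dist k k₀ := dist_triangle _ _ _
      _ < r := by linarith
  -- Cauchy's estimate on circles of radius r/4 turns the domination of F into a domination of its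
  -- derivative in k.
  have hder : ∀ᵐ y ∂μ, ∀ k ∈ Metric.ball k₀ (r / 2),
      ‖deriv (fun k => F k y) k‖ ≤ b y / (r / 4) := by
    filter_upwards [hF] with y hy k hk
    refine Complex.norm_deriv_le_of_forall_mem_sphere_norm_le hr4 ?_ fun z hz =>
      hy.2 z (hsub k hk (Metric.sphere_subset_closedBall hz))
    refine DifferentiableOn.diffContOnCl ?_
    rw [closure_ball _ hr4.ne']
    exact hy.1.mono (hsub k hk)
  have hdat : ∀ᵐ y ∂μ, ∀ k ∈ Metric.ball k₀ (r / 2),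
      HasDerivAt (fun k => F k y) (deriv (fun k => F k y) k) k := by
    filter_upwards [hF] with y hy k hk
    exact (hy.1.differentiableAt (hU.mem_nhds
      (hsub k hk (Metric.mem_closedBall_self hr4.le)))).hasDerivAt
  -- Measurability of the derivative: it is an almost everywhere limit of difference quotients along
  -- a sequence of increments tending to 0.
  have hmeas : AEStronglyMeasurable (fun y => deriv (fun k => F k y) k₀) μ := by
    let s : ℕ → ℂ := fun n => ((r / 4 * (1 / ((n : ℝ) + 1)) : ℝ) : ℂ)
    have hs : Tendsto s atTop (𝓝 0) := by
      have := (tendsto_one_div_add_atTop_nhds_zero_nat (𝕜 := ℝ)).const_mul (r / 4)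
      rw [mul_zero] at this
      exact (Complex.continuous_ofReal.tendsto' 0 0 (by simp)).comp this
    have hs0 : ∀ n, s n ≠ 0 := fun n => by
      have : (r / 4 * (1 / ((n : ℝ) + 1)) : ℝ) ≠ 0 := by positivity
      exact Complex.ofReal_ne_zero.2 this
    have hsU : ∀ n, k₀ + s n ∈ U := fun n => by
      refine hsub k₀ (Metric.mem_ball_self hr2) ?_
      rw [Metric.mem_closedBall, dist_eq_norm, add_sub_cancel_left, Complex.norm_real,
        Real.norm_of_nonneg (by positivity)]
      refine mul_le_of_le_one_right hr4.le ?_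
      rw [div_le_one (by positivity)]
      linarith [n.cast_nonneg (α := ℝ)]
    refine aestronglyMeasurable_of_tendsto_ae (u := atTop)
      (f := fun (n : ℕ) y => (s n)⁻¹ • (F (k₀ + s n) y - F k₀ y)) (fun n => ?_) ?_
    · exact AEStronglyMeasurable.const_smul ((hm _ (hsU n)).sub (hm _ hk₀)) (s n)⁻¹
    · filter_upwards [hdat] with y hy
      have h1 := (hy k₀ (Metric.mem_ball_self hr2)).tendsto_slope_zero
      refine h1.comp (tendsto_nhdsWithin_iff.2 ⟨hs, Eventually.of_forall hs0⟩)
  refine (hasDerivAt_integral_of_dominated_loc_of_deriv_le (Metric.ball_mem_nhds k₀ hr2)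
    (F' := fun k y => deriv (fun k => F k y) k) (bound := fun y => b y / (r / 4))
    ?_ ?_ hmeas hder (hb.div_const _) hdat).2.differentiableAt.differentiableWithinAt
  · filter_upwards [hU.mem_nhds hk₀] with k hk using hm k hk
  · exact hb.mono' (hm k₀ hk₀) (by filter_upwards [hF] with y hy using hy.2 k₀ hk₀)

/-! ### Exponentially decaying potentials and the modulated Volterra kernel. -/

/-- A continuous function dominated by `N e^{-β|x|}`. -/
structure IsExpDecaying (N β : ℝ) (V : ℝ → ℂ) : Prop where
  rate_pos : 0 < β
  continuous : Continuous V
  bound : ∀ x, ‖V x‖ ≤ N * Real.exp (-(β * |x|))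

namespace IsExpDecaying

variable {N β : ℝ} {V : ℝ → ℂ}

theorem nonneg (h : IsExpDecaying N β V) : 0 ≤ N := by
  simpa using (norm_nonneg _).trans (h.bound 0)

theorem bound_right (h : IsExpDecaying N β V) (x : ℝ) : ‖V x‖ ≤ N * Real.exp (-(β * x)) :=
  (h.bound x).trans (mul_le_mul_of_nonneg_left (Real.exp_le_exp.2 (neg_le_neg
    (mul_le_mul_of_nonneg_left (le_abs_self x) h.rate_pos.le))) h.nonneg)

theorem comp_neg (h : IsExpDecaying N β V) : IsExpDecaying N β (fun x => V (-x)) :=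
  ⟨h.rate_pos, h.continuous.comp continuous_neg, fun x => by simpa using h.bound (-x)⟩

end IsExpDecaying

/-- The kernel `(e^{2iks} - 1)/(2ik)` of the Volterra equation for `e^{-ikx} f_+(x;k)`. -/
noncomputable def modKernel (k : ℂ) (s : ℝ) : ℂ :=
  (Complex.exp (2 * Complex.I * k * s) - 1) / (2 * Complex.I * k)

/-- `∫_x^∞ e^{2ik(y-x)} g(y) dy`. -/
noncomputable def expTail (k : ℂ) (g : ℝ → ℂ) (x : ℝ) : ℂ :=
  ∫ y in Ioi x, Complex.exp (2 * Complex.I * k * (y - x : ℝ)) * g y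

theorem norm_exp_two_I_mul_le {k : ℂ} (hk : 0 ≤ k.im) {s : ℝ} (hs : 0 ≤ s) :
    ‖Complex.exp (2 * Complex.I * k * s)‖ ≤ 1 := by
  rw [Complex.norm_exp, Real.exp_le_one_iff]
  simp
  positivity

/-- The bound does not grow with s, at the price of degenerating as k → 0. -/
theorem norm_modKernel_le {k : ℂ} (hk : 0 ≤ k.im) {s : ℝ} (hs : 0 ≤ s) :
    ‖modKernel k s‖ ≤ 1 / ‖k‖ := by
  rw [modKernel, norm_div]
  have h1 : ‖Complex.exp (2 * Complex.I * k * s) - 1‖ ≤ 2 := by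
    refine (norm_sub_le _ _).trans ?_
    have := norm_exp_two_I_mul_le hk hs
    rw [norm_one]; linarith
  have h2 : ‖2 * Complex.I * k‖ = 2 * ‖k‖ := by simp
  rw [h2]
  rcases (norm_nonneg k).eq_or_lt with h0 | h0
  · simp [← h0]
  · rw [div_le_div_iff₀ (by positivity) h0]
    nlinarith

theorem continuous_modKernel (k : ℂ) : Continuous (modKernel k) := by
  unfold modKernel; fun_prop

theorem integrableOn_exp_mul {k : ℂ} (hk : 0 ≤ k.im) {g : ℝ → ℂ} {x : ℝ}
    (hi : IntegrableOn g (Ioi x)) :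
    IntegrableOn (fun y : ℝ => Complex.exp (2 * Complex.I * k * (y - x : ℝ)) * g y) (Ioi x) := by
  refine Integrable.bdd_mul (c := 1) hi (by fun_prop) ?_
  exact (ae_restrict_iff' measurableSet_Ioi).2 (Eventually.of_forall fun y hy =>
    norm_exp_two_I_mul_le hk (sub_nonneg.2 (le_of_lt hy)))

theorem integrableOn_modKernel_mul {k : ℂ} (hk : 0 ≤ k.im) {g : ℝ → ℂ} {x : ℝ}
    (hi : IntegrableOn g (Ioi x)) :
    IntegrableOn (fun y : ℝ => modKernel k (y - x) * g y) (Ioi x) := by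
  refine Integrable.bdd_mul (c := 1 / ‖k‖) hi
    ((continuous_modKernel k).comp (continuous_sub_right x)).aestronglyMeasurable ?_
  exact (ae_restrict_iff' measurableSet_Ioi).2 (Eventually.of_forall fun y hy =>
    norm_modKernel_le hk (sub_nonneg.2 (le_of_lt hy)))

theorem norm_expTail_le {k : ℂ} (hk : 0 ≤ k.im) {g : ℝ → ℂ} {x B c : ℝ} (hc : 0 < c)
    (h : ∀ y, x < y → ‖g y‖ ≤ B * Real.exp (-(c * y))) :
    ‖expTail k g x‖ ≤ B * (Real.exp (-(c * x)) / c) := by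
  refine norm_integral_Ioi_le_of_exp_bound hc fun y hy => ?_
  rw [norm_mul]
  exact (mul_le_of_le_one_left (norm_nonneg _)
    (norm_exp_two_I_mul_le hk (sub_nonneg.2 hy.le))).trans (h y hy)

theorem hasDerivAt_expTail {k : ℂ} (hk : 0 ≤ k.im) {g : ℝ → ℂ} (hg : Continuous g)
    (hi : ∀ x, IntegrableOn g (Ioi x)) (x : ℝ) :
    HasDerivAt (expTail k g) (-g x - 2 * Complex.I * k * expTail k g x) x := by
  have hi' : ∀ x, IntegrableOn (fun y : ℝ => Complex.exp (2 * Complex.I * k * y) * g y) (Ioi x) := by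
    intro z
    have := (integrableOn_exp_mul hk (hi z)).const_mul (Complex.exp (2 * Complex.I * k * z))
    refine this.congr (Eventually.of_forall fun y => ?_)
    simp only
    rw [← mul_assoc, ← Complex.exp_add]
    congr 2
    push_cast; ring
  have e : ∀ z, expTail k g z = Complex.exp (-(2 * Complex.I * k * z)) *
      ∫ y in Ioi z, Complex.exp (2 * Complex.I * k * y) * g y := by
    intro z
    rw [expTail, ← integral_const_mul]
    congr 1 with y
    rw [← mul_assoc, ← Complex.exp_add]
    congr 2
    push_cast; ring
  have h1 := hasDerivAt_integral_Ioi (by fun_prop : Continuous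
    (fun y : ℝ => Complex.exp (2 * Complex.I * k * y) * g y)) hi' x
  have h2 : HasDerivAt (fun z : ℝ => Complex.exp (-(2 * Complex.I * k * z)))
      (Complex.exp (-(2 * Complex.I * k * x)) * -(2 * Complex.I * k * 1)) x :=
    (((hasDerivAt_id (x : ℂ)).const_mul (2 * Complex.I * k)).neg.cexp).comp_ofReal
  rw [funext e]
  refine (h2.mul h1).congr_deriv ?_
  have h3 : Complex.exp (-(2 * Complex.I * k * x)) * Complex.exp (2 * Complex.I * k * x) = 1 := by
    rw [← Complex.exp_add]; simp
  linear_combination -(g x) * h3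

theorem integral_modKernel_mul {k : ℂ} (hk : 0 ≤ k.im) {g : ℝ → ℂ} {x : ℝ}
    (hi : IntegrableOn g (Ioi x)) :
    ∫ y in Ioi x, modKernel k (y - x) * g y =
      (expTail k g x - ∫ y in Ioi x, g y) / (2 * Complex.I * k) := by
  rw [expTail, ← integral_sub (integrableOn_exp_mul hk hi) hi, ← integral_div]
  congr 1 with y
  rw [modKernel]; ring

/-- The kernel vanishes at s = 0, so the moving endpoint contributes nothing: the two terms g(x)
coming from the split of the kernel cancel. -/
theorem hasDerivAt_integral_modKernel {k : ℂ} (hk : 0 < k.im) {g : ℝ → ℂ} (hg : Continuous g)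
    (hi : ∀ x, IntegrableOn g (Ioi x)) (x : ℝ) :
    HasDerivAt (fun x => ∫ y in Ioi x, modKernel k (y - x) * g y) (-expTail k g x) x := by
  have hk0 : k ≠ 0 := by rintro rfl; simp at hk
  rw [funext fun z => integral_modKernel_mul hk.le (hi z)]
  refine (((hasDerivAt_expTail hk.le hg hi x).sub
    (hasDerivAt_integral_Ioi hg hi x)).div_const (2 * Complex.I * k)).congr_deriv ?_
  rw [div_eq_iff (by simp [hk0])]
  ring

/-! ### The Volterra series -/

/-- The terms of the Neumann series of `m(x) = 1 + ∫_x^∞ modKernel k (y-x) V(y) m(y) dy`. -/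
noncomputable def volterraTerm (V : ℝ → ℂ) (k : ℂ) : ℕ → ℝ → ℂ
  | 0 => fun _ => 1
  | n + 1 => fun x => ∫ y in Ioi x, modKernel k (y - x) * (V y * volterraTerm V k n y)

/-- The modulated Jost solution `m(x;k) = e^{-ikx} f_+(x;k)`. -/
noncomputable def modJost (V : ℝ → ℂ) (k : ℂ) (x : ℝ) : ℂ :=
  ∑' n, volterraTerm V k n x

section Volterra

variable {N β : ℝ} {V : ℝ → ℂ} {k : ℂ}

theorem norm_mul_le_of_exp_bound (hV : IsExpDecaying N β V) {a : ℂ} {y B c : ℝ}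
    (ha : ‖a‖ ≤ B * Real.exp (-(c * y))) :
    ‖V y * a‖ ≤ N * B * Real.exp (-((c + β) * y)) := by
  rw [norm_mul]
  have h := mul_le_mul (hV.bound_right y) ha (norm_nonneg _)
    (mul_nonneg hV.nonneg (Real.exp_nonneg _))
  refine h.trans_eq ?_
  rw [show -((c + β) * y) = -(β * y) + -(c * y) by ring, Real.exp_add]
  ring

theorem norm_integral_modKernel_le (hV : IsExpDecaying N β V) (hk : 0 ≤ k.im) {a : ℝ → ℂ}
    {x B c : ℝ} (hc : 0 ≤ c) (ha : ∀ y, x < y → ‖a y‖ ≤ B * Real.exp (-(c * y))) :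
    ‖∫ y in Ioi x, modKernel k (y - x) * (V y * a y)‖ ≤
      N * B / ‖k‖ * (Real.exp (-((c + β) * x)) / (c + β)) := by
  refine norm_integral_Ioi_le_of_exp_bound (by linarith [hV.rate_pos]) fun y hy => ?_
  rw [norm_mul]
  refine (mul_le_mul (norm_modKernel_le hk (sub_nonneg.2 hy.le))
    (norm_mul_le_of_exp_bound hV (ha y hy)) (norm_nonneg _) (by positivity)).trans_eq ?_
  ring

/-- The size `(N/(|k|β))^n / n!` of the `n`-th Volterra term. -/
noncomputable def volterraCoeff (N β r : ℝ) (n : ℕ) : ℝ := (N / (r * β)) ^ n / n.factorial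

theorem volterraCoeff_nonneg (hN : 0 ≤ N) (hβ : 0 ≤ β) {r : ℝ} (hr : 0 ≤ r) (n : ℕ) :
    0 ≤ volterraCoeff N β r n := by
  unfold volterraCoeff; positivity

theorem volterraCoeff_succ (hβ : 0 < β) {r : ℝ} (hr : 0 < r) (n : ℕ) :
    volterraCoeff N β r (n + 1) = N * volterraCoeff N β r n / r / (n * β + β) := by
  unfold volterraCoeff
  rw [Nat.factorial_succ, pow_succ]
  push_cast
  have : (n.factorial : ℝ) ≠ 0 := by positivity
  have : (n : ℝ) + 1 ≠ 0 := by positivity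
  have : (n : ℝ) * β + β ≠ 0 := by positivity
  field_simp

/-- Each use of the Volterra operator integrates e^{-(n+1)βy}, and the divisor (n+1)β is the source
of the factorial. The functions `a` and `b` are general so that the bound serves both the terms of
the series and the uniqueness proof. -/
theorem volterra_iterate_bound (hV : IsExpDecaying N β V) (hk : 0 < k.im) {a b : ℝ → ℂ} {n : ℕ}
    {x B : ℝ}
    (ha : ∀ y, x < y → ‖a y‖ ≤ B * volterraCoeff N β ‖k‖ n * Real.exp (-(n * β * y)))
    (hb : b x = ∫ y in Ioi x, modKernel k (y - x) * (V y * a y)) :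
    ‖b x‖ ≤ B * volterraCoeff N β ‖k‖ (n + 1) * Real.exp (-((n + 1 : ℕ) * β * x)) := by
  have hk0 : 0 < ‖k‖ := norm_pos_iff.2 (by rintro rfl; simp at hk)
  have hβ := hV.rate_pos
  rw [hb]
  refine (norm_integral_modKernel_le hV hk.le (by positivity) ha).trans_eq ?_
  rw [volterraCoeff_succ hβ hk0, show ((n + 1 : ℕ) : ℝ) * β * x = (n * β + β) * x by
    push_cast; ring]
  ring

theorem norm_volterraTerm_le (hV : IsExpDecaying N β V) (hk : 0 < k.im) (n : ℕ) (x : ℝ) :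
    ‖volterraTerm V k n x‖ ≤ volterraCoeff N β ‖k‖ n * Real.exp (-(n * β * x)) := by
  induction n generalizing x with
  | zero => simp [volterraTerm, volterraCoeff]
  | succ n ih =>
    have := volterra_iterate_bound hV hk (a := volterraTerm V k n) (b := volterraTerm V k (n + 1))
      (n := n) (x := x) (B := 1) (fun y _ => by simpa using ih y) rfl
    simpa using this

theorem integrableOn_of_exp_bound_mul (hV : IsExpDecaying N β V) {a : ℝ → ℂ} (ha : Continuous a)
    {x B c : ℝ} (hc : 0 ≤ c) (hb : ∀ y, x < y → ‖a y‖ ≤ B * Real.exp (-(c * y))) :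
    IntegrableOn (fun y => V y * a y) (Ioi x) :=
  integrableOn_Ioi_of_exp_bound (c := c + β) (by linarith [hV.rate_pos])
    (hV.continuous.mul ha) fun y hy => norm_mul_le_of_exp_bound hV (hb y hy)

theorem continuous_volterraTerm (hV : IsExpDecaying N β V) (hk : 0 < k.im) (n : ℕ) :
    Continuous (volterraTerm V k n) := by
  induction n with
  | zero => exact continuous_const
  | succ n ih =>
    have hβ := hV.rate_pos
    refine continuous_iff_continuousAt.2 fun x => (hasDerivAt_integral_modKernel hk
      (hV.continuous.mul ih) (fun x => ?_) x).continuousAt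
    exact integrableOn_of_exp_bound_mul hV ih (c := n * β) (by positivity)
      fun y _ => norm_volterraTerm_le hV hk n y

theorem summable_volterraCoeff_mul_exp (N β r x : ℝ) :
    Summable fun n : ℕ => volterraCoeff N β r n * Real.exp (-(n * β * x)) := by
  refine (Real.summable_pow_div_factorial (N / (r * β) * Real.exp (-(β * x)))).congr fun n => ?_
  rw [volterraCoeff, mul_pow, ← Real.exp_nat_mul]
  rw [show (n : ℝ) * -(β * x) = -(n * β * x) by ring]
  ring

theorem exp_neg_nat_mul_le (hβ : 0 < β) {x y : ℝ} (h : x ≤ y) (n : ℕ) :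
    Real.exp (-(n * β * y)) ≤ Real.exp (-(n * β * x)) :=
  Real.exp_le_exp.2 (neg_le_neg (mul_le_mul_of_nonneg_left h (by positivity)))

theorem norm_volterraTerm_le_of_le (hV : IsExpDecaying N β V) (hk : 0 < k.im) (n : ℕ) {x y : ℝ}
    (h : x ≤ y) : ‖volterraTerm V k n y‖ ≤ volterraCoeff N β ‖k‖ n * Real.exp (-(n * β * x)) :=
  (norm_volterraTerm_le hV hk n y).trans (mul_le_mul_of_nonneg_left
    (exp_neg_nat_mul_le hV.rate_pos h n)
    (volterraCoeff_nonneg hV.nonneg hV.rate_pos.le (norm_nonneg _) n))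

theorem summable_volterraTerm (hV : IsExpDecaying N β V) (hk : 0 < k.im) (x : ℝ) :
    Summable fun n => volterraTerm V k n x :=
  Summable.of_norm_bounded (summable_volterraCoeff_mul_exp N β ‖k‖ x)
    fun n => norm_volterraTerm_le hV hk n x

theorem continuous_modJost (hV : IsExpDecaying N β V) (hk : 0 < k.im) :
    Continuous (modJost V k) := by
  refine continuous_iff_continuousAt.2 fun x => ?_
  have h : ContinuousOn (modJost V k) (Ici (x - 1)) :=
    continuousOn_tsum (fun n => (continuous_volterraTerm hV hk n).continuousOn)
      (summable_volterraCoeff_mul_exp N β ‖k‖ (x - 1))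
      fun n y hy => norm_volterraTerm_le_of_le hV hk n hy
  exact h.continuousAt (Ici_mem_nhds (by linarith))

/-- A bound for `‖m(y;k)‖` on `[x, ∞)`. -/
noncomputable def modJostBound (N β r x : ℝ) : ℝ :=
  ∑' n : ℕ, volterraCoeff N β r n * Real.exp (-(n * β * x))

theorem norm_modJost_le (hV : IsExpDecaying N β V) (hk : 0 < k.im) {x y : ℝ} (h : x ≤ y) :
    ‖modJost V k y‖ ≤ modJostBound N β ‖k‖ x :=
  tsum_of_norm_bounded (summable_volterraCoeff_mul_exp N β ‖k‖ x).hasSum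
    fun n => norm_volterraTerm_le_of_le hV hk n h

theorem integrableOn_mul_modJost (hV : IsExpDecaying N β V) (hk : 0 < k.im) (x : ℝ) :
    IntegrableOn (fun y => V y * modJost V k y) (Ioi x) :=
  integrableOn_of_exp_bound_mul hV (continuous_modJost hV hk) le_rfl
    (B := modJostBound N β ‖k‖ x) fun y hy => by simpa using norm_modJost_le hV hk hy.le

theorem modJost_eq (hV : IsExpDecaying N β V) (hk : 0 < k.im) (x : ℝ) :
    modJost V k x = 1 + ∫ y in Ioi x, modKernel k (y - x) * (V y * modJost V k y) := by
  have hβ := hV.rate_pos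
  have hint : ∀ n, IntegrableOn (fun y => modKernel k (y - x) * (V y * volterraTerm V k n y))
      (Ioi x) := fun n => integrableOn_modKernel_mul hk.le (integrableOn_of_exp_bound_mul hV
        (continuous_volterraTerm hV hk n) (c := n * β) (by positivity)
        fun y _ => norm_volterraTerm_le hV hk n y)
  have hs := hasSum_integral_of_summable_integral_norm hint ?_
  · rw [modJost, (summable_volterraTerm hV hk x).tsum_eq_zero_add]
    congr 1
    change ∑' n, ∫ y in Ioi x, modKernel k (y - x) * (V y * volterraTerm V k n y) = _
    rw [hs.tsum_eq]
    congr 1 with y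
    rw [tsum_mul_left, tsum_mul_left, modJost]
  · refine Summable.of_nonneg_of_le (fun n => integral_nonneg fun y => norm_nonneg _) (fun n => ?_)
      ((summable_volterraCoeff_mul_exp N β ‖k‖ x).mul_left
        (1 / ‖k‖ * N * (Real.exp (-(β * x)) / β)))
    have hle : ∀ y ∈ Ioi x, ‖modKernel k (y - x) * (V y * volterraTerm V k n y)‖ ≤
        1 / ‖k‖ * N * (volterraCoeff N β ‖k‖ n * Real.exp (-(n * β * x))) *
          Real.exp (-(β * y)) := fun y hy => by
      rw [norm_mul, norm_mul]
      calc _ ≤ 1 / ‖k‖ * (N * Real.exp (-(β * y)) *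
            (volterraCoeff N β ‖k‖ n * Real.exp (-(n * β * x)))) := by
            gcongr
            · exact norm_modKernel_le hk.le (sub_nonneg.2 (le_of_lt hy))
            · exact mul_nonneg hV.nonneg (Real.exp_nonneg _)
            · exact hV.bound_right y
            · exact norm_volterraTerm_le_of_le hV hk n (le_of_lt hy)
        _ = _ := by ring
    calc _ ≤ ∫ y in Ioi x, 1 / ‖k‖ * N * (volterraCoeff N β ‖k‖ n * Real.exp (-(n * β * x))) *
          Real.exp (-(β * y)) := setIntegral_mono_on (hint n).norm
            ((integrableOn_exp_neg_mul_Ioi hβ x).const_mul _) measurableSet_Ioi hle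
      _ = _ := by rw [integral_const_mul, integral_exp_neg_mul_Ioi hβ]; ring

/-- The negative derivative of `m(·;k)`. -/
noncomputable def modJostTail (V : ℝ → ℂ) (k : ℂ) (x : ℝ) : ℂ :=
  expTail k (fun y => V y * modJost V k y) x

theorem hasDerivAt_modJost (hV : IsExpDecaying N β V) (hk : 0 < k.im) (x : ℝ) :
    HasDerivAt (modJost V k) (-modJostTail V k x) x := by
  have := (hasDerivAt_integral_modKernel (g := fun y => V y * modJost V k y) hk
    (hV.continuous.mul (continuous_modJost hV hk)) (integrableOn_mul_modJost hV hk) x).const_add 1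
  rwa [← funext (modJost_eq hV hk)] at this

theorem hasDerivAt_modJostTail (hV : IsExpDecaying N β V) (hk : 0 < k.im) (x : ℝ) :
    HasDerivAt (modJostTail V k)
      (-(V x * modJost V k x) - 2 * Complex.I * k * modJostTail V k x) x :=
  hasDerivAt_expTail hk.le (hV.continuous.mul (continuous_modJost hV hk))
    (integrableOn_mul_modJost hV hk) x

theorem norm_modJostTail_le (hV : IsExpDecaying N β V) (hk : 0 < k.im) {x y : ℝ} (h : x ≤ y) :
    ‖modJostTail V k y‖ ≤ N * modJostBound N β ‖k‖ x * (Real.exp (-(β * y)) / β) := by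
  refine norm_expTail_le hk.le hV.rate_pos fun z hz => ?_
  simpa using norm_mul_le_of_exp_bound hV (c := 0)
    (by simpa using norm_modJost_le hV hk (h.trans hz.le))

theorem norm_modJost_sub_one_le (hV : IsExpDecaying N β V) (hk : 0 < k.im) {x y : ℝ} (h : x ≤ y) :
    ‖modJost V k y - 1‖ ≤ N * modJostBound N β ‖k‖ x / ‖k‖ * (Real.exp (-(β * y)) / β) := by
  rw [modJost_eq hV hk y, add_sub_cancel_left]
  simpa using norm_integral_modKernel_le hV hk.le (c := 0) le_rfl (x := y)
    (B := modJostBound N β ‖k‖ x)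
    fun z hz => by simpa using norm_modJost_le hV hk (h.trans hz.le)

end Volterra

/-! ### Jost solutions and their Wronskian in the upper half plane. -/

section Jost

variable {N β : ℝ} {V : ℝ → ℂ} {k : ℂ}

theorem ne_zero_of_im_pos (hk : 0 < k.im) : k ≠ 0 := by
  rintro rfl; simp at hk

/-- Factoring out e^{ikx} replaces the sine kernel, which grows with s when Im k > 0, by a bounded
one. -/
theorem volterraKernel_mul_exp (hk : k ≠ 0) (s : ℝ) :
    volterraKernel k s * Complex.exp (Complex.I * k * s) = modKernel k s := by
  rw [volterraKernel, if_neg hk, modKernel, Complex.sin]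
  have h1 : Complex.exp (2 * Complex.I * k * s) =
      Complex.exp (Complex.I * k * s) * Complex.exp (Complex.I * k * s) := by
    rw [← Complex.exp_add]; congr 1; ring
  have h2 : Complex.exp (-(k * s) * Complex.I) * Complex.exp (Complex.I * k * s) = 1 := by
    rw [← Complex.exp_add, ← Complex.exp_zero]; congr 1; ring
  have h3 : Complex.exp (k * s * Complex.I) = Complex.exp (Complex.I * k * s) := by
    congr 1; ring
  rw [h1, h3]
  have hI := Complex.I_ne_zero
  generalize Complex.exp (Complex.I * k * s) = a at *
  generalize Complex.exp (-(k * s) * Complex.I) = b at *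
  field_simp
  linear_combination Complex.I ^ 2 * h2 + (1 - a ^ 2) * Complex.I_sq

theorem volterraKernel_mul_modulated (hk : k ≠ 0) (x y : ℝ) (v a : ℂ) :
    volterraKernel k (y - x) * v * (Complex.exp (Complex.I * k * y) * a) =
      Complex.exp (Complex.I * k * x) * (modKernel k (y - x) * (v * a)) := by
  rw [← volterraKernel_mul_exp hk,
    show Complex.I * k * y = Complex.I * k * x + Complex.I * k * (y - x : ℝ) by push_cast; ring,
    Complex.exp_add]
  ring

theorem isJostPlus_modulated_iff (hk : k ≠ 0) (n : ℝ → ℂ) :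
    IsJostPlus V k (fun x : ℝ => Complex.exp (Complex.I * k * x) * n x) ↔
      Continuous n ∧ (∀ x, IntegrableOn (fun y => modKernel k (y - x) * (V y * n y)) (Ioi x)) ∧
      ∀ x, n x = 1 + ∫ y in Ioi x, modKernel k (y - x) * (V y * n y) := by
  have hc : Continuous n ↔ Continuous (fun x : ℝ => Complex.exp (Complex.I * k * x) * n x) := by
    refine ⟨fun h => by fun_prop, fun h => ?_⟩
    have : Continuous (fun x : ℝ => Complex.exp (-(Complex.I * k * x)) *
      (Complex.exp (Complex.I * k * x) * n x)) := by fun_prop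
    refine this.congr fun x => ?_
    rw [← mul_assoc, ← Complex.exp_add]; simp
  have hi : ∀ x : ℝ, IntegrableOn (fun y : ℝ => volterraKernel k (y - x) * V y *
      (Complex.exp (Complex.I * k * y) * n y)) (Ioi x) ↔
      IntegrableOn (fun y => modKernel k (y - x) * (V y * n y)) (Ioi x) := fun x => by
    simp only [volterraKernel_mul_modulated hk]
    exact integrable_const_mul_iff (Complex.exp_ne_zero _).isUnit _
  have hv : ∀ x : ℝ, (Complex.exp (Complex.I * k * x) * n x = Complex.exp (Complex.I * k * x) +
      ∫ y in Ioi x, volterraKernel k (y - x) * V y * (Complex.exp (Complex.I * k * y) * n y)) ↔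
      n x = 1 + ∫ y in Ioi x, modKernel k (y - x) * (V y * n y) := fun x => by
    simp only [volterraKernel_mul_modulated hk]
    rw [integral_const_mul]
    have h0 := Complex.exp_ne_zero (Complex.I * k * x)
    rw [← mul_right_inj' h0 (b := n x), mul_add, mul_one]
  exact ⟨fun h => ⟨hc.2 h.continuous, fun x => (hi x).1 (h.integrable x),
    fun x => (hv x).1 (h.volterra x)⟩, fun h => ⟨hc.1 h.1, fun x => (hi x).2 (h.2.1 x),
    fun x => (hv x).2 (h.2.2 x)⟩⟩

theorem isJostPlus_modJost (hV : IsExpDecaying N β V) (hk : 0 < k.im) :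
    IsJostPlus V k (fun x : ℝ => Complex.exp (Complex.I * k * x) * modJost V k x) :=
  (isJostPlus_modulated_iff (ne_zero_of_im_pos hk) _).2 ⟨continuous_modJost hV hk,
    fun x => integrableOn_modKernel_mul hk.le (integrableOn_mul_modJost hV hk x), modJost_eq hV hk⟩

theorem sin_ne_zero_of_im_pos (hk : 0 < k.im) : Complex.sin k ≠ 0 := by
  intro h
  obtain ⟨n, hn⟩ := Complex.sin_eq_zero_iff.1 h
  have := congrArg Complex.im hn
  simp at this
  linarith

/-- Two translates of the sine kernel combine into a pure exponential. As sin k ≠ 0 for Im k > 0,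
integrability of the Volterra integrands at the base points x and x - 1 gives integrability of
e^{-iky} V f on (x, ∞). Uniqueness of the Jost solution therefore needs no growth condition beyond
`IsJostPlus`. -/
theorem volterraKernel_shift (hk : k ≠ 0) (s : ℝ) :
    Complex.sin k * Complex.exp (-(Complex.I * k * s)) =
      k * (volterraKernel k (s + 1) - Complex.exp (Complex.I * k) * volterraKernel k s) := by
  simp only [volterraKernel, if_neg hk]
  have h1 : Complex.exp (Complex.I * k) = Complex.cos k + Complex.sin k * Complex.I := by
    rw [mul_comm, Complex.exp_mul_I]
  have h2 : Complex.exp (-(Complex.I * k * s)) =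
      Complex.cos (k * s) - Complex.sin (k * s) * Complex.I := by
    rw [show -(Complex.I * k * s) = (-(k * s)) * Complex.I by ring, Complex.exp_mul_I,
      Complex.cos_neg, Complex.sin_neg]
    ring
  have h3 : Complex.sin (k * (s + 1 : ℝ)) =
      Complex.sin (k * s) * Complex.cos k + Complex.cos (k * s) * Complex.sin k := by
    rw [← Complex.sin_add]; congr 1; push_cast; ring
  rw [h1, h2, h3]
  field_simp
  ring

/-- A solution of the homogeneous modulated Volterra equation vanishes. -/
theorem eq_zero_of_volterra (hV : IsExpDecaying N β V) (hk : 0 < k.im) {h : ℝ → ℂ}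
    (hi : ∀ x, IntegrableOn (fun y => V y * h y) (Ioi x))
    (he : ∀ x, h x = ∫ y in Ioi x, modKernel k (y - x) * (V y * h y)) (x : ℝ) : h x = 0 := by
  -- Integrability of V h first gives a uniform bound on [x, ∞). Iterating the equation n times then
  -- bounds h by B times the n-th term of a convergent series, which tends to 0.
  set B := 1 / ‖k‖ * ∫ y in Ioi x, ‖V y * h y‖ with hB
  have hb : ∀ y, x ≤ y → ‖h y‖ ≤ B := fun y hy => by
    rw [he y, hB, ← integral_const_mul]
    refine (norm_integral_le_of_norm_le (((hi y).norm).const_mul (1 / ‖k‖))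
      ((ae_restrict_iff' measurableSet_Ioi).2 (Eventually.of_forall fun z hz => ?_))).trans ?_
    · rw [norm_mul]
      exact mul_le_mul_of_nonneg_right (norm_modKernel_le hk.le (sub_nonneg.2 (le_of_lt hz)))
        (norm_nonneg _)
    · exact setIntegral_mono_set (((hi x).norm).const_mul _)
        (Eventually.of_forall fun z => by simp only [Pi.zero_apply]; positivity)
        (Ioi_subset_Ioi hy).eventuallyLE
  have hn : ∀ n : ℕ, ∀ y, x ≤ y →
      ‖h y‖ ≤ B * volterraCoeff N β ‖k‖ n * Real.exp (-(n * β * y)) := by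
    intro n
    induction n with
    | zero => intro y hy; simpa [volterraCoeff] using hb y hy
    | succ n ih =>
      intro y hy
      exact volterra_iterate_bound hV hk (a := h) (b := h) (fun z hz => ih z (hy.trans hz.le)) (he y)
  have ht := ((summable_volterraCoeff_mul_exp N β ‖k‖ x).tendsto_atTop_zero).const_mul B
  rw [mul_zero] at ht
  refine norm_le_zero_iff.1 (ge_of_tendsto' ht fun n => ?_)
  rw [← mul_assoc]
  exact hn n x le_rfl

theorem IsJostPlus.eq_modulated (hV : IsExpDecaying N β V) (hk : 0 < k.im) {f : ℝ → ℂ}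
    (hf : IsJostPlus V k f) : f = fun x : ℝ => Complex.exp (Complex.I * k * x) * modJost V k x := by
  have hk0 := ne_zero_of_im_pos hk
  set n : ℝ → ℂ := fun x => Complex.exp (-(Complex.I * k * x)) * f x with hn
  have hfn : f = fun x : ℝ => Complex.exp (Complex.I * k * x) * n x := by
    funext x
    rw [hn]
    simp only
    rw [← mul_assoc, ← Complex.exp_add]; simp
  have hVn : ∀ x, IntegrableOn (fun y => V y * n y) (Ioi x) := fun x => by
    have h1 := (hf.integrable (x - 1)).mono_set (Ioi_subset_Ioi (sub_le_self x zero_le_one))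
    have h2 := (hf.integrable x).const_mul (Complex.exp (Complex.I * k))
    refine ((h1.sub h2).const_mul (Complex.exp (-(Complex.I * k * x)) * k / Complex.sin k)).congr
      (Eventually.of_forall fun y => ?_)
    have h3 := volterraKernel_shift hk0 (y - x)
    rw [show y - x + 1 = y - (x - 1) by ring] at h3
    have h4 : Complex.exp (-(Complex.I * k * y)) =
        Complex.exp (-(Complex.I * k * x)) * Complex.exp (-(Complex.I * k * (y - x : ℝ))) := by
      rw [← Complex.exp_add]; congr 1; push_cast; ring
    have hs := sin_ne_zero_of_im_pos hk
    simp only [hn, Pi.sub_apply, h4]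
    field_simp
    linear_combination (-(V y * f y)) * h3
  rw [hfn] at hf
  obtain ⟨-, -, hv⟩ := (isJostPlus_modulated_iff hk0 n).1 hf
  rw [hfn]
  funext x
  congr 1
  have h0 := eq_zero_of_volterra hV hk (h := fun x => n x - modJost V k x)
    (fun x => by
      simp only [mul_sub]
      exact (hVn x).sub (integrableOn_mul_modJost hV hk x)) (fun x => by
      simp only [mul_sub]
      rw [integral_sub (integrableOn_modKernel_mul hk.le (hVn x))
        (integrableOn_modKernel_mul hk.le (integrableOn_mul_modJost hV hk x)), hv x,
        modJost_eq hV hk x]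
      ring) x
  exact sub_eq_zero.1 h0

theorem jostPlus_eq (hV : IsExpDecaying N β V) (hk : 0 < k.im) :
    jostPlus V k = fun x : ℝ => Complex.exp (Complex.I * k * x) * modJost V k x :=
  (Classical.epsilon_spec ⟨_, isJostPlus_modJost hV hk⟩ : IsJostPlus V k _).eq_modulated hV hk

theorem volterraKernel_neg (k : ℂ) (s : ℝ) : volterraKernel k (-s) = -volterraKernel k s := by
  unfold volterraKernel
  split_ifs
  · simp
  · simp [Complex.sin_neg, neg_div]

/-- Reflection exchanges the two ends of the line, so every property of f_- is read off from f_+ for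
the reflected potential. -/
theorem isJostMinus_iff (V : ℝ → ℂ) (k : ℂ) (f : ℝ → ℂ) :
    IsJostMinus V k f ↔ IsJostPlus (fun x => V (-x)) k (fun x => f (-x)) := by
  have hi : ∀ x, (fun y : ℝ => volterraKernel k (y - -x) * V y * f y) ∘ Neg.neg =
      fun y : ℝ => -(volterraKernel k (y - x) * V (-y) * f (-y)) := fun x => by
    funext y
    simp only [Function.comp]
    rw [show -y - -x = -(y - x) by ring, volterraKernel_neg]
    ring
  have h1 : ∀ x, IntegrableOn (fun y : ℝ => volterraKernel k (y - -x) * V y * f y) (Iio (-x)) ↔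
      IntegrableOn (fun y : ℝ => volterraKernel k (y - x) * V (-y) * f (-y)) (Ioi x) := fun x => by
    rw [← (Measure.measurePreserving_neg (volume : Measure ℝ)).integrableOn_comp_preimage
      (Homeomorph.neg ℝ).measurableEmbedding, hi]
    refine Iff.trans integrable_neg_iff ?_
    simp [IntegrableOn]
  have h2 : ∀ x, ∫ y in Iio (-x), volterraKernel k (y - -x) * V y * f y =
      -∫ y in Ioi x, volterraKernel k (y - x) * V (-y) * f (-y) := fun x => by
    rw [← integral_neg, ← (Measure.measurePreserving_neg (volume : Measure ℝ)).setIntegral_preimage_emb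
      (Homeomorph.neg ℝ).measurableEmbedding]
    simp only [neg_preimage, neg_Iio, neg_neg]
    exact integral_congr_ae (Eventually.of_forall fun y => congrFun (hi x) y)
  constructor
  · intro h
    refine ⟨h.continuous.comp continuous_neg, fun x => (h1 x).1 (h.integrable (-x)), fun x => ?_⟩
    rw [h.volterra (-x), h2 x, sub_neg_eq_add]
    simp
  · intro h
    refine ⟨by simpa [Function.comp_def] using h.continuous.comp continuous_neg,
      fun x => ?_, fun x => ?_⟩
    · simpa using (h1 (-x)).2 (h.integrable (-x))
    · have := h.volterra (-x)
      have h3 := h2 (-x)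
      simp only [neg_neg] at this h3
      rw [h3, this]
      simp

theorem jostMinus_eq (hV : IsExpDecaying N β V) (hk : 0 < k.im) :
    jostMinus V k =
      fun x : ℝ => Complex.exp (-(Complex.I * k * x)) * modJost (fun x => V (-x)) k (-x) := by
  have hex : IsJostMinus V k
      (fun x : ℝ => Complex.exp (-(Complex.I * k * x)) * modJost (fun x => V (-x)) k (-x)) := by
    rw [isJostMinus_iff]
    simpa using isJostPlus_modJost hV.comp_neg hk
  have hspec : IsJostMinus V k (jostMinus V k) := Classical.epsilon_spec ⟨_, hex⟩
  have h := ((isJostMinus_iff V k _).1 hspec).eq_modulated hV.comp_neg hk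
  funext x
  have := congrFun h (-x)
  simpa only [neg_neg, Complex.ofReal_neg, mul_neg] using this

theorem hasDerivAt_modulated (hV : IsExpDecaying N β V) (hk : 0 < k.im) (x : ℝ) :
    HasDerivAt (fun x : ℝ => Complex.exp (Complex.I * k * x) * modJost V k x)
      (Complex.exp (Complex.I * k * x) * (Complex.I * k * modJost V k x - modJostTail V k x)) x := by
  have h2 : HasDerivAt (fun z : ℝ => Complex.exp (Complex.I * k * z))
      (Complex.exp (Complex.I * k * x) * (Complex.I * k * 1)) x :=
    (((hasDerivAt_id (x : ℂ)).const_mul (Complex.I * k)).cexp).comp_ofReal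
  exact (h2.mul (hasDerivAt_modJost hV hk x)).congr_deriv (by ring)

theorem hasDerivAt_modulated_deriv (hV : IsExpDecaying N β V) (hk : 0 < k.im) (x : ℝ) :
    HasDerivAt (fun x : ℝ => Complex.exp (Complex.I * k * x) *
        (Complex.I * k * modJost V k x - modJostTail V k x))
      ((V x - k ^ 2) * (Complex.exp (Complex.I * k * x) * modJost V k x)) x := by
  have h2 : HasDerivAt (fun z : ℝ => Complex.exp (Complex.I * k * z))
      (Complex.exp (Complex.I * k * x) * (Complex.I * k * 1)) x :=
    (((hasDerivAt_id (x : ℂ)).const_mul (Complex.I * k)).cexp).comp_ofReal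
  refine (h2.mul (((hasDerivAt_modJost hV hk x).const_mul (Complex.I * k)).sub
    (hasDerivAt_modJostTail hV hk x))).congr_deriv ?_
  simp only [Pi.sub_apply]
  linear_combination k ^ 2 * Complex.exp (Complex.I * k * x) * modJost V k x * Complex.I_sq

/-- The Wronskian of the Jost solutions at `0`, in terms of the modulated Jost solutions. -/
noncomputable def jostWronskian (V : ℝ → ℂ) (k : ℂ) : ℂ :=
  -(modJost V k 0 * (Complex.I * k * modJost (fun x => V (-x)) k 0 -
      modJostTail (fun x => V (-x)) k 0)) -
    modJost (fun x => V (-x)) k 0 * (Complex.I * k * modJost V k 0 - modJostTail V k 0)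

theorem wronskian_jost (hV : IsExpDecaying N β V) (hk : 0 < k.im) :
    wronskian (jostPlus V k) (jostMinus V k) 0 = jostWronskian V k := by
  have h1 := hasDerivAt_modulated hV hk 0
  have h2 : HasDerivAt (jostMinus V k) (-(Complex.exp (Complex.I * k * (-0 : ℝ)) * (Complex.I * k *
      modJost (fun x => V (-x)) k (-0) - modJostTail (fun x => V (-x)) k (-0)))) 0 := by
    have := (hasDerivAt_modulated hV.comp_neg hk (-0)).scomp 0 (hasDerivAt_neg 0)
    rw [jostMinus_eq hV hk]
    simpa [Function.comp_def] using this
  rw [← jostPlus_eq hV hk] at h1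
  rw [wronskian, h1.deriv, h2.deriv, jostPlus_eq hV hk, jostMinus_eq hV hk, jostWronskian]
  simp
  ring

theorem transmission_eq (hV : IsExpDecaying N β V) (hk : 0 < k.im) :
    transmission V k = -(2 * Complex.I * k) / jostWronskian V k := by
  rw [transmission, wronskian_jost hV hk]

/-! ### Holomorphic dependence on the wave number -/

theorem volterraCoeff_anti (hN : 0 ≤ N) (hβ : 0 < β) {r s : ℝ} (hr : 0 < r) (hrs : r ≤ s) (n : ℕ) :
    volterraCoeff N β s n ≤ volterraCoeff N β r n := by
  unfold volterraCoeff
  have : 0 < s := hr.trans_le hrs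
  gcongr

theorem modJostBound_anti (hN : 0 ≤ N) (hβ : 0 < β) {r s : ℝ} (hr : 0 < r) (hrs : r ≤ s) (x : ℝ) :
    modJostBound N β s x ≤ modJostBound N β r x :=
  (summable_volterraCoeff_mul_exp N β s x).tsum_le_tsum (fun n => mul_le_mul_of_nonneg_right
    (volterraCoeff_anti hN hβ hr hrs n) (Real.exp_nonneg _)) (summable_volterraCoeff_mul_exp N β r x)

/-- The part of the upper half plane outside the disc of radius `r`. -/
def upperRegion (r : ℝ) : Set ℂ := {k | 0 < k.im ∧ r < ‖k‖}

theorem isOpen_upperRegion (r : ℝ) : IsOpen (upperRegion r) :=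
  (isOpen_lt continuous_const Complex.continuous_im).inter (isOpen_lt continuous_const continuous_norm)

theorem differentiableOn_modKernel (r s : ℝ) :
    DifferentiableOn ℂ (fun k => modKernel k s) (upperRegion r) := by
  unfold modKernel
  refine DifferentiableOn.div (by fun_prop) (by fun_prop) fun k hk => ?_
  have := ne_zero_of_im_pos hk.1
  simp [this]

theorem norm_volterraTerm_le_region (hV : IsExpDecaying N β V) {r : ℝ} (hr : 0 < r)
    (hk : k ∈ upperRegion r) (n : ℕ) {x y : ℝ} (h : x ≤ y) :
    ‖volterraTerm V k n y‖ ≤ volterraCoeff N β r n * Real.exp (-(n * β * x)) :=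
  (norm_volterraTerm_le_of_le hV hk.1 n h).trans (mul_le_mul_of_nonneg_right
    (volterraCoeff_anti hV.nonneg hV.rate_pos hr hk.2.le n) (Real.exp_nonneg _))

theorem differentiableOn_volterraTerm (hV : IsExpDecaying N β V) {r : ℝ} (hr : 0 < r) (n : ℕ)
    (x : ℝ) : DifferentiableOn ℂ (fun k => volterraTerm V k n x) (upperRegion r) := by
  induction n generalizing x with
  | zero => exact differentiableOn_const _
  | succ n ih =>
    refine differentiableOn_integral_of_dominated (isOpen_upperRegion r)
      (b := fun y => 1 / r * (N * Real.exp (-(β * y)) *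
        (volterraCoeff N β r n * Real.exp (-(n * β * x)))))
      (((integrableOn_exp_neg_mul_Ioi hV.rate_pos x).const_mul N).mul_const _ |>.const_mul _)
      (fun k hk => ?_) ?_
    · refine Continuous.aestronglyMeasurable ?_
      have h1 := continuous_modKernel k
      have h2 := continuous_volterraTerm hV hk.1 n
      have h3 := hV.continuous
      fun_prop
    · refine (ae_restrict_iff' measurableSet_Ioi).2 (Eventually.of_forall fun y hy =>
        ⟨(differentiableOn_modKernel r _).mul ((ih y).const_mul _), fun k hk => ?_⟩)
      rw [norm_mul, norm_mul]
      have h0 : 0 ≤ N * Real.exp (-(β * y)) := mul_nonneg hV.nonneg (Real.exp_nonneg _)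
      gcongr
      · exact (norm_modKernel_le hk.1.le (sub_nonneg.2 (le_of_lt hy))).trans
          (one_div_le_one_div_of_le hr hk.2.le)
      · exact hV.bound_right y
      · exact norm_volterraTerm_le_region hV hr hk n (le_of_lt hy)

theorem differentiableOn_modJost (hV : IsExpDecaying N β V) {r : ℝ} (hr : 0 < r) (x : ℝ) :
    DifferentiableOn ℂ (fun k => modJost V k x) (upperRegion r) :=
  Complex.differentiableOn_tsum_of_summable_norm (summable_volterraCoeff_mul_exp N β r x)
    (fun n => differentiableOn_volterraTerm hV hr n x) (isOpen_upperRegion r)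
    fun n _ hk => norm_volterraTerm_le_region hV hr hk n le_rfl

theorem differentiableOn_modJostTail (hV : IsExpDecaying N β V) {r : ℝ} (hr : 0 < r) (x : ℝ) :
    DifferentiableOn ℂ (fun k => modJostTail V k x) (upperRegion r) := by
  refine differentiableOn_integral_of_dominated (isOpen_upperRegion r)
    (b := fun y => 1 * (N * Real.exp (-(β * y)) * modJostBound N β r x))
    (((integrableOn_exp_neg_mul_Ioi hV.rate_pos x).const_mul N).mul_const _ |>.const_mul _)
    (fun k hk => ?_) ?_
  · refine Continuous.aestronglyMeasurable ?_
    have h2 := continuous_modJost hV hk.1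
    have h3 := hV.continuous
    fun_prop
  · refine (ae_restrict_iff' measurableSet_Ioi).2 (Eventually.of_forall fun y hy =>
      ⟨DifferentiableOn.mul (by fun_prop) ((differentiableOn_modJost hV hr y).const_mul _),
        fun k hk => ?_⟩)
    rw [norm_mul, norm_mul]
    have h0 : 0 ≤ N * Real.exp (-(β * y)) := mul_nonneg hV.nonneg (Real.exp_nonneg _)
    gcongr
    · exact norm_exp_two_I_mul_le hk.1.le (sub_nonneg.2 (le_of_lt hy))
    · exact hV.bound_right y
    · exact (norm_modJost_le hV hk.1 (le_of_lt hy)).trans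
        (modJostBound_anti hV.nonneg hV.rate_pos hr hk.2.le x)

/-- The bounds are uniform only away from k = 0, so analyticity at k is obtained in the region
outside the disc of radius |k|/2. -/
theorem differentiableOn_jostWronskian (hV : IsExpDecaying N β V) :
    DifferentiableOn ℂ (jostWronskian V) {k | 0 < k.im} := by
  intro k hk
  have hk0 : 0 < ‖k‖ := norm_pos_iff.2 (ne_zero_of_im_pos hk)
  have hmem : k ∈ upperRegion (‖k‖ / 2) := ⟨hk, by linarith⟩
  have hr : 0 < ‖k‖ / 2 := by positivity
  have hd : DifferentiableOn ℂ (jostWronskian V) (upperRegion (‖k‖ / 2)) := by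
    have h1 := differentiableOn_modJost hV hr 0
    have h2 := differentiableOn_modJost hV.comp_neg hr 0
    have h3 := differentiableOn_modJostTail hV hr 0
    have h4 := differentiableOn_modJostTail hV.comp_neg hr 0
    unfold jostWronskian
    fun_prop
  exact (hd.differentiableAt ((isOpen_upperRegion _).mem_nhds hmem)).differentiableWithinAt

/-! ### Reality on the imaginary axis -/

/-- At k = iκ the number 2ik = -2κ is real. All reality statements below rest on this. -/
theorem conj_modKernel (κ s : ℝ) :
    starRingEnd ℂ (modKernel (Complex.I * κ) s) = modKernel (Complex.I * κ) s := by
  simp [modKernel, ← Complex.exp_conj, map_ofNat]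

theorem conj_volterraTerm (hV : ∀ x, starRingEnd ℂ (V x) = V x) (κ : ℝ) (n : ℕ) (x : ℝ) :
    starRingEnd ℂ (volterraTerm V (Complex.I * κ) n x) = volterraTerm V (Complex.I * κ) n x := by
  induction n generalizing x with
  | zero => simp [volterraTerm]
  | succ n ih =>
    simp only [volterraTerm]
    rw [← integral_conj]
    congr 1 with y
    rw [map_mul, map_mul, conj_modKernel, ih, hV]

theorem conj_modJost (hV : ∀ x, starRingEnd ℂ (V x) = V x) (κ x : ℝ) :
    starRingEnd ℂ (modJost V (Complex.I * κ) x) = modJost V (Complex.I * κ) x := by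
  rw [modJost, Complex.conj_tsum]
  simp only [conj_volterraTerm hV]

theorem conj_modJostTail (hV : ∀ x, starRingEnd ℂ (V x) = V x) (κ x : ℝ) :
    starRingEnd ℂ (modJostTail V (Complex.I * κ) x) = modJostTail V (Complex.I * κ) x := by
  rw [modJostTail, expTail, ← integral_conj]
  congr 1 with y
  rw [map_mul, map_mul, conj_modJost hV, hV, ← Complex.exp_conj]
  simp [map_ofNat]

theorem conj_jostWronskian (hV : ∀ x, starRingEnd ℂ (V x) = V x) (κ : ℝ) :
    starRingEnd ℂ (jostWronskian V (Complex.I * κ)) = jostWronskian V (Complex.I * κ) := by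
  have hV' : ∀ x, starRingEnd ℂ ((fun x => V (-x)) x) = (fun x => V (-x)) x := fun x => hV (-x)
  have hI : starRingEnd ℂ (Complex.I * (Complex.I * κ)) = Complex.I * (Complex.I * κ) := by simp
  simp only [jostWronskian, map_sub, map_neg, map_mul (starRingEnd ℂ) (modJost _ _ _),
    map_mul (starRingEnd ℂ) (Complex.I * (Complex.I * κ)), hI, conj_modJost hV, conj_modJost hV',
    conj_modJostTail hV, conj_modJostTail hV']

end Jost

/-! ### Perturbation theory for the first-order system on a half line, uniformly in κ. -/

theorem norm_exp_two_mul_sub_one_le {z : ℂ} {b : ℝ} (hz : ‖z‖ ≤ b) (hb : b ≤ 1 / 4) :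
    ‖Complex.exp (2 * z) - 1‖ ≤ 4 * b := by
  have h2 : ‖2 * z‖ = 2 * ‖z‖ := by simp
  refine (Complex.norm_exp_sub_one_le (x := 2 * z) (by linarith)).trans ?_
  rw [h2]; linarith

/-- The constant in the first-order estimate of the perturbed system. -/
noncomputable def halfLineConst (β : ℝ) : ℝ := 11 / β ^ 2 + 16 / β + 1

/-- The constant in the second-order estimate of the perturbed system. -/
noncomputable def halfLineConst₂ (β : ℝ) : ℝ :=
  (34 + 6 * halfLineConst β + 8 / β) * (2 / β) + 2 * halfLineConst β

theorem one_le_halfLineConst {β : ℝ} (hβ : 0 < β) : 1 ≤ halfLineConst β := by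
  have : 0 ≤ 11 / β ^ 2 + 16 / β := by positivity
  unfold halfLineConst; linarith

/-- The system `Φ' = κΦ + e^{-2P}Γ + TΦ`, `Γ' = κΓ + e^{2P}(U + κ²)Φ - TΓ` on `[0, ∞)`, a small
perturbation of the constant-coefficient one, and its solution asymptotic to `(1, -κ)`. -/
structure HalfLineSystem (β δ κ : ℝ) (P T U Φ Γ : ℝ → ℂ) : Prop where
  rate_pos : 0 < β
  κ_pos : 0 < κ
  κ_le : κ ≤ δ
  δ_le : halfLineConst β * δ ≤ 1 / 4
  continuous_P : Continuous P
  continuous_T : Continuous T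
  continuous_U : Continuous U
  bound_P : ∀ x, 0 ≤ x → ‖P x‖ ≤ δ * Real.exp (-(β * x))
  bound_T : ∀ x, 0 ≤ x → ‖T x‖ ≤ δ * Real.exp (-(β * x))
  bound_U : ∀ x, 0 ≤ x → ‖U x‖ ≤ 2 * (δ * Real.exp (-(β * x)))
  deriv_Φ : ∀ x, HasDerivAt Φ (κ * Φ x + Complex.exp (2 * -P x) * Γ x + T x * Φ x) x
  deriv_Γ : ∀ x, HasDerivAt Γ
    (κ * Γ x + Complex.exp (2 * P x) * (U x + κ ^ 2) * Φ x - T x * Γ x) x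
  tendsto_Φ : Tendsto Φ atTop (𝓝 1)
  tendsto_Γ : Tendsto (fun x => Γ x + κ * Φ x) atTop (𝓝 0)
  bounded : ∃ B, ∀ x, 0 ≤ x → ‖Φ x‖ ≤ B ∧ ‖Γ x‖ ≤ B

namespace HalfLineSystem

variable {β δ κ : ℝ} {P T U Φ Γ : ℝ → ℂ}

/-- The perturbation in the equation for `Φ`. -/
noncomputable def err₁ (P T Φ Γ : ℝ → ℂ) (x : ℝ) : ℂ :=
  (Complex.exp (2 * -P x) - 1) * Γ x + T x * Φ x

/-- The perturbation in the equation for `Γ + κΦ`. -/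
noncomputable def err₂ (κ : ℝ) (P T U Φ Γ : ℝ → ℂ) (x : ℝ) : ℂ :=
  (Complex.exp (2 * P x) * U x + κ ^ 2 * (Complex.exp (2 * P x) - 1)) * Φ x - T x * Γ x +
    κ * err₁ P T Φ Γ x

theorem δ_pos (h : HalfLineSystem β δ κ P T U Φ Γ) : 0 < δ := h.κ_pos.trans_le h.κ_le

theorem δ_le' (h : HalfLineSystem β δ κ P T U Φ Γ) : δ ≤ 1 / 4 :=
  (le_mul_of_one_le_left h.δ_pos.le (one_le_halfLineConst h.rate_pos)).trans h.δ_le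

theorem weight_le (h : HalfLineSystem β δ κ P T U Φ Γ) {x : ℝ} (hx : 0 ≤ x) : Real.exp (-(β * x)) ≤ 1 :=
  Real.exp_le_one_iff.2 (neg_nonpos.2 (mul_nonneg h.rate_pos.le hx))

theorem small (h : HalfLineSystem β δ κ P T U Φ Γ) {x : ℝ} (hx : 0 ≤ x) : δ * Real.exp (-(β * x)) ≤ 1 / 4 :=
  (mul_le_of_le_one_right h.δ_pos.le (h.weight_le hx)).trans h.δ_le'

theorem norm_expP_sub_one (h : HalfLineSystem β δ κ P T U Φ Γ) {x : ℝ} (hx : 0 ≤ x) :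
    ‖Complex.exp (2 * P x) - 1‖ ≤ 4 * (δ * Real.exp (-(β * x))) :=
  norm_exp_two_mul_sub_one_le (h.bound_P x hx) (h.small hx)

theorem norm_expP_neg_sub_one (h : HalfLineSystem β δ κ P T U Φ Γ) {x : ℝ} (hx : 0 ≤ x) :
    ‖Complex.exp (2 * -P x) - 1‖ ≤ 4 * (δ * Real.exp (-(β * x))) :=
  norm_exp_two_mul_sub_one_le (by simpa using h.bound_P x hx) (h.small hx)

theorem norm_expP (h : HalfLineSystem β δ κ P T U Φ Γ) {x : ℝ} (hx : 0 ≤ x) : ‖Complex.exp (2 * P x)‖ ≤ 2 := by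
  have h1 := h.norm_expP_sub_one hx
  have h2 := h.small hx
  have := norm_le_norm_sub_add (Complex.exp (2 * P x)) 1
  rw [norm_one] at this
  linarith

theorem norm_err₁ (h : HalfLineSystem β δ κ P T U Φ Γ) {x B : ℝ} (hx : 0 ≤ x) (h1 : ‖Φ x‖ ≤ B) (h2 : ‖Γ x‖ ≤ B) :
    ‖err₁ P T Φ Γ x‖ ≤ 5 * δ * B * Real.exp (-(β * x)) := by
  have hw : 0 ≤ δ * Real.exp (-(β * x)) := mul_nonneg h.δ_pos.le (Real.exp_nonneg _)
  calc ‖err₁ P T Φ Γ x‖ ≤ ‖Complex.exp (2 * -P x) - 1‖ * ‖Γ x‖ + ‖T x‖ * ‖Φ x‖ := by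
        rw [← norm_mul, ← norm_mul]; exact norm_add_le _ _
    _ ≤ 4 * (δ * Real.exp (-(β * x))) * B + δ * Real.exp (-(β * x)) * B := by
        gcongr
        · exact h.norm_expP_neg_sub_one hx
        · exact h.bound_T x hx
    _ = _ := by ring

theorem norm_err₂ (h : HalfLineSystem β δ κ P T U Φ Γ) {x B : ℝ} (hx : 0 ≤ x) (h1 : ‖Φ x‖ ≤ B) (h2 : ‖Γ x‖ ≤ B) :
    ‖err₂ κ P T U Φ Γ x‖ ≤ 11 * δ * B * Real.exp (-(β * x)) := by
  have hw : 0 ≤ δ * Real.exp (-(β * x)) := mul_nonneg h.δ_pos.le (Real.exp_nonneg _)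
  have hB : 0 ≤ B := (norm_nonneg _).trans h1
  have hκ : κ ≤ 1 / 4 := h.κ_le.trans h.δ_le'
  have hκ0 := h.κ_pos
  have hnκ : ‖(κ : ℂ)‖ = κ := by simp [abs_of_pos hκ0]
  calc ‖err₂ κ P T U Φ Γ x‖
      ≤ (‖Complex.exp (2 * P x)‖ * ‖U x‖ + κ ^ 2 * ‖Complex.exp (2 * P x) - 1‖) * ‖Φ x‖ +
        ‖T x‖ * ‖Γ x‖ + κ * ‖err₁ P T Φ Γ x‖ := by
        have hk2 : ‖(κ : ℂ) ^ 2 * (Complex.exp (2 * P x) - 1)‖ =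
            κ ^ 2 * ‖Complex.exp (2 * P x) - 1‖ := by rw [norm_mul, norm_pow, hnκ]
        unfold err₂
        refine (norm_add_le _ _).trans (add_le_add ((norm_sub_le _ _).trans (add_le_add ?_ ?_)) ?_)
        · rw [norm_mul]
          refine mul_le_mul_of_nonneg_right ((norm_add_le _ _).trans ?_) (norm_nonneg _)
          rw [hk2, norm_mul]
        · rw [norm_mul]
        · rw [norm_mul, hnκ]
    _ ≤ (2 * (2 * (δ * Real.exp (-(β * x)))) + (1 / 4) ^ 2 * (4 * (δ * Real.exp (-(β * x))))) * B +
        δ * Real.exp (-(β * x)) * B + 1 / 4 * (5 * δ * B * Real.exp (-(β * x))) := by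
        gcongr
        · exact h.norm_expP hx
        · exact h.bound_U x hx
        · exact h.norm_expP_sub_one hx
        · exact h.bound_T x hx
        · exact h.norm_err₁ hx h1 h2
    _ ≤ _ := by nlinarith [mul_nonneg hw hB]

theorem hasDerivAt_Φ (h : HalfLineSystem β δ κ P T U Φ Γ) (x : ℝ) :
    HasDerivAt Φ ((Γ x + κ * Φ x) + err₁ P T Φ Γ x) x :=
  (h.deriv_Φ x).congr_deriv (by unfold err₁; ring)

/-- Γ + κΦ is the growing mode, of rate 2κ, of the constant-coefficient system. With the weight
e^{-2κx} it is driven by the perturbation alone. -/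
theorem hasDerivAt_sum (h : HalfLineSystem β δ κ P T U Φ Γ) (x : ℝ) :
    HasDerivAt (fun x : ℝ => Complex.exp (-(2 * κ * x)) * (Γ x + κ * Φ x))
      (Complex.exp (-(2 * κ * x)) * err₂ κ P T U Φ Γ x) x := by
  have h2 : HasDerivAt (fun z : ℝ => Complex.exp (-(2 * κ * z)))
      (Complex.exp (-(2 * κ * x)) * -(2 * κ * 1)) x :=
    (((hasDerivAt_id (x : ℂ)).const_mul (2 * κ : ℂ)).neg.cexp).comp_ofReal
  refine (h2.mul ((h.deriv_Γ x).add ((h.deriv_Φ x).const_mul (κ : ℂ)))).congr_deriv ?_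
  simp only [Pi.add_apply]
  unfold err₂ err₁
  ring

theorem continuous_Φ (h : HalfLineSystem β δ κ P T U Φ Γ) : Continuous Φ :=
  continuous_iff_continuousAt.2 fun x => (h.deriv_Φ x).continuousAt

theorem continuous_Γ (h : HalfLineSystem β δ κ P T U Φ Γ) : Continuous Γ :=
  continuous_iff_continuousAt.2 fun x => (h.deriv_Γ x).continuousAt

theorem continuous_err₁ (h : HalfLineSystem β δ κ P T U Φ Γ) : Continuous (err₁ P T Φ Γ) := by
  have h1 := h.continuous_Φ
  have h2 := h.continuous_Γ
  have h3 := h.continuous_P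
  have h4 := h.continuous_T
  unfold err₁
  fun_prop

theorem continuous_err₂ (h : HalfLineSystem β δ κ P T U Φ Γ) : Continuous (err₂ κ P T U Φ Γ) := by
  have h1 := h.continuous_Φ
  have h2 := h.continuous_Γ
  have h3 := h.continuous_P
  have h4 := h.continuous_T
  have h5 := h.continuous_U
  have h6 := h.continuous_err₁
  unfold err₂
  fun_prop

theorem norm_exp_weight (κ x : ℝ) :
    ‖Complex.exp (-(2 * κ * x))‖ = Real.exp (-(2 * κ * x)) := by
  rw [Complex.norm_exp]; simp

theorem tendsto_weighted (h : HalfLineSystem β δ κ P T U Φ Γ) :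
    Tendsto (fun x : ℝ => Complex.exp (-(2 * κ * x)) * (Γ x + κ * Φ x)) atTop (𝓝 0) := by
  have := h.κ_pos
  refine squeeze_zero_norm' (a := fun x => ‖Γ x + κ * Φ x‖) ?_ (by simpa using h.tendsto_Γ.norm)
  filter_upwards [eventually_ge_atTop 0] with x hx
  rw [norm_mul, norm_exp_weight]
  exact mul_le_of_le_one_left (norm_nonneg _) (Real.exp_le_one_iff.2 (by
    have : 0 ≤ 2 * κ * x := by positivity
    linarith))

/-- Integration from infinity, where the weighted growing mode vanishes. -/
theorem integral_weighted (h : HalfLineSystem β δ κ P T U Φ Γ) {B : ℝ} (hB : ∀ x, 0 ≤ x → ‖Φ x‖ ≤ B ∧ ‖Γ x‖ ≤ B) {x : ℝ} (hx : 0 ≤ x) :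
    Complex.exp (-(2 * κ * x)) * (Γ x + κ * Φ x) =
      -∫ y in Ioi x, Complex.exp (-(2 * κ * y)) * err₂ κ P T U Φ Γ y := by
  have hκ := h.κ_pos
  have hi : IntegrableOn (fun y : ℝ => Complex.exp (-(2 * κ * y)) * err₂ κ P T U Φ Γ y) (Ioi x) := by
    have := h.continuous_err₂
    refine integrableOn_Ioi_of_exp_bound (B := 11 * δ * B) h.rate_pos (by fun_prop) fun y hy => ?_
    have hy0 : 0 ≤ y := hx.trans hy.le
    rw [norm_mul, norm_exp_weight]
    exact (mul_le_of_le_one_left (norm_nonneg _) (Real.exp_le_one_iff.2 (by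
      have : 0 ≤ 2 * κ * y := by positivity
      linarith))).trans (h.norm_err₂ hy0 (hB y hy0).1 (hB y hy0).2)
  rw [integral_Ioi_of_hasDerivAt_of_tendsto' (fun y _ => h.hasDerivAt_sum y) hi h.tendsto_weighted]
  ring

/-- Since e^{-2κy} ≤ e^{-2κx} for y ≥ x, the weight cancels from both sides and no inverse power of
κ appears. This keeps the analysis uniform down to κ = 0, unlike the Volterra bounds. -/
theorem norm_sum_le (h : HalfLineSystem β δ κ P T U Φ Γ) {B : ℝ} (hB : ∀ x, 0 ≤ x → ‖Φ x‖ ≤ B ∧ ‖Γ x‖ ≤ B) {x : ℝ} (hx : 0 ≤ x) :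
    ‖Γ x + κ * Φ x‖ ≤ 11 * δ * B / β * Real.exp (-(β * x)) := by
  have hκ := h.κ_pos
  have hw := Real.exp_pos (-(2 * κ * x))
  have h1 : ‖∫ y in Ioi x, Complex.exp (-(2 * κ * y)) * err₂ κ P T U Φ Γ y‖ ≤
      Real.exp (-(2 * κ * x)) * (11 * δ * B) * (Real.exp (-(β * x)) / β) := by
    refine norm_integral_Ioi_le_of_exp_bound h.rate_pos fun y hy => ?_
    have hy0 : 0 ≤ y := hx.trans hy.le
    rw [norm_mul, norm_exp_weight, mul_assoc (Real.exp _)]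
    refine mul_le_mul (Real.exp_le_exp.2 ?_) (h.norm_err₂ hy0 (hB y hy0).1 (hB y hy0).2)
      (norm_nonneg _) hw.le
    have : 2 * κ * x ≤ 2 * κ * y := by gcongr
    linarith
  have h2 := congrArg norm (h.integral_weighted hB hx)
  rw [norm_neg, norm_mul, norm_exp_weight] at h2
  rw [← h2, mul_assoc (Real.exp _), mul_le_mul_iff_right₀ hw] at h1
  exact h1.trans_eq (by ring)

theorem norm_Φ_sub_one_le (h : HalfLineSystem β δ κ P T U Φ Γ) {B : ℝ} (hB : ∀ x, 0 ≤ x → ‖Φ x‖ ≤ B ∧ ‖Γ x‖ ≤ B) {x : ℝ}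
    (hx : 0 ≤ x) : ‖Φ x - 1‖ ≤ halfLineConst β * δ * B := by
  have hβ := h.rate_pos
  have hδ := h.δ_pos
  have hB0 : 0 ≤ B := (norm_nonneg _).trans (hB 0 le_rfl).1
  have hb : ∀ y, x < y → ‖(Γ y + κ * Φ y) + err₁ P T Φ Γ y‖ ≤
      (11 * δ * B / β + 5 * δ * B) * Real.exp (-(β * y)) := fun y hy => by
    have hy0 : 0 ≤ y := hx.trans hy.le
    rw [add_mul]
    exact (norm_add_le _ _).trans (add_le_add (h.norm_sum_le hB hy0)
      (h.norm_err₁ hy0 (hB y hy0).1 (hB y hy0).2))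
  have hc : Continuous fun y => (Γ y + κ * Φ y) + err₁ P T Φ Γ y := by
    have h1 := h.continuous_Φ
    have h2 := h.continuous_Γ
    have h3 := h.continuous_err₁
    fun_prop
  have h1 := integral_Ioi_of_hasDerivAt_of_tendsto' (a := x) (fun y _ => h.hasDerivAt_Φ y)
    (integrableOn_Ioi_of_exp_bound hβ hc hb) h.tendsto_Φ
  rw [norm_sub_rev, ← h1]
  refine (norm_integral_Ioi_le_of_exp_bound hβ hb).trans ?_
  calc (11 * δ * B / β + 5 * δ * B) * (Real.exp (-(β * x)) / β)
      ≤ (11 * δ * B / β + 5 * δ * B) * (1 / β) := by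
        gcongr
        exact h.weight_le hx
    _ = (11 / β ^ 2 + 5 / β) * (δ * B) := by field_simp
    -- The constant is enlarged so that one value serves both for Φ - 1 and for Γ.
    _ ≤ (11 / β ^ 2 + 16 / β + 1) * (δ * B) := by
        have : 5 / β ≤ 16 / β := by gcongr; norm_num
        refine mul_le_mul_of_nonneg_right ?_ (by positivity)
        linarith
    _ = _ := by rw [halfLineConst]; ring

theorem norm_Γ_le (h : HalfLineSystem β δ κ P T U Φ Γ) {B : ℝ} (hB : ∀ x, 0 ≤ x → ‖Φ x‖ ≤ B ∧ ‖Γ x‖ ≤ B) {x : ℝ}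
    (hx : 0 ≤ x) : ‖Γ x‖ ≤ halfLineConst β * δ * B := by
  have hβ := h.rate_pos
  have hδ := h.δ_pos
  have hκ := h.κ_pos
  have hB0 : 0 ≤ B := (norm_nonneg _).trans (hB 0 le_rfl).1
  have hnκ : ‖(κ : ℂ)‖ = κ := by simp [abs_of_pos hκ]
  calc ‖Γ x‖ = ‖(Γ x + κ * Φ x) - κ * Φ x‖ := by rw [add_sub_cancel_right]
    _ ≤ ‖Γ x + κ * Φ x‖ + ‖κ * Φ x‖ := norm_sub_le _ _
    _ ≤ 11 * δ * B / β * 1 + δ * B := by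
        rw [norm_mul, hnκ]
        refine add_le_add ((h.norm_sum_le hB hx).trans ?_) ?_
        · gcongr
          exact h.weight_le hx
        · gcongr
          · exact h.κ_le
          · exact (hB x hx).1
    _ = (11 / β + 1) * (δ * B) := by field_simp
    _ ≤ (11 / β ^ 2 + 16 / β + 1) * (δ * B) := by
        have h1 : 11 / β ≤ 16 / β := by gcongr; norm_num
        have h2 : 0 ≤ 11 / β ^ 2 := by positivity
        refine mul_le_mul_of_nonneg_right ?_ (by positivity)
        linarith
    _ = _ := by rw [halfLineConst]; ring

/-- A bootstrap: some bound B is known, with no control on its size. The previous estimates and Kδ ≤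
1/4 improve a bound b to 1 + b/2, and iteration leads to the fixed point 2. -/
theorem bounded_by_two (h : HalfLineSystem β δ κ P T U Φ Γ) {x : ℝ} (hx : 0 ≤ x) : ‖Φ x‖ ≤ 2 ∧ ‖Γ x‖ ≤ 2 := by
  obtain ⟨B, hB⟩ := h.bounded
  have hB0 : 0 ≤ B := (norm_nonneg _).trans (hB 0 le_rfl).1
  have key : ∀ n : ℕ, ∀ x, 0 ≤ x → ‖Φ x‖ ≤ 2 + (1 / 2) ^ n * B ∧ ‖Γ x‖ ≤ 2 + (1 / 2) ^ n * B := by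
    intro n
    induction n with
    | zero =>
      intro x hx
      have := hB x hx
      constructor <;> linarith [this.1, this.2]
    | succ n ih =>
      intro x hx
      have h1 := h.norm_Φ_sub_one_le ih hx
      have h2 := h.norm_Γ_le ih hx
      have h3 := norm_le_norm_sub_add (Φ x) 1
      rw [norm_one] at h3
      have hpos : 0 ≤ 2 + (1 / 2 : ℝ) ^ n * B := by positivity
      have h4 := mul_le_mul_of_nonneg_right (h.δ_le.trans (by norm_num : (1 / 4 : ℝ) ≤ 1 / 2)) hpos
      rw [pow_succ]
      constructor <;> linarith
  have ht : Tendsto (fun n : ℕ => 2 + (1 / 2 : ℝ) ^ n * B) atTop (𝓝 2) := by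
    simpa using ((tendsto_pow_atTop_nhds_zero_of_lt_one (by norm_num : (0 : ℝ) ≤ 1 / 2)
      (by norm_num)).mul_const B).const_add 2
  exact ⟨ge_of_tendsto' ht fun n => (key n x hx).1, ge_of_tendsto' ht fun n => (key n x hx).2⟩

theorem first_order (h : HalfLineSystem β δ κ P T U Φ Γ) {x : ℝ} (hx : 0 ≤ x) : ‖Φ x - 1‖ ≤ 2 * halfLineConst β * δ :=
  (h.norm_Φ_sub_one_le (fun _ hx => h.bounded_by_two hx) hx).trans_eq (by ring)

theorem first_order_Γ (h : HalfLineSystem β δ κ P T U Φ Γ) {x : ℝ} (hx : 0 ≤ x) : ‖Γ x‖ ≤ 2 * halfLineConst β * δ :=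
  (h.norm_Γ_le (fun _ hx => h.bounded_by_two hx) hx).trans_eq (by ring)

/-- To leading order the forcing of the growing mode is U itself; each remaining term has at least
two factors of size δ. -/
theorem norm_err₂_sub (h : HalfLineSystem β δ κ P T U Φ Γ) {x : ℝ} (hx : 0 ≤ x) :
    ‖err₂ κ P T U Φ Γ x - U x‖ ≤
      (34 + 6 * halfLineConst β) * δ ^ 2 * Real.exp (-(β * x)) := by
  have hδ := h.δ_pos
  have hκ0 := h.κ_pos
  have hκ := h.κ_le
  set w := Real.exp (-(β * x)) with hw
  have hw0 : 0 ≤ w := (Real.exp_pos _).le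
  set K := halfLineConst β
  have hK : 1 ≤ K := one_le_halfLineConst h.rate_pos
  have hnκ : ‖(κ : ℂ)‖ = κ := by simp [abs_of_pos hκ0]
  have hΦ := (h.bounded_by_two hx).1
  have hP := h.norm_expP_sub_one hx
  have e : err₂ κ P T U Φ Γ x - U x =
      U x * ((Complex.exp (2 * P x) - 1) * Φ x) + U x * (Φ x - 1) +
        κ ^ 2 * (Complex.exp (2 * P x) - 1) * Φ x - T x * Γ x + κ * err₁ P T Φ Γ x := by
    unfold err₂; ring
  rw [e]
  have b1 : ‖U x * ((Complex.exp (2 * P x) - 1) * Φ x)‖ ≤ 2 * (δ * w) * (4 * (δ * 1) * 2) := by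
    rw [norm_mul, norm_mul]
    gcongr
    · exact h.bound_U x hx
    · refine hP.trans ?_
      gcongr
      exact h.weight_le hx
  have b2 : ‖U x * (Φ x - 1)‖ ≤ 2 * (δ * w) * (2 * K * δ) := by
    rw [norm_mul]
    gcongr
    · exact h.bound_U x hx
    · exact h.first_order hx
  have b3 : ‖κ ^ 2 * (Complex.exp (2 * P x) - 1) * Φ x‖ ≤ (δ * (1 / 4)) * (4 * (δ * w)) * 2 := by
    rw [norm_mul, norm_mul, norm_pow, hnκ]
    gcongr
    rw [pow_two]
    exact mul_le_mul hκ (hκ.trans h.δ_le') hκ0.le hδ.le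
  have b4 : ‖T x * Γ x‖ ≤ (δ * w) * (2 * K * δ) := by
    rw [norm_mul]
    gcongr
    · exact h.bound_T x hx
    · exact h.first_order_Γ hx
  have b5 : ‖κ * err₁ P T Φ Γ x‖ ≤ δ * (5 * δ * 2 * w) := by
    rw [norm_mul, hnκ]
    gcongr
    exact h.norm_err₁ hx hΦ (h.bounded_by_two hx).2
  calc _ ≤ 2 * (δ * w) * (4 * (δ * 1) * 2) + 2 * (δ * w) * (2 * K * δ) +
        (δ * (1 / 4)) * (4 * (δ * w)) * 2 + (δ * w) * (2 * K * δ) + δ * (5 * δ * 2 * w) :=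
        (norm_add_le _ _).trans (add_le_add ((norm_sub_le _ _).trans (add_le_add
          ((norm_add_le _ _).trans (add_le_add ((norm_add_le _ _).trans (add_le_add b1 b2)) b3))
          b4)) b5)
    _ ≤ _ := by nlinarith [mul_nonneg (sq_nonneg δ) hw0]

/-- The integral formula for the growing mode at x = 0, with the forcing replaced by U, the weight
e^{-2κy} by 1 and Φ(0) by 1. Each replacement costs O(δ²). -/
theorem second_order (h : HalfLineSystem β δ κ P T U Φ Γ) :
    ‖Γ 0 + κ + ∫ x in Ioi 0, U x‖ ≤ halfLineConst₂ β * δ ^ 2 := by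
  have hβ := h.rate_pos
  have hδ := h.δ_pos
  have hκ0 := h.κ_pos
  have hκ := h.κ_le
  have hnκ : ‖(κ : ℂ)‖ = κ := by simp [abs_of_pos hκ0]
  have hU := h.continuous_U
  have hE := h.continuous_err₂
  have hA := h.integral_weighted (fun _ hx => h.bounded_by_two hx) le_rfl
  have hUi : IntegrableOn U (Ioi 0) := integrableOn_Ioi_of_exp_bound (B := 2 * δ) hβ hU
    fun y hy => by rw [mul_assoc]; exact h.bound_U y hy.le
  have hEi : IntegrableOn (fun y : ℝ => Complex.exp (-(2 * κ * y)) * err₂ κ P T U Φ Γ y) (Ioi 0) := by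
    refine integrableOn_Ioi_of_exp_bound (B := 11 * δ * 2) hβ (by fun_prop) fun y hy => ?_
    rw [norm_mul, norm_exp_weight]
    exact (mul_le_of_le_one_left (norm_nonneg _) (Real.exp_le_one_iff.2 (by
      have : 0 ≤ 2 * κ * y := by positivity
      linarith))).trans (h.norm_err₂ hy.le (h.bounded_by_two hy.le).1 (h.bounded_by_two hy.le).2)
  have e : Γ 0 + κ + ∫ x in Ioi 0, U x =
      -(∫ y in Ioi (0 : ℝ), (Complex.exp (-(2 * κ * y)) * err₂ κ P T U Φ Γ y - U y)) -
        κ * (Φ 0 - 1) := by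
    rw [integral_sub hEi hUi]
    simp only [Complex.ofReal_zero, mul_zero, neg_zero, Complex.exp_zero, one_mul] at hA
    linear_combination hA
  have hb : ∀ y : ℝ, 0 < y → ‖Complex.exp (-(2 * κ * y)) * err₂ κ P T U Φ Γ y - U y‖ ≤
      (34 + 6 * halfLineConst β + 8 / β) * δ ^ 2 * Real.exp (-(β / 2 * y)) := by
    intro y hy
    have hky : 0 ≤ 2 * κ * y := by positivity
    have hE1 : Real.exp (-(2 * κ * y)) ≤ 1 := Real.exp_le_one_iff.2 (by linarith)
    have h1 : ‖Complex.exp (-(2 * κ * y)) - 1‖ ≤ 2 * κ * y := by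
      have : Complex.exp (-(2 * κ * y)) - 1 = ((Real.exp (-(2 * κ * y)) - 1 : ℝ) : ℂ) := by
        push_cast; rfl
      rw [this, Complex.norm_real, Real.norm_eq_abs, abs_sub_comm, abs_of_nonneg (by linarith)]
      linarith [Real.add_one_le_exp (-(2 * κ * y))]
    have h2 : Real.exp (-(β * y)) = Real.exp (-(β / 2 * y)) * Real.exp (-(β / 2 * y)) := by
      rw [← Real.exp_add]; congr 1; ring
    -- Half of the decay absorbs the factor y from 1 - e^{-2κy} ≤ 2κy, which is why the rate drops
    -- to β/2.
    have h3 : y * Real.exp (-(β / 2 * y)) ≤ 2 / β := by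
      rw [Real.exp_neg, ← div_eq_mul_inv, div_le_div_iff₀ (Real.exp_pos _) hβ]
      linarith [Real.add_one_le_exp (β / 2 * y)]
    have h4 : Real.exp (-(β * y)) ≤ Real.exp (-(β / 2 * y)) :=
      Real.exp_le_exp.2 (by nlinarith)
    have hK : 1 ≤ halfLineConst β := one_le_halfLineConst hβ
    calc _ = ‖Complex.exp (-(2 * κ * y)) * (err₂ κ P T U Φ Γ y - U y) +
          (Complex.exp (-(2 * κ * y)) - 1) * U y‖ := by congr 1; ring
      _ ≤ 1 * ((34 + 6 * halfLineConst β) * δ ^ 2 * Real.exp (-(β * y))) +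
          2 * δ * y * (2 * (δ * Real.exp (-(β * y)))) := by
          refine (norm_add_le _ _).trans (add_le_add ?_ ?_)
          · rw [norm_mul, norm_exp_weight]
            exact mul_le_mul hE1 (h.norm_err₂_sub hy.le) (norm_nonneg _) zero_le_one
          · rw [norm_mul]
            refine mul_le_mul (h1.trans ?_) (h.bound_U y hy.le) (norm_nonneg _) (by positivity)
            gcongr
      _ = (34 + 6 * halfLineConst β) * δ ^ 2 * Real.exp (-(β * y)) +
          4 * δ ^ 2 * ((y * Real.exp (-(β / 2 * y))) * Real.exp (-(β / 2 * y))) := by rw [h2]; ring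
      _ ≤ (34 + 6 * halfLineConst β) * δ ^ 2 * Real.exp (-(β / 2 * y)) +
          4 * δ ^ 2 * (2 / β * Real.exp (-(β / 2 * y))) := by gcongr
      _ = _ := by ring
  rw [e]
  refine (norm_sub_le _ _).trans ?_
  rw [norm_neg, norm_mul, hnκ]
  calc _ ≤ (34 + 6 * halfLineConst β + 8 / β) * δ ^ 2 * (Real.exp (-(β / 2 * 0)) / (β / 2)) +
        δ * (2 * halfLineConst β * δ) := by
        gcongr
        · exact norm_integral_Ioi_le_of_exp_bound (by positivity) hb
        · exact h.first_order le_rfl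
    _ = _ := by
        rw [halfLineConst₂, mul_zero, neg_zero, Real.exp_zero]
        field_simp

end HalfLineSystem

/-! ### Integrals with the weight e^{-β|x|}. -/

theorem integrable_exp_neg_mul_abs {β : ℝ} (hβ : 0 < β) :
    Integrable (fun x : ℝ => Real.exp (-(β * |x|))) := by
  have h1 : IntegrableOn (fun x : ℝ => Real.exp (-(β * |x|))) (Ioi 0) :=
    (integrableOn_exp_neg_mul_Ioi hβ 0).congr_fun (fun x hx => by rw [abs_of_pos hx]) measurableSet_Ioi
  have h2 : IntegrableOn (fun x : ℝ => Real.exp (-(β * |x|))) (Iic 0) := by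
    rw [← (Measure.measurePreserving_neg (volume : Measure ℝ)).integrableOn_comp_preimage
      (Homeomorph.neg ℝ).measurableEmbedding]
    simp only [Function.comp_def, abs_neg, neg_preimage, neg_Iic, neg_zero]
    exact (integrableOn_Ici_iff_integrableOn_Ioi (by simp)).2 h1
  rw [← integrableOn_univ, ← Iic_union_Ioi (a := (0 : ℝ))]
  exact h2.union h1

theorem integral_exp_neg_mul_abs {β : ℝ} (hβ : 0 < β) :
    ∫ x : ℝ, Real.exp (-(β * |x|)) = 2 / β := by
  rw [integral_comp_abs (f := fun x => Real.exp (-(β * x))), integral_exp_neg_mul_Ioi hβ]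
  simp; ring

theorem norm_integral_le_of_exp_abs_bound {g : ℝ → ℂ} {B β : ℝ} (hβ : 0 < β)
    (h : ∀ᵐ x, ‖g x‖ ≤ B * Real.exp (-(β * |x|))) : ‖∫ x, g x‖ ≤ B * (2 / β) := by
  rw [← integral_exp_neg_mul_abs hβ, ← integral_const_mul]
  exact norm_integral_le_of_norm_le ((integrable_exp_neg_mul_abs hβ).const_mul B) h

theorem integrable_of_exp_abs_bound {g : ℝ → ℂ} {B β : ℝ} (hβ : 0 < β)
    (hg : AEStronglyMeasurable g) (h : ∀ᵐ x, ‖g x‖ ≤ B * Real.exp (-(β * |x|))) :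
    Integrable g :=
  ((integrable_exp_neg_mul_abs hβ).const_mul B).mono' hg h

theorem tendsto_exp_neg_mul_atTop {β : ℝ} (hβ : 0 < β) :
    Tendsto (fun x : ℝ => Real.exp (-(β * x))) atTop (𝓝 0) :=
  Real.tendsto_exp_atBot.comp (tendsto_neg_atTop_atBot.comp (tendsto_id.const_mul_atTop hβ))

theorem tendsto_zero_of_exp_bound {f : ℝ → ℂ} {B β : ℝ} (hβ : 0 < β)
    (h : ∀ x, 0 ≤ x → ‖f x‖ ≤ B * Real.exp (-(β * x))) : Tendsto f atTop (𝓝 0) := by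
  refine squeeze_zero_norm' ((eventually_ge_atTop 0).mono h) ?_
  simpa using (tendsto_exp_neg_mul_atTop hβ).const_mul B

theorem exists_bound_of_tendsto {f : ℝ → ℂ} {a : ℂ} (hf : Continuous f)
    (ht : Tendsto f atTop (𝓝 a)) : ∃ B, ∀ x, 0 ≤ x → ‖f x‖ ≤ B := by
  obtain ⟨X, hX⟩ := eventually_atTop.1 (ht.norm.eventually (eventually_le_nhds
    (lt_add_one ‖a‖)))
  obtain ⟨B, hB⟩ := (isCompact_Icc (a := (0 : ℝ)) (b := X)).exists_bound_of_continuousOn hf.continuousOn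
  refine ⟨max B (‖a‖ + 1), fun x hx => ?_⟩
  rcases le_total x X with h | h
  · exact (hB x ⟨hx, h⟩).trans (le_max_left _ _)
  · exact (hX x h).trans (le_max_right _ _)

/-! ### Correctors and the expansion of the Wronskian. -/

/-- Functions `S`, `P` that absorb the oscillations of `V` up to small remainders:
`S' = V - R` and `P' = S - T`. -/
structure Corrector (β δ : ℝ) (V P T S R : ℝ → ℂ) : Prop where
  rate_pos : 0 < β
  continuous_T : Continuous T
  continuous_R : Continuous R
  deriv_S : ∀ x, HasDerivAt S (V x - R x) x
  deriv_P : ∀ x, HasDerivAt P (S x - T x) x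
  bound_P : ∀ x, ‖P x‖ ≤ δ * Real.exp (-(β * |x|))
  bound_T : ∀ x, ‖T x‖ ≤ δ * Real.exp (-(β * |x|))
  bound_R : ∀ x, ‖R x‖ ≤ δ * Real.exp (-(β * |x|))
  bound_S : ∀ x, ‖S x‖ ^ 2 ≤ δ * Real.exp (-(β * |x|))

namespace Corrector

variable {N β δ κ : ℝ} {V P T S R : ℝ → ℂ}

theorem continuous_S (h : Corrector β δ V P T S R) : Continuous S :=
  continuous_iff_continuousAt.2 fun x => (h.deriv_S x).continuousAt

theorem continuous_P (h : Corrector β δ V P T S R) : Continuous P :=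
  continuous_iff_continuousAt.2 fun x => (h.deriv_P x).continuousAt

/-- Under reflection the antiderivative S changes sign, the second antiderivative P does not, and T
follows S. -/
theorem comp_neg (h : Corrector β δ V P T S R) :
    Corrector β δ (fun x => V (-x)) (fun x => P (-x)) (fun x => -T (-x)) (fun x => -S (-x))
      (fun x => R (-x)) where
  rate_pos := h.rate_pos
  continuous_T := (h.continuous_T.comp continuous_neg).neg
  continuous_R := h.continuous_R.comp continuous_neg
  deriv_S x := by
    refine (((h.deriv_S (-x)).scomp x (hasDerivAt_neg x)).neg).congr_deriv ?_
    simp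
  deriv_P x := by
    refine ((h.deriv_P (-x)).scomp x (hasDerivAt_neg x)).congr_deriv ?_
    simp; ring
  bound_P x := by simpa using h.bound_P (-x)
  bound_T x := by simpa using h.bound_T (-x)
  bound_R x := by simpa using h.bound_R (-x)
  bound_S x := by simpa using h.bound_S (-x)

theorem norm_sub_sq_le (h : Corrector β δ V P T S R) (x : ℝ) :
    ‖R x - S x ^ 2‖ ≤ 2 * (δ * Real.exp (-(β * |x|))) := by
  refine (norm_sub_le _ _).trans ?_
  rw [norm_pow]
  linarith [h.bound_R x, h.bound_S x]

theorem integrable_sub_sq (h : Corrector β δ V P T S R) : Integrable fun x => R x - S x ^ 2 := by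
  have h1 := h.continuous_R
  have h2 := h.continuous_S
  exact integrable_of_exp_abs_bound (B := 2 * δ) h.rate_pos (by fun_prop)
    (Eventually.of_forall fun x => by rw [mul_assoc]; exact h.norm_sub_sq_le x)

theorem tendsto_S (h : Corrector β δ V P T S R) : Tendsto S atTop (𝓝 0) := by
  have h1 : Tendsto (fun x => S x ^ 2) atTop (𝓝 0) :=
    tendsto_zero_of_exp_bound (B := δ) h.rate_pos fun x hx => by
      have := h.bound_S x
      rwa [abs_of_nonneg hx, ← norm_pow] at this
  rw [tendsto_zero_iff_norm_tendsto_zero] at h1 ⊢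
  have h2 := h1.sqrt
  simpa [Real.sqrt_sq (norm_nonneg _)] using h2

/-- Here m' is `-modJostTail`, so the second component is e^{P}(m' - κm - Sm). Differentiating m' -
Sm replaces V by R but leaves the term -Sm'. As P' = S - T, the factors e^{±P} remove the terms
linear in S, in favour of T, and what remains is -S². -/
theorem halfLineSystem (h : Corrector β δ V P T S R) (hV : IsExpDecaying N β V)
    (hκ : 0 < κ) (hκδ : κ ≤ δ) (hδ : halfLineConst β * δ ≤ 1 / 4) :
    HalfLineSystem β δ κ P T (fun x => R x - S x ^ 2)
      (fun x => Complex.exp (-P x) * modJost V (Complex.I * κ) x)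
      (fun x => Complex.exp (P x) * (-κ * modJost V (Complex.I * κ) x -
        modJostTail V (Complex.I * κ) x - S x * modJost V (Complex.I * κ) x)) := by
  have hk : 0 < (Complex.I * κ).im := by simpa using hκ
  set k := Complex.I * (κ : ℂ) with hkdef
  have hik : 2 * Complex.I * k = -(2 * κ) := by
    rw [hkdef]; linear_combination (2 * (κ : ℂ)) * Complex.I_sq
  have hm := hasDerivAt_modJost hV hk
  have hG := hasDerivAt_modJostTail hV hk
  rw [hik] at hG
  have hP := h.tendsto_S
  have tm : Tendsto (modJost V k) atTop (𝓝 1) := by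
    rw [← tendsto_sub_nhds_zero_iff]
    refine tendsto_zero_of_exp_bound (B := N * modJostBound N β ‖k‖ 0 / ‖k‖ / β) hV.rate_pos
      fun x hx => (norm_modJost_sub_one_le hV hk hx).trans_eq (by ring)
  have tG : Tendsto (modJostTail V k) atTop (𝓝 0) :=
    tendsto_zero_of_exp_bound (B := N * modJostBound N β ‖k‖ 0 / β) hV.rate_pos
      fun x hx => (norm_modJostTail_le hV hk hx).trans_eq (by ring)
  have tP : Tendsto P atTop (𝓝 0) :=
    tendsto_zero_of_exp_bound (B := δ) hV.rate_pos fun x hx => by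
      simpa [abs_of_nonneg hx] using h.bound_P x
  have tΦ : Tendsto (fun x => Complex.exp (-P x) * modJost V k x) atTop (𝓝 1) := by
    simpa using ((Complex.continuous_exp.tendsto _).comp tP.neg).mul tm
  have tΓ : Tendsto (fun x => Complex.exp (P x) * (-κ * modJost V k x - modJostTail V k x -
      S x * modJost V k x)) atTop (𝓝 (-κ)) := by
    simpa using ((Complex.continuous_exp.tendsto _).comp tP).mul
      (((tm.const_mul (-κ : ℂ)).sub tG).sub (h.tendsto_S.mul tm))
  have dΦ : ∀ x, HasDerivAt (fun x => Complex.exp (-P x) * modJost V k x)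
      (κ * (Complex.exp (-P x) * modJost V k x) + Complex.exp (2 * -P x) * (Complex.exp (P x) *
        (-κ * modJost V k x - modJostTail V k x - S x * modJost V k x)) +
        T x * (Complex.exp (-P x) * modJost V k x)) x := fun x => by
    refine (((h.deriv_P x).neg.cexp).mul (hm x)).congr_deriv ?_
    have : Complex.exp (2 * -P x) * Complex.exp (P x) = Complex.exp (-P x) := by
      rw [← Complex.exp_add]; congr 1; ring
    linear_combination (-(-κ * modJost V k x - modJostTail V k x - S x * modJost V k x)) * this
  have dΓ : ∀ x, HasDerivAt (fun x => Complex.exp (P x) * (-κ * modJost V k x -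
        modJostTail V k x - S x * modJost V k x))
      (κ * (Complex.exp (P x) * (-κ * modJost V k x - modJostTail V k x - S x * modJost V k x)) +
        Complex.exp (2 * P x) * (R x - S x ^ 2 + κ ^ 2) * (Complex.exp (-P x) * modJost V k x) -
        T x * (Complex.exp (P x) * (-κ * modJost V k x - modJostTail V k x -
          S x * modJost V k x))) x := fun x => by
    refine (((h.deriv_P x).cexp).mul ((((hm x).const_mul (-κ : ℂ)).sub (hG x)).sub
      ((h.deriv_S x).mul (hm x)))).congr_deriv ?_
    have : Complex.exp (2 * P x) * Complex.exp (-P x) = Complex.exp (P x) := by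
      rw [← Complex.exp_add]; congr 1; ring
    simp only [Pi.sub_apply, Pi.mul_apply]
    linear_combination (-(R x - S x ^ 2 + κ ^ 2) * modJost V k x) * this
  have hR := h.continuous_R
  have hS := h.continuous_S
  refine ⟨h.rate_pos, hκ, hκδ, hδ, h.continuous_P, h.continuous_T, by fun_prop, fun x hx => ?_,
    fun x hx => ?_, fun x hx => ?_, dΦ, dΓ, tΦ, ?_, ?_⟩
  · simpa [abs_of_nonneg hx] using h.bound_P x
  · simpa [abs_of_nonneg hx] using h.bound_T x
  · simpa [abs_of_nonneg hx] using h.norm_sub_sq_le x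
  · simpa using tΓ.add (tΦ.const_mul (κ : ℂ))
  · obtain ⟨B₁, h₁⟩ := exists_bound_of_tendsto
      (continuous_iff_continuousAt.2 fun x => (dΦ x).continuousAt) tΦ
    obtain ⟨B₂, h₂⟩ := exists_bound_of_tendsto
      (continuous_iff_continuousAt.2 fun x => (dΓ x).continuousAt) tΓ
    exact ⟨max B₁ B₂, fun x hx => ⟨(h₁ x hx).trans (le_max_left _ _),
      (h₂ x hx).trans (le_max_right _ _)⟩⟩

/-- The Wronskian on the imaginary axis to second order in the size of the corrector. -/
theorem norm_jostWronskian_sub_le (h : Corrector β δ V P T S R) (hV : IsExpDecaying N β V)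
    (hκ : 0 < κ) (hκδ : κ ≤ δ) (hδ : halfLineConst β * δ ≤ 1 / 4) :
    ‖jostWronskian V (Complex.I * κ) - (2 * κ + ∫ x, (R x - S x ^ 2))‖ ≤
      (8 * halfLineConst β ^ 2 + 2 * halfLineConst₂ β) * δ ^ 2 := by
  have s₁ := h.halfLineSystem hV hκ hκδ hδ
  have s₂ := h.comp_neg.halfLineSystem hV.comp_neg hκ hκδ hδ
  have a₁ := s₁.first_order le_rfl
  have a₂ := s₂.first_order le_rfl
  have b₁ := s₁.first_order_Γ le_rfl
  have b₂ := s₂.first_order_Γ le_rfl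
  have c₁ := s₁.second_order
  have c₂ := s₂.second_order
  have hsplit : ∫ x, (R x - S x ^ 2) =
      (∫ x in Ioi 0, (R x - S x ^ 2)) + ∫ x in Ioi 0, (R (-x) - (-S (-x)) ^ 2) := by
    simp only [neg_sq]
    rw [integral_comp_neg_Ioi (f := fun x => R x - S x ^ 2), neg_zero, add_comm,
      intervalIntegral.integral_Iic_add_Ioi h.integrable_sub_sq.integrableOn
        h.integrable_sub_sq.integrableOn]
  simp only [neg_zero] at a₂ b₂ c₂
  set k := Complex.I * (κ : ℂ) with hkdef
  set Φ₁ := Complex.exp (-P 0) * modJost V k 0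
  set Φ₂ := Complex.exp (-P 0) * modJost (fun x => V (-x)) k 0
  set Γ₁ := Complex.exp (P 0) * (-κ * modJost V k 0 - modJostTail V k 0 - S 0 * modJost V k 0)
  set Γ₂ := Complex.exp (P 0) * (-κ * modJost (fun x => V (-x)) k 0 -
    modJostTail (fun x => V (-x)) k 0 - -S 0 * modJost (fun x => V (-x)) k 0)
  -- The factors e^{±P(0)} multiply to 1, and the contributions of S(0) cancel because S enters the
  -- two half-line problems with opposite signs.
  have hW : jostWronskian V k = -(Φ₁ * Γ₂ + Φ₂ * Γ₁) := by
    have hE : Complex.exp (-P 0) * Complex.exp (P 0) = 1 := by rw [← Complex.exp_add]; simp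
    have hI : Complex.I * k = -κ := by
      rw [hkdef]; linear_combination (κ : ℂ) * Complex.I_sq
    rw [jostWronskian, hI]
    simp only [Φ₁, Φ₂, Γ₁, Γ₂]
    linear_combination (modJost V k 0 * (-κ * modJost (fun x => V (-x)) k 0 -
      modJostTail (fun x => V (-x)) k 0) + modJost (fun x => V (-x)) k 0 *
        (-κ * modJost V k 0 - modJostTail V k 0)) * hE
  set J₁ := ∫ x in Ioi 0, (R x - S x ^ 2)
  set J₂ := ∫ x in Ioi 0, (R (-x) - (-S (-x)) ^ 2)
  have e : jostWronskian V k - (2 * κ + ∫ x, (R x - S x ^ 2)) =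
      -((Φ₁ - 1) * Γ₂ + (Φ₂ - 1) * Γ₁ + (Γ₁ + κ + J₁) + (Γ₂ + κ + J₂)) := by
    rw [hW, hsplit]; ring
  set K := halfLineConst β
  have hK : 1 ≤ K := one_le_halfLineConst h.rate_pos
  have hδ0 : 0 < δ := hκ.trans_le hκδ
  rw [e, norm_neg]
  calc _ ≤ (2 * K * δ) * (2 * K * δ) + (2 * K * δ) * (2 * K * δ) + halfLineConst₂ β * δ ^ 2 +
        halfLineConst₂ β * δ ^ 2 := by
        refine (norm_add_le _ _).trans (add_le_add ((norm_add_le _ _).trans (add_le_add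
          ((norm_add_le _ _).trans (add_le_add ?_ ?_)) c₁)) c₂)
        · rw [norm_mul]; gcongr
        · rw [norm_mul]; gcongr
    _ = _ := by ring

end Corrector

/-! ### Weak derivatives on the line -/

theorem exists_bound_support {φ : ℝ → ℝ} (hc : HasCompactSupport φ) :
    ∃ M : ℝ, 0 < M ∧ ∀ x, x ∉ Ioo (-M) M → φ x = 0 := by
  obtain ⟨r, hr⟩ := hc.isCompact.isBounded.subset_ball (0 : ℝ)
  refine ⟨max r 1, by positivity, fun x hx => image_eq_zero_of_notMem_tsupport fun h => hx ?_⟩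
  have := hr h
  rw [Metric.mem_ball, dist_zero_right, Real.norm_eq_abs, abs_lt] at this
  exact ⟨by linarith [le_max_left r 1], by linarith [le_max_left r 1]⟩

theorem integral_eq_intervalIntegral_of_support {E : Type*} [NormedAddCommGroup E] [NormedSpace ℝ E]
    {f : ℝ → E} {M : ℝ}
    (h : ∀ x, x ∉ Ioo (-M) M → f x = 0) : ∫ x, f x = ∫ x in (-M)..M, f x := by
  refine (intervalIntegral.integral_eq_integral_of_support_subset fun x hx => ?_).symm
  by_contra hx'
  exact hx (h x fun h' => hx' ⟨h'.1, h'.2.le⟩)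

theorem LocallyIntegrable.intervalIntegrable' {E : Type*} [NormedAddCommGroup E] {g : ℝ → E}
    (hg : LocallyIntegrable g volume) (a b : ℝ) : IntervalIntegrable g volume a b :=
  intervalIntegrable_iff.mpr
    ((hg.integrableOn_isCompact isCompact_uIcc).mono_set uIoc_subset_uIcc)

/-- The endpoints ±M are included: there the derivative is computed within the half line on which φ
vanishes. -/
theorem deriv_eq_zero_of_support {φ : ℝ → ℝ} {M : ℝ} (hd : Differentiable ℝ φ)
    (h : ∀ x, x ∉ Ioo (-M) M → φ x = 0) (x : ℝ) (hx : x ∉ Ioo (-M) M) : deriv φ x = 0 := by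
  have key : ∀ s : Set ℝ, UniqueDiffWithinAt ℝ s x → x ∈ s → (∀ y ∈ s, φ y = 0) → deriv φ x = 0 := by
    intro s hs hxs h0
    rw [← (hd x).derivWithin hs, derivWithin_congr (fun y hy => h0 y hy) (h0 x hxs)]
    simp
  rw [mem_Ioo, not_and_or, not_lt, not_lt] at hx
  rcases hx with hx | hx
  · exact key (Iic x) (uniqueDiffOn_Iic x x self_mem_Iic) self_mem_Iic fun y hy => h y fun h' =>
      absurd (h'.1.trans_le (le_trans hy hx)) (lt_irrefl _)
  · exact key (Ici x) (uniqueDiffOn_Ici x x self_mem_Ici) self_mem_Ici fun y hy => h y fun h' =>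
      absurd ((le_trans hx hy).trans_lt h'.2) (lt_irrefl _)

/-- The primitive is only absolutely continuous, so integration by parts for absolutely continuous
functions is combined with Lebesgue's differentiation theorem. Complex g are treated later through
real and imaginary parts. -/
theorem integral_deriv_mul_primitive {g : ℝ → ℝ} (hg : LocallyIntegrable g volume) {φ : ℝ → ℝ}
    (hφ : ContDiff ℝ ∞ φ) (hc : HasCompactSupport φ) :
    ∫ x, deriv φ x * ∫ y in (0 : ℝ)..x, g y = -∫ x, φ x * g x := by
  obtain ⟨M, hM, hsupp⟩ := exists_bound_support hc
  have hd := hφ.differentiable (by simp)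
  have hsupp' := deriv_eq_zero_of_support hd hsupp
  rw [integral_eq_intervalIntegral_of_support fun x hx => by rw [hsupp' x hx, zero_mul],
    integral_eq_intervalIntegral_of_support fun x hx => by rw [hsupp x hx, zero_mul]]
  have h0 : (0 : ℝ) ∈ uIcc (-M) M := by rw [uIcc_of_le (by linarith)]; constructor <;> linarith
  have hac := (LocallyIntegrable.intervalIntegrable' hg (-M)
    M).absolutelyContinuousOnInterval_intervalIntegral h0
  have hφac : AbsolutelyContinuousOnInterval φ (-M) M :=
    (hφ.of_le (by exact_mod_cast le_top)).contDiffOn.absolutelyContinuousOnInterval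
  have h1 := hac.integral_mul_deriv_eq_deriv_mul hφac
  rw [hsupp M (by simp), hsupp (-M) (by simp)] at h1
  simp only [mul_zero, sub_zero, zero_sub] at h1
  rw [intervalIntegral.integral_congr (g := fun x => (∫ y in (0 : ℝ)..x, g y) * deriv φ x)
    fun x _ => mul_comm _ _, h1]
  congr 1
  refine intervalIntegral.integral_congr_ae ?_
  filter_upwards [_root_.LocallyIntegrable.ae_hasDerivAt_integral hg] with x hx _
  rw [(hx 0).deriv, mul_comm]

theorem continuous_primitive {g : ℝ → ℂ} (hg : LocallyIntegrable g volume) :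
    Continuous fun x => ∫ y in (0 : ℝ)..x, g y :=
  intervalIntegral.continuous_primitive (LocallyIntegrable.intervalIntegrable' hg) 0

theorem hasWeakDeriv_primitive {g : ℝ → ℂ} (hg : LocallyIntegrable g volume) :
    HasWeakDeriv (fun x => ∫ y in (0 : ℝ)..x, g y) g where
  locallyIntegrable := (continuous_primitive hg).locallyIntegrable
  locallyIntegrable_deriv := hg
  integral_eq φ hφ hc := by
    have hd : Continuous (deriv φ) := hφ.continuous_deriv (by simp)
    have i1 := integrable_test_smul (continuous_primitive hg).locallyIntegrable hd hc.deriv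
    have i2 := integrable_test_smul hg hφ.continuous hc
    have aux : ∀ L : ℂ →L[ℝ] ℝ, L (∫ x, deriv φ x • ∫ y in (0 : ℝ)..x, g y) =
        L (-∫ x, φ x • g x) := fun L => by
      have hgL : LocallyIntegrable (fun x => L (g x)) volume := by
        intro x
        obtain ⟨s, hs, hi⟩ := hg x
        exact ⟨s, hs, L.integrable_comp hi⟩
      rw [map_neg, ← L.integral_comp_comm i1, ← L.integral_comp_comm i2]
      simp only [map_smul, smul_eq_mul]
      rw [← integral_deriv_mul_primitive hgL hφ hc]
      congr 1 with x
      rw [L.intervalIntegral_comp_comm (LocallyIntegrable.intervalIntegrable' hg 0 x)]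
    exact Complex.ext (aux Complex.reCLM) (aux Complex.imCLM)

/-- A smooth compactly supported function of integral zero has such a primitive. -/
theorem exists_primitive_test {η : ℝ → ℝ} (hη : ContDiff ℝ ∞ η) (hc : HasCompactSupport η)
    (h0 : ∫ x, η x = 0) :
    ∃ H : ℝ → ℝ, ContDiff ℝ ∞ H ∧ HasCompactSupport H ∧ deriv H = η := by
  obtain ⟨M, hM, hsupp⟩ := exists_bound_support hc
  have hd : ∀ x, HasDerivAt (fun x => ∫ y in (-M)..x, η y) (η x) x := fun x =>
    intervalIntegral.integral_hasDerivAt_right (hη.continuous.intervalIntegrable _ _)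
      (hη.continuous.stronglyMeasurableAtFilter _ _) hη.continuous.continuousAt
  have hderiv : deriv (fun x => ∫ y in (-M)..x, η y) = η := funext fun x => (hd x).deriv
  refine ⟨fun x => ∫ y in (-M)..x, η y, ?_, ?_, hderiv⟩
  · rw [contDiff_infty_iff_deriv, hderiv]
    exact ⟨fun x => (hd x).differentiableAt, hη⟩
  · refine HasCompactSupport.intro (isCompact_Icc (a := -M) (b := M)) fun x hx => ?_
    rw [mem_Icc, not_and_or, not_le, not_le] at hx
    rcases hx with hx | hx
    · rw [intervalIntegral.integral_symm, intervalIntegral.integral_congr (g := fun _ => (0 : ℝ))]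
      · simp
      · intro y hy
        rw [uIcc_of_le hx.le] at hy
        exact hsupp y fun h => absurd (h.1.trans_le hy.2) (lt_irrefl _)
    · rw [← intervalIntegral.integral_add_adjacent_intervals (b := M)
        (hη.continuous.intervalIntegrable _ _) (hη.continuous.intervalIntegrable _ _),
        ← integral_eq_intervalIntegral_of_support hsupp, h0, zero_add,
        intervalIntegral.integral_congr (g := fun _ => (0 : ℝ))]
      · simp
      · intro y hy
        rw [uIcc_of_le hx.le] at hy
        exact hsupp y fun h => absurd (hy.1.trans_lt h.2) (lt_irrefl _)

/-- The du Bois-Reymond argument: subtracting from a test function φ the multiple (∫φ)p of a fixed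
bump of integral 1 leaves the derivative of a test function. The constant is thus ∫pf. -/
theorem HasWeakDeriv.ae_eq_const {f : ℝ → ℂ} (h : HasWeakDeriv f fun _ => 0) :
    ∃ c : ℂ, f =ᵐ[volume] fun _ => c := by
  obtain ⟨ψ⟩ : Nonempty (ContDiffBump (0 : ℝ)) := inferInstance
  set p := ψ.normed volume with hp
  have hp1 : ContDiff ℝ ∞ p := ψ.contDiff_normed
  have hp2 : HasCompactSupport p := ψ.hasCompactSupport_normed
  refine ⟨∫ x, p x • f x, ae_eq_of_integral_contDiff_smul_eq h.locallyIntegrable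
    (locallyIntegrable_const _) fun φ hφ hc => ?_⟩
  have hφi : Integrable φ := hφ.continuous.integrable_of_hasCompactSupport hc
  have hpi : Integrable p := hp1.continuous.integrable_of_hasCompactSupport hp2
  set I := ∫ x, φ x with hI
  have hη : ContDiff ℝ ∞ fun x => φ x - I * p x := hφ.sub (contDiff_const.mul hp1)
  have hηc : HasCompactSupport fun x => φ x - I * p x := hc.sub hp2.mul_left
  obtain ⟨H, hH, hHc, hHd⟩ := exists_primitive_test hη hηc (by
    rw [integral_sub hφi (hpi.const_mul I), integral_const_mul, hp, ψ.integral_normed, ← hI]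
    ring)
  have h1 := h.integral_eq H hH hHc
  rw [hHd] at h1
  simp only [smul_zero, integral_zero, neg_zero, sub_smul, mul_smul] at h1
  have h2 : Integrable fun x => I • p x • f x :=
    (integrable_test_smul h.locallyIntegrable hp1.continuous hp2).smul I
  rw [integral_sub (integrable_test_smul h.locallyIntegrable hφ.continuous hc) h2,
    integral_smul] at h1
  rw [integral_smul_const, ← hI]
  exact sub_eq_zero.1 h1

theorem HasWeakDeriv.ae_eq_primitive {f g : ℝ → ℂ} (h : HasWeakDeriv f g) :
    ∃ c : ℂ, f =ᵐ[volume] fun x => c + ∫ y in (0 : ℝ)..x, g y := by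
  have h1 := h.add ((hasWeakDeriv_primitive h.locallyIntegrable_deriv).const_smul (-1))
  obtain ⟨c, hc⟩ := (h1.congr (Filter.EventuallyEq.refl _ _) (g' := fun _ => 0)
    (Eventually.of_forall fun x => by simp)).ae_eq_const
  refine ⟨c, ?_⟩
  filter_upwards [hc] with x hx
  rw [← hx]; ring

theorem HasWeakDeriv.exists_continuous {f g : ℝ → ℂ} (h : HasWeakDeriv f g) :
    ∃ F : ℝ → ℂ, f =ᵐ[volume] F ∧ Continuous F := by
  obtain ⟨c, hc⟩ := h.ae_eq_primitive
  exact ⟨_, hc, continuous_const.add (continuous_primitive h.locallyIntegrable_deriv)⟩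

theorem HasWeakDeriv.exists_hasDerivAt {f g G : ℝ → ℂ} (h : HasWeakDeriv f g)
    (hg : g =ᵐ[volume] G) (hG : Continuous G) :
    ∃ F : ℝ → ℂ, f =ᵐ[volume] F ∧ ∀ x, HasDerivAt F (G x) x := by
  obtain ⟨c, hc⟩ := (h.congr (Filter.EventuallyEq.refl _ _) hg).ae_eq_primitive
  exact ⟨_, hc, fun x => (intervalIntegral.integral_hasDerivAt_right (hG.intervalIntegrable _ _)
    (hG.stronglyMeasurableAtFilter _ _) hG.continuousAt).const_add c⟩

theorem hasWeakDeriv_of_hasDerivAt {F G : ℝ → ℂ} (h : ∀ x, HasDerivAt F (G x) x)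
    (hG : Continuous G) : HasWeakDeriv F G where
  locallyIntegrable :=
    (continuous_iff_continuousAt.2 fun x => (h x).continuousAt).locallyIntegrable
  locallyIntegrable_deriv := hG.locallyIntegrable
  integral_eq φ hφ hc := by
    have hF : Continuous F := continuous_iff_continuousAt.2 fun x => (h x).continuousAt
    have hd : Continuous (deriv φ) := hφ.continuous_deriv (by simp)
    have h1 := integrable_test_smul hF.locallyIntegrable hd hc.deriv
    have h2 := integrable_test_smul hG.locallyIntegrable hφ.continuous hc
    have h3 := integrable_test_smul hF.locallyIntegrable hφ.continuous hc
    have h4 := integral_eq_zero_of_hasDerivAt_of_integrable (f := fun x => φ x • F x)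
      (f' := fun x => φ x • G x + deriv φ x • F x)
      (fun x => ((hφ.differentiable (by simp) x).hasDerivAt).smul (h x)) (h2.add h1) h3
    rw [integral_add h2 h1] at h4
    exact eq_neg_of_add_eq_zero_right h4

/-- Integration by parts against a bounded smooth function. -/
theorem HasWeakDeriv.integral_bounded {f f' : ℝ → ℂ} (h : HasWeakDeriv f f') (hf : Integrable f)
    (hf' : Integrable f') {u : ℝ → ℝ} (hu : ContDiff ℝ ∞ u) {C : ℝ} (hu0 : ∀ x, |u x| ≤ C)
    (hu1 : ∀ x, |deriv u x| ≤ C) : ∫ x, deriv u x • f x = -∫ x, u x • f' x := by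
  have hC : 0 ≤ C := (abs_nonneg _).trans (hu0 0)
  obtain ⟨χ⟩ : Nonempty (ContDiffBump (0 : ℝ)) := inferInstance
  have hχ : ContDiff ℝ ∞ χ := χ.contDiff
  have hχd : Continuous (deriv χ) := hχ.continuous_deriv (by simp)
  obtain ⟨D, hD⟩ := hχd.bounded_above_of_compact_support χ.hasCompactSupport.deriv
  have hD0 : 0 ≤ D := (norm_nonneg _).trans (hD 0)
  let s : ℕ → ℝ := fun n => 1 / ((n : ℝ) + 1)
  have hs0 : ∀ n, 0 < s n := fun n => by positivity
  have hs1 : ∀ n, s n ≤ 1 := fun n => by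
    rw [div_le_one (by positivity)]; linarith [n.cast_nonneg (α := ℝ)]
  have hs : Tendsto s atTop (𝓝 0) := tendsto_one_div_add_atTop_nhds_zero_nat
  -- Dilated cutoffs exhaust the line as s n → 0, while s n ≤ 1 keeps their derivatives bounded;
  -- dominated convergence applies on both sides.
  let φ : ℕ → ℝ → ℝ := fun n x => χ (s n * x) * u x
  have hφ : ∀ n, ContDiff ℝ ∞ (φ n) := fun n => (hχ.comp (contDiff_const.mul contDiff_id)).mul hu
  have hφc : ∀ n, HasCompactSupport (φ n) := fun n =>
    (χ.hasCompactSupport.comp_homeomorph (Homeomorph.mulLeft₀ (s n) (hs0 n).ne')).mul_right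
  have hφd : ∀ n x, deriv (φ n) x = deriv χ (s n * x) * s n * u x + χ (s n * x) * deriv u x := by
    intro n x
    have h1 : HasDerivAt (fun x => χ (s n * x)) (deriv χ (s n * x) * (s n * 1)) x :=
      ((hχ.differentiable (by simp) _).hasDerivAt).comp x ((hasDerivAt_id x).const_mul (s n))
    rw [mul_one] at h1
    exact (h1.mul (hu.differentiable (by simp) x).hasDerivAt).deriv
  have hlim : ∀ x, Tendsto (fun n => χ (s n * x)) atTop (𝓝 1) := fun x => by
    have h1 : Tendsto (fun n => s n * x) atTop (𝓝 0) := by simpa using hs.mul_const x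
    have h2 := (hχ.continuous.tendsto 0).comp h1
    rwa [χ.one_of_mem_closedBall (Metric.mem_closedBall_self χ.rIn_pos.le)] at h2
  have hlimd : ∀ x, Tendsto (fun n => deriv (φ n) x) atTop (𝓝 (deriv u x)) := fun x => by
    simp only [hφd]
    have h1 : Tendsto (fun n => deriv χ (s n * x)) atTop (𝓝 (deriv χ 0)) :=
      (hχd.tendsto 0).comp (by simpa using hs.mul_const x)
    simpa using ((h1.mul hs).mul_const (u x)).add ((hlim x).mul_const (deriv u x))
  have t1 : Tendsto (fun n => ∫ x, deriv (φ n) x • f x) atTop (𝓝 (∫ x, deriv u x • f x)) := by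
    refine tendsto_integral_of_dominated_convergence (fun x => (D * 1 * C + 1 * C) * ‖f x‖)
      (fun n => ?_) (hf.norm.const_mul _) (fun n => Eventually.of_forall fun x => ?_)
      (Eventually.of_forall fun x => (hlimd x).smul_const _)
    · exact ((hφ n).continuous_deriv (by simp)).aestronglyMeasurable.smul hf.1
    · rw [norm_smul, hφd]
      refine mul_le_mul_of_nonneg_right ((norm_add_le _ _).trans (add_le_add ?_ ?_)) (norm_nonneg _)
      · rw [norm_mul, norm_mul]
        gcongr
        · exact hD _
        · rw [Real.norm_of_nonneg (hs0 n).le]; exact hs1 n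
        · exact hu0 x
      · rw [norm_mul]
        gcongr
        · rw [Real.norm_of_nonneg χ.nonneg]; exact χ.le_one
        · exact hu1 x
  have t2 : Tendsto (fun n => ∫ x, φ n x • f' x) atTop (𝓝 (∫ x, u x • f' x)) := by
    refine tendsto_integral_of_dominated_convergence (fun x => (1 * C) * ‖f' x‖)
      (fun n => ?_) (hf'.norm.const_mul _) (fun n => Eventually.of_forall fun x => ?_)
      (Eventually.of_forall fun x => ?_)
    · exact (hφ n).continuous.aestronglyMeasurable.smul hf'.1
    · rw [norm_smul, norm_mul]
      gcongr
      · rw [Real.norm_of_nonneg χ.nonneg]; exact χ.le_one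
      · exact hu0 x
    · simpa [φ] using ((hlim x).mul_const (u x)).smul_const (f' x)
  refine tendsto_nhds_unique t1 (t2.neg.congr fun n => ?_)
  exact (h.integral_eq (φ n) (hφ n) (hφc n)).symm

/-- Non-stationary phase, to first order. -/
theorem HasWeakDeriv.norm_integral_exp_le {f f' : ℝ → ℂ} (h : HasWeakDeriv f f') {β B : ℝ}
    (hβ : 0 < β) (hf : ∀ᵐ x, ‖f x‖ ≤ B * Real.exp (-(β * |x|)))
    (hf' : ∀ᵐ x, ‖f' x‖ ≤ B * Real.exp (-(β * |x|))) {ν : ℝ} (hν : ν ≠ 0) :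
    ‖∫ x : ℝ, f x * Complex.exp (Complex.I * ν * x)‖ ≤ 1 / |ν| * (B * (2 / β)) := by
  have i1 := integrable_of_exp_abs_bound hβ h.locallyIntegrable.aestronglyMeasurable hf
  have i2 := integrable_of_exp_abs_bound hβ h.locallyIntegrable_deriv.aestronglyMeasurable hf'
  -- Test functions are real, so the exponential is treated as cosine plus i times sine.
  have hcd : ContDiff ℝ ∞ fun x : ℝ => Real.cos (ν * x) := by fun_prop
  have hsd : ContDiff ℝ ∞ fun x : ℝ => Real.sin (ν * x) := by fun_prop
  have dc : ∀ x, deriv (fun x : ℝ => Real.cos (ν * x)) x = -(ν * Real.sin (ν * x)) := fun x => by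
    have := ((hasDerivAt_id x).const_mul ν).cos.deriv
    simp only [id, mul_one] at this
    rw [this]; ring
  have ds : ∀ x, deriv (fun x : ℝ => Real.sin (ν * x)) x = ν * Real.cos (ν * x) := fun x => by
    have := ((hasDerivAt_id x).const_mul ν).sin.deriv
    simp only [id, mul_one] at this
    rw [this]; ring
  have e1 := h.integral_bounded i1 i2 hcd (C := max 1 |ν|)
    (fun x => (Real.abs_cos_le_one _).trans (le_max_left _ _)) (fun x => by
      rw [dc, abs_neg, abs_mul]
      exact (mul_le_of_le_one_right (abs_nonneg _) (Real.abs_sin_le_one _)).trans (le_max_right _ _))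
  have e2 := h.integral_bounded i1 i2 hsd (C := max 1 |ν|)
    (fun x => (Real.abs_sin_le_one _).trans (le_max_left _ _)) (fun x => by
      rw [ds, abs_mul]
      exact (mul_le_of_le_one_right (abs_nonneg _) (Real.abs_cos_le_one _)).trans (le_max_right _ _))
  have hexp : ∀ x : ℝ, Complex.exp (Complex.I * ν * x) =
      ((Real.cos (ν * x) : ℝ) : ℂ) + ((Real.sin (ν * x) : ℝ) : ℂ) * Complex.I := fun x => by
    push_cast
    rw [← Complex.exp_mul_I]; congr 1; ring
  have bd : ∀ {g : ℝ → ℂ} (hg : Integrable g) (u : ℝ → ℝ), Continuous u → (∀ x, |u x| ≤ 1) →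
      Integrable fun x => u x • g x := fun hg u hu h1 =>
    hg.bdd_smul 1 hu.aestronglyMeasurable (Eventually.of_forall h1)
  have c1 := bd i1 _ hcd.continuous fun x => Real.abs_cos_le_one _
  have c2 := bd i1 _ hsd.continuous fun x => Real.abs_sin_le_one _
  have c3 := bd i2 _ hcd.continuous fun x => Real.abs_cos_le_one _
  have c4 := bd i2 _ hsd.continuous fun x => Real.abs_sin_le_one _
  have split : ∀ {g : ℝ → ℂ}, Integrable (fun x => Real.cos (ν * x) • g x) →
      Integrable (fun x => Real.sin (ν * x) • g x) →
      ∫ x : ℝ, g x * Complex.exp (Complex.I * ν * x) =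
        (∫ x, Real.cos (ν * x) • g x) + Complex.I * ∫ x, Real.sin (ν * x) • g x := by
    intro g h1 h2
    rw [← integral_const_mul, ← integral_add h1 (h2.const_mul _)]
    congr 1 with x
    rw [hexp, Complex.real_smul, Complex.real_smul]; ring
  simp only [dc, ds, neg_smul, mul_smul, integral_neg, integral_smul] at e1 e2
  have key : Complex.I * ν * ∫ x : ℝ, f x * Complex.exp (Complex.I * ν * x) =
      -∫ x : ℝ, f' x * Complex.exp (Complex.I * ν * x) := by
    rw [split c1 c2, split c3 c4]
    simp only [Complex.real_smul] at e1 e2 ⊢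
    linear_combination Complex.I * e2 + e1 +
      (ν * ∫ x, ((Real.sin (ν * x) : ℝ) : ℂ) * f x) * Complex.I_sq
  have hn := congrArg norm key
  rw [norm_mul, norm_neg, norm_mul, Complex.norm_I, one_mul, Complex.norm_real,
    Real.norm_eq_abs] at hn
  have hν' : 0 < |ν| := abs_pos.2 hν
  rw [one_div, ← div_eq_inv_mul, le_div_iff₀ hν', mul_comm, hn]
  refine norm_integral_le_of_exp_abs_bound hβ ?_
  filter_upwards [hf'] with x hx
  rw [norm_mul, Complex.norm_exp]
  simpa using hx

/-! ### Classical representatives of the profiles. -/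

theorem ae_norm_le_of_expNorm_le {β : ℝ} {g : ℝ → ℂ} {n : ℝ} (h : expNorm β g ≤ ENNReal.ofReal n)
    (hn : 0 ≤ n) : ∀ᵐ x, ‖g x‖ ≤ n * Real.exp (-(β * |x|)) := by
  rw [expNorm, eLpNorm_exponent_top] at h
  filter_upwards [enorm_ae_le_eLpNormEssSup (fun x : ℝ => Real.exp (β * |x|) • g x) volume] with x hx
  have h1 := hx.trans h
  rw [← ofReal_norm, ENNReal.ofReal_le_ofReal_iff hn, norm_smul,
    Real.norm_of_nonneg (Real.exp_nonneg _)] at h1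
  rw [Real.exp_neg, ← div_eq_mul_inv, le_div_iff₀ (Real.exp_pos _), mul_comm]
  exact h1

theorem le_of_ae_le_of_continuous {f g : ℝ → ℝ} (hf : Continuous f) (hg : Continuous g)
    (h : ∀ᵐ x, f x ≤ g x) (x : ℝ) : f x ≤ g x := by
  have hc : IsClosed {x | f x ≤ g x} := isClosed_le hf hg
  have hd : Dense {x | f x ≤ g x} := Measure.dense_of_ae h
  have := hc.closure_eq ▸ hd.closure_eq
  exact (this ▸ mem_univ x : x ∈ {x | f x ≤ g x})

/-- Twice continuously differentiable profiles `Q₀ j`, with derivatives `Q₁ j` and `Q₂ j`, weak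
third derivatives `Q₃ j`, summable exponentially weighted bounds `n j`, and separated
frequencies. -/
structure SmoothProfile (θ β : ℝ) (lam : Idx → ℝ) (Q₀ Q₁ Q₂ Q₃ : Idx → ℝ → ℂ) (n : Idx → ℝ) :
    Prop where
  θ_pos : 0 < θ
  rate_pos : 0 < β
  gap : ∀ j l : Idx, j ≠ l → θ ≤ |lam j - lam l|
  lam_ge : ∀ j, θ ≤ |lam j|
  summable : Summable n
  deriv₀ : ∀ j x, HasDerivAt (Q₀ j) (Q₁ j x) x
  deriv₁ : ∀ j x, HasDerivAt (Q₁ j) (Q₂ j x) x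
  weak : ∀ j, HasWeakDeriv (Q₂ j) (Q₃ j)
  decay₀ : ∀ j, IsExpDecaying (n j) β (Q₀ j)
  decay₁ : ∀ j, IsExpDecaying (n j) β (Q₁ j)
  decay₂ : ∀ j, IsExpDecaying (n j) β (Q₂ j)
  bound₃ : ∀ j, ∀ᵐ x, ‖Q₃ j x‖ ≤ n j * Real.exp (-(β * |x|))

/-- The second derivative has a weak derivative, hence a continuous representative; integrating
downwards, the lower ones become pointwise differentiable. Continuity also upgrades the almost
everywhere bounds to all x, except for the third derivative. -/
theorem exists_classical_of_sobolevNorm_lt {β : ℝ} (hβ : 0 < β) {g : ℝ → ℂ} {n : ℝ} (hn : 0 ≤ n)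
    (h : sobolevNorm 3 β g < ENNReal.ofReal n) :
    ∃ Q₀ Q₁ Q₂ Q₃ : ℝ → ℂ, g =ᵐ[volume] Q₀ ∧ (∀ x, HasDerivAt Q₀ (Q₁ x) x) ∧
      (∀ x, HasDerivAt Q₁ (Q₂ x) x) ∧ HasWeakDeriv Q₂ Q₃ ∧ IsExpDecaying n β Q₀ ∧
      IsExpDecaying n β Q₁ ∧ IsExpDecaying n β Q₂ ∧
      ∀ᵐ x, ‖Q₃ x‖ ≤ n * Real.exp (-(β * |x|)) := by
  obtain ⟨d, h⟩ := iInf_lt_iff.1 h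
  obtain ⟨hd, h⟩ := iInf_lt_iff.1 h
  have hb : ∀ l ∈ Finset.range 4, ∀ᵐ x, ‖d l x‖ ≤ n * Real.exp (-(β * |x|)) := fun l hl =>
    ae_norm_le_of_expNorm_le ((Finset.single_le_sum (f := fun l => expNorm β (d l))
      (fun _ _ => zero_le) hl).trans h.le) hn
  have upgrade : ∀ {f F : ℝ → ℂ}, f =ᵐ[volume] F → Continuous F →
      (∀ᵐ x, ‖f x‖ ≤ n * Real.exp (-(β * |x|))) → IsExpDecaying n β F := by
    intro f F hfF hF hf
    refine ⟨hβ, hF, le_of_ae_le_of_continuous hF.norm (by fun_prop) ?_⟩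
    filter_upwards [hfF, hf] with x h1 h2
    rwa [← h1]
  have w0 := hd.succ 0 (by norm_num)
  have w1 := hd.succ 1 (by norm_num)
  have w2 := hd.succ 2 (by norm_num)
  obtain ⟨Q₂, e2, c2⟩ := w2.exists_continuous
  obtain ⟨Q₁, e1, d1⟩ := w1.exists_hasDerivAt e2 c2
  have c1 : Continuous Q₁ := continuous_iff_continuousAt.2 fun x => (d1 x).continuousAt
  obtain ⟨Q₀, e0, d0⟩ := w0.exists_hasDerivAt e1 c1
  have c0 : Continuous Q₀ := continuous_iff_continuousAt.2 fun x => (d0 x).continuousAt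
  exact ⟨Q₀, Q₁, Q₂, d 3, hd.zero ▸ e0, d0, d1, w2.congr e2 (Filter.EventuallyEq.refl _ _),
    upgrade e0 c0 (hb 0 (by simp)), upgrade e1 c1 (hb 1 (by simp)), upgrade e2 c2 (hb 2 (by simp)),
    hb 3 (by simp)⟩

theorem exists_smoothProfile {lam : Idx → ℝ} {q : Idx → ℝ → ℂ} {θ β : ℝ}
    (hθ : 0 < θ) (hβ : 0 < β) (hgap : ∀ j l : Idx, j ≠ l → θ ≤ |lam j - lam l|)
    (hlam : ∀ j : Idx, θ ≤ |lam j|) (hnorm : ∑' j : Idx, sobolevNorm 3 β (q j) < ⊤) :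
    ∃ (Q₀ Q₁ Q₂ Q₃ : Idx → ℝ → ℂ) (n : Idx → ℝ), SmoothProfile θ β lam Q₀ Q₁ Q₂ Q₃ n ∧
      ∀ j, q j =ᵐ[volume] Q₀ j := by
  -- `sobolevNorm` is an infimum. A summable positive excess gives strict inequalities, hence
  -- admissible derivative families, and keeps the bounds summable.
  obtain ⟨δ, hδ0, hδ⟩ := ENNReal.exists_pos_sum_of_countable (ε := 1) one_ne_zero Idx
  have hfin : ∀ j, sobolevNorm 3 β (q j) ≠ ⊤ := fun j => ENNReal.ne_top_of_tsum_ne_top hnorm.ne j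
  set n : Idx → ℝ := fun j => (sobolevNorm 3 β (q j) + δ j).toReal with hn
  have hsum : ∑' j, (sobolevNorm 3 β (q j) + δ j) ≠ ⊤ := by
    rw [ENNReal.tsum_add]
    exact ENNReal.add_ne_top.2 ⟨hnorm.ne, (hδ.trans ENNReal.one_lt_top).ne⟩
  have hlt : ∀ j, sobolevNorm 3 β (q j) < ENNReal.ofReal (n j) := fun j => by
    rw [hn, ENNReal.ofReal_toReal (ENNReal.add_ne_top.2 ⟨hfin j, ENNReal.coe_ne_top⟩)]
    exact ENNReal.lt_add_right (hfin j) (by exact_mod_cast (hδ0 j).ne')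
  choose Q₀ Q₁ Q₂ Q₃ h0 h1 h2 h3 h4 h5 h6 h7 using fun j =>
    exists_classical_of_sobolevNorm_lt hβ (ENNReal.toReal_nonneg) (hlt j)
  exact ⟨Q₀, Q₁, Q₂, Q₃, n, ⟨hθ, hβ, hgap, hlam, ENNReal.summable_toReal hsum, h1, h2, h3, h4, h5,
    h6, h7⟩, h0⟩

/-! ### Algebra of exponentially decaying functions. -/

namespace IsExpDecaying

variable {N M β : ℝ} {f g : ℝ → ℂ}

theorem bound_const (hf : IsExpDecaying N β f) (x : ℝ) : ‖f x‖ ≤ N :=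
  (hf.bound x).trans (mul_le_of_le_one_right hf.nonneg (Real.exp_le_one_iff.2
    (neg_nonpos.2 (mul_nonneg hf.rate_pos.le (abs_nonneg x)))))

theorem mono (hf : IsExpDecaying N β f) (h : N ≤ M) : IsExpDecaying M β f :=
  ⟨hf.rate_pos, hf.continuous, fun x => (hf.bound x).trans
    (mul_le_mul_of_nonneg_right h (Real.exp_nonneg _))⟩

theorem mul_bounded (hf : IsExpDecaying N β f) (hg : Continuous g) (hb : ∀ x, ‖g x‖ ≤ M) :
    IsExpDecaying (M * N) β (fun x => g x * f x) :=
  ⟨hf.rate_pos, hg.mul hf.continuous, fun x => by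
    rw [norm_mul, mul_assoc]
    exact mul_le_mul (hb x) (hf.bound x) (norm_nonneg _) ((norm_nonneg _).trans (hb x))⟩

theorem mul (hf : IsExpDecaying N β f) (hg : IsExpDecaying M β g) :
    IsExpDecaying (N * M) β (fun x => f x * g x) :=
  hg.mul_bounded hf.continuous hf.bound_const

theorem const_mul (hf : IsExpDecaying N β f) (c : ℂ) :
    IsExpDecaying (‖c‖ * N) β (fun x => c * f x) :=
  hf.mul_bounded continuous_const fun _ => le_rfl

theorem add (hf : IsExpDecaying N β f) (hg : IsExpDecaying M β g) :
    IsExpDecaying (N + M) β (fun x => f x + g x) :=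
  ⟨hf.rate_pos, hf.continuous.add hg.continuous, fun x => by
    rw [add_mul]; exact (norm_add_le _ _).trans (add_le_add (hf.bound x) (hg.bound x))⟩

theorem sub (hf : IsExpDecaying N β f) (hg : IsExpDecaying M β g) :
    IsExpDecaying (N + M) β (fun x => f x - g x) :=
  ⟨hf.rate_pos, hf.continuous.sub hg.continuous, fun x => by
    rw [add_mul]; exact (norm_sub_le _ _).trans (add_le_add (hf.bound x) (hg.bound x))⟩

theorem conj (hf : IsExpDecaying N β f) : IsExpDecaying N β (fun x => starRingEnd ℂ (f x)) :=
  ⟨hf.rate_pos, Complex.continuous_conj.comp hf.continuous, fun x => by simpa using hf.bound x⟩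

theorem integrable (hf : IsExpDecaying N β f) : Integrable f :=
  integrable_of_exp_abs_bound hf.rate_pos hf.continuous.aestronglyMeasurable
    (Eventually.of_forall hf.bound)

theorem norm_integral_le (hf : IsExpDecaying N β f) : ‖∫ x, f x‖ ≤ N * (2 / β) :=
  norm_integral_le_of_exp_abs_bound hf.rate_pos (Eventually.of_forall hf.bound)

theorem integral_norm_le (hf : IsExpDecaying N β f) : ∫ x, ‖f x‖ ≤ N * (2 / β) := by
  rw [← integral_exp_neg_mul_abs hf.rate_pos, ← integral_const_mul]
  exact integral_mono hf.integrable.norm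
    ((integrable_exp_neg_mul_abs hf.rate_pos).const_mul N) hf.bound

end IsExpDecaying

/-! ### Two-scale sums -/

/-- The oscillating phase `e^{2πiλ_j x/ε}`. -/
noncomputable def phase (lam : Idx → ℝ) (ε : ℝ) (j : Idx) (x : ℝ) : ℂ :=
  Complex.exp (2 * Real.pi * Complex.I * lam j * ((x / ε : ℝ) : ℂ))

/-- `∑_j F_j(x) e^{2πiλ_j x/ε}`. -/
noncomputable def oscSum (lam : Idx → ℝ) (ε : ℝ) (F : Idx → ℝ → ℂ) (x : ℝ) : ℂ :=
  ∑' j, F j x * phase lam ε j x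

/-- The multiplier `2πiλ_j` of `∂_y`. -/
noncomputable def freq (lam : Idx → ℝ) (j : Idx) : ℂ := 2 * Real.pi * Complex.I * lam j

section OscSum

variable {lam : Idx → ℝ} {ε β : ℝ} {F F' : Idx → ℝ → ℂ} {c c' : Idx → ℝ}

theorem phase_eq (lam : Idx → ℝ) (ε : ℝ) (j : Idx) (x : ℝ) :
    phase lam ε j x = Complex.exp (Complex.I * ((2 * Real.pi * lam j / ε : ℝ) : ℂ) * x) := by
  rw [phase]; congr 1; push_cast; ring

theorem norm_phase (lam : Idx → ℝ) (ε : ℝ) (j : Idx) (x : ℝ) : ‖phase lam ε j x‖ = 1 := by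
  rw [phase_eq, Complex.norm_exp]; simp

theorem continuous_phase (lam : Idx → ℝ) (ε : ℝ) (j : Idx) : Continuous (phase lam ε j) := by
  rw [funext (phase_eq lam ε j)]; fun_prop

theorem hasDerivAt_phase (lam : Idx → ℝ) (ε : ℝ) (j : Idx) (x : ℝ) :
    HasDerivAt (phase lam ε j) (freq lam j / ε * phase lam ε j x) x := by
  have h : HasDerivAt (fun z : ℝ => Complex.exp (Complex.I * ((2 * Real.pi * lam j / ε : ℝ) : ℂ) * z))
      (Complex.exp (Complex.I * ((2 * Real.pi * lam j / ε : ℝ) : ℂ) * x) *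
        (Complex.I * ((2 * Real.pi * lam j / ε : ℝ) : ℂ) * 1)) x :=
    (((hasDerivAt_id (x : ℂ)).const_mul _).cexp).comp_ofReal
  rw [← funext (phase_eq lam ε j), ← phase_eq] at h
  refine h.congr_deriv ?_
  rw [freq]; push_cast; ring

theorem isExpDecaying_mul_phase {f : ℝ → ℂ} {N : ℝ} (hf : IsExpDecaying N β f) (j : Idx) :
    IsExpDecaying N β (fun x => f x * phase lam ε j x) := by
  have := hf.mul_bounded (continuous_phase lam ε j) fun x => (norm_phase lam ε j x).le
  simpa only [mul_comm (phase lam ε j _)] using this.mono (one_mul N).le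

theorem hasSum_oscSum (hF : ∀ j, IsExpDecaying (c j) β (F j)) (hc : Summable c) (x : ℝ) :
    HasSum (fun j => F j x * phase lam ε j x) (oscSum lam ε F x) :=
  (Summable.of_norm_bounded hc fun j =>
    (isExpDecaying_mul_phase (hF j) j).bound_const x).hasSum

theorem isExpDecaying_oscSum (hβ : 0 < β) (hF : ∀ j, IsExpDecaying (c j) β (F j))
    (hc : Summable c) : IsExpDecaying (∑' j, c j) β (oscSum lam ε F) := by
  refine ⟨hβ, continuous_tsum (fun j => (isExpDecaying_mul_phase (hF j) j).continuous) hc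
    fun j x => (isExpDecaying_mul_phase (hF j) j).bound_const x, fun x => ?_⟩
  exact tsum_of_norm_bounded (hc.hasSum.mul_right _)
    fun j => (isExpDecaying_mul_phase (hF j) j).bound x

/-- Bounds are required of the whole combination F' + (2πiλ_j/ε)F because the multipliers 2πiλ_j are
unbounded in j. -/
theorem hasDerivAt_oscSum (hF : ∀ j, IsExpDecaying (c j) β (F j)) (hc : Summable c)
    (hd : ∀ j x, HasDerivAt (F j) (F' j x) x)
    (hF' : ∀ j, IsExpDecaying (c' j) β (fun x => F' j x + freq lam j / ε * F j x))
    (hc' : Summable c') (x : ℝ) :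
    HasDerivAt (oscSum lam ε F) (oscSum lam ε (fun j x => F' j x + freq lam j / ε * F j x) x) x := by
  refine hasDerivAt_tsum hc' (fun j y => ?_)
    (fun j y => (isExpDecaying_mul_phase (hF' j) j).bound_const y)
    (hasSum_oscSum (ε := ε) (lam := lam) hF hc 0).summable x
  refine ((hd j y).mul (hasDerivAt_phase lam ε j y)).congr_deriv ?_
  ring

theorem hasSum_integral_mul_oscSum (hF : ∀ j, IsExpDecaying (c j) β (F j)) (hc : Summable c)
    {g : ℝ → ℂ} {B : ℝ} (hg : Continuous g) (hB : ∀ x, ‖g x‖ ≤ B) :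
    HasSum (fun j => ∫ x, g x * (F j x * phase lam ε j x)) (∫ x, g x * oscSum lam ε F x) := by
  have h : ∀ j, IsExpDecaying (B * c j) β (fun x => g x * (F j x * phase lam ε j x)) := fun j =>
    (isExpDecaying_mul_phase (hF j) j).mul_bounded hg hB
  have := hasSum_integral_of_summable_integral_norm (fun j => (h j).integrable)
    (Summable.of_nonneg_of_le (fun j => integral_nonneg fun x => norm_nonneg _)
      (fun j => (h j).integral_norm_le) ((hc.mul_left B).mul_right _))
  simpa only [tsum_mul_left, oscSum] using this

end OscSum

/-- The lower bound `2πθ` for the frequencies. -/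
theorem norm_freq (lam : Idx → ℝ) (j : Idx) : ‖freq lam j‖ = 2 * Real.pi * |lam j| := by
  simp [freq, abs_of_pos Real.pi_pos]

theorem freq_sq (lam : Idx → ℝ) (j : Idx) :
    freq lam j ^ 2 = -(((2 * Real.pi) ^ 2 * lam j ^ 2 : ℝ) : ℂ) := by
  rw [freq]; push_cast
  linear_combination (2 * Real.pi * lam j : ℂ) ^ 2 * Complex.I_sq

namespace SmoothProfile

variable {θ β : ℝ} {lam : Idx → ℝ} {Q₀ Q₁ Q₂ Q₃ : Idx → ℝ → ℂ} {n : Idx → ℝ} {ε : ℝ}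

/-- The profile of the potential's first antiderivative `S`. -/
noncomputable def profS (lam : Idx → ℝ) (Q₀ Q₁ : Idx → ℝ → ℂ) (ε : ℝ) (j : Idx) (x : ℝ) : ℂ :=
  ε / freq lam j * Q₀ j x - ε ^ 2 / freq lam j ^ 2 * Q₁ j x

/-- The profile `c ε² (2πiλ_j)⁻² Q_j`. -/
noncomputable def prof₂ (c : ℂ) (lam : Idx → ℝ) (Q : Idx → ℝ → ℂ) (ε : ℝ) (j : Idx) (x : ℝ) : ℂ :=
  c * (ε ^ 2 / freq lam j ^ 2) * Q j x

theorem freq_pos (h : SmoothProfile θ β lam Q₀ Q₁ Q₂ Q₃ n) : 0 < 2 * Real.pi * θ := by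
  have := h.θ_pos; positivity

theorem le_norm_freq (h : SmoothProfile θ β lam Q₀ Q₁ Q₂ Q₃ n) (j : Idx) :
    2 * Real.pi * θ ≤ ‖freq lam j‖ := by
  rw [norm_freq]
  have := h.lam_ge j
  gcongr

theorem freq_ne_zero (h : SmoothProfile θ β lam Q₀ Q₁ Q₂ Q₃ n) (j : Idx) : freq lam j ≠ 0 :=
  norm_pos_iff.1 (h.freq_pos.trans_le (h.le_norm_freq j))

theorem norm_div_freq_le (h : SmoothProfile θ β lam Q₀ Q₁ Q₂ Q₃ n) (hε : 0 < ε) (j : Idx) :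
    ‖(ε / freq lam j : ℂ)‖ ≤ ε / (2 * Real.pi * θ) := by
  rw [norm_div, Complex.norm_real, Real.norm_of_nonneg hε.le]
  exact div_le_div_of_nonneg_left hε.le h.freq_pos (h.le_norm_freq j)

theorem norm_div_freq_sq_le (h : SmoothProfile θ β lam Q₀ Q₁ Q₂ Q₃ n) (hε : 0 < ε) (j : Idx) :
    ‖(ε ^ 2 / freq lam j ^ 2 : ℂ)‖ ≤ (ε / (2 * Real.pi * θ)) ^ 2 := by
  rw [← div_pow, norm_pow]
  exact pow_le_pow_left₀ (norm_nonneg _) (h.norm_div_freq_le hε j) 2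

theorem decay_prof₂ (h : SmoothProfile θ β lam Q₀ Q₁ Q₂ Q₃ n) (hε : 0 < ε) {Q : Idx → ℝ → ℂ}
    (hQ : ∀ j, IsExpDecaying (n j) β (Q j)) (c : ℂ) (j : Idx) :
    IsExpDecaying (‖c‖ * (ε / (2 * Real.pi * θ)) ^ 2 * n j) β (prof₂ c lam Q ε j) := by
  refine ((hQ j).const_mul _).mono (mul_le_mul_of_nonneg_right ?_ (hQ j).nonneg)
  rw [norm_mul]
  exact mul_le_mul_of_nonneg_left (h.norm_div_freq_sq_le hε j) (norm_nonneg _)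

theorem decay_profS (h : SmoothProfile θ β lam Q₀ Q₁ Q₂ Q₃ n) (hε : 0 < ε) (j : Idx) :
    IsExpDecaying ((ε / (2 * Real.pi * θ) + (ε / (2 * Real.pi * θ)) ^ 2) * n j) β
      (profS lam Q₀ Q₁ ε j) := by
  refine (((h.decay₀ j).const_mul _).sub ((h.decay₁ j).const_mul _)).mono ?_
  rw [add_mul]
  exact add_le_add (mul_le_mul_of_nonneg_right (h.norm_div_freq_le hε j) (h.decay₀ j).nonneg)
    (mul_le_mul_of_nonneg_right (h.norm_div_freq_sq_le hε j) (h.decay₀ j).nonneg)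

theorem decay_oscSum_prof₂ (h : SmoothProfile θ β lam Q₀ Q₁ Q₂ Q₃ n) (hε : 0 < ε)
    {Q : Idx → ℝ → ℂ} (hQ : ∀ j, IsExpDecaying (n j) β (Q j)) (c : ℂ) :
    IsExpDecaying (‖c‖ * (ε / (2 * Real.pi * θ)) ^ 2 * ∑' j, n j) β
      (oscSum lam ε (prof₂ c lam Q ε)) := by
  rw [← tsum_mul_left]
  exact isExpDecaying_oscSum h.rate_pos (h.decay_prof₂ hε hQ c) (h.summable.mul_left _)

theorem decay_oscSum_profS (h : SmoothProfile θ β lam Q₀ Q₁ Q₂ Q₃ n) (hε : 0 < ε) :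
    IsExpDecaying ((ε / (2 * Real.pi * θ) + (ε / (2 * Real.pi * θ)) ^ 2) * ∑' j, n j) β
      (oscSum lam ε (profS lam Q₀ Q₁ ε)) := by
  rw [← tsum_mul_left]
  exact isExpDecaying_oscSum h.rate_pos (h.decay_profS hε) (h.summable.mul_left _)

theorem decay_potential (h : SmoothProfile θ β lam Q₀ Q₁ Q₂ Q₃ n) (ε : ℝ) :
    IsExpDecaying (∑' j, n j) β (oscSum lam ε Q₀) :=
  isExpDecaying_oscSum h.rate_pos h.decay₀ h.summable

/-- The second term of `profS` cancels the term in εQ₁ produced by the first, so that the remainder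
is O(ε²) and not O(ε). -/
theorem hasDerivAt_S (h : SmoothProfile θ β lam Q₀ Q₁ Q₂ Q₃ n) (hε : 0 < ε) (x : ℝ) :
    HasDerivAt (oscSum lam ε (profS lam Q₀ Q₁ ε))
      (oscSum lam ε Q₀ x - oscSum lam ε (prof₂ 1 lam Q₂ ε) x) x := by
  have hε0 : (ε : ℂ) ≠ 0 := by exact_mod_cast hε.ne'
  have e : ∀ j x, ε / freq lam j * Q₁ j x - ε ^ 2 / freq lam j ^ 2 * Q₂ j x +
      freq lam j / ε * profS lam Q₀ Q₁ ε j x = Q₀ j x - prof₂ 1 lam Q₂ ε j x := fun j x => by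
    have := h.freq_ne_zero j
    rw [profS, prof₂]
    field_simp
    ring
  have hs := (h.summable.mul_left (‖(1 : ℂ)‖ * (ε / (2 * Real.pi * θ)) ^ 2))
  have := hasDerivAt_oscSum (lam := lam) (ε := ε) (β := β) (F := profS lam Q₀ Q₁ ε)
    (F' := fun j x => ε / freq lam j * Q₁ j x - ε ^ 2 / freq lam j ^ 2 * Q₂ j x)
    (c' := fun j => n j + ‖(1 : ℂ)‖ * (ε / (2 * Real.pi * θ)) ^ 2 * n j)
    (h.decay_profS hε) (h.summable.mul_left _)
    (fun j x => ((h.deriv₀ j x).const_mul _).sub ((h.deriv₁ j x).const_mul _))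
    (fun j => by
      simp only [e]
      exact (h.decay₀ j).sub (h.decay_prof₂ hε h.decay₂ 1 j))
    (h.summable.add hs) x
  refine this.congr_deriv ?_
  simp only [e]
  refine HasSum.tsum_eq ?_
  simp only [sub_mul]
  exact (hasSum_oscSum h.decay₀ h.summable x).sub
    (hasSum_oscSum (h.decay_prof₂ hε h.decay₂ 1) hs x)

/-- The factor -2 collects two equal terms in Q₁: one from differentiating Q₀, one from the second
term of `profS`. -/
theorem hasDerivAt_P (h : SmoothProfile θ β lam Q₀ Q₁ Q₂ Q₃ n) (hε : 0 < ε) (x : ℝ) :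
    HasDerivAt (oscSum lam ε (prof₂ 1 lam Q₀ ε))
      (oscSum lam ε (profS lam Q₀ Q₁ ε) x - oscSum lam ε (prof₂ (-2) lam Q₁ ε) x) x := by
  have hε0 : (ε : ℂ) ≠ 0 := by exact_mod_cast hε.ne'
  have e : ∀ j x, 1 * (ε ^ 2 / freq lam j ^ 2) * Q₁ j x +
      freq lam j / ε * prof₂ 1 lam Q₀ ε j x =
        profS lam Q₀ Q₁ ε j x - prof₂ (-2) lam Q₁ ε j x := fun j x => by
    have := h.freq_ne_zero j
    rw [profS, prof₂, prof₂]
    field_simp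
    ring
  have hs := (h.summable.mul_left (‖(-2 : ℂ)‖ * (ε / (2 * Real.pi * θ)) ^ 2))
  have hs' := (h.summable.mul_left (ε / (2 * Real.pi * θ) + (ε / (2 * Real.pi * θ)) ^ 2))
  have := hasDerivAt_oscSum (lam := lam) (ε := ε) (β := β) (F := prof₂ 1 lam Q₀ ε)
    (F' := fun j x => 1 * (ε ^ 2 / freq lam j ^ 2) * Q₁ j x)
    (c' := fun j => (ε / (2 * Real.pi * θ) + (ε / (2 * Real.pi * θ)) ^ 2) * n j +
      ‖(-2 : ℂ)‖ * (ε / (2 * Real.pi * θ)) ^ 2 * n j)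
    (h.decay_prof₂ hε h.decay₀ 1) (h.summable.mul_left _)
    (fun j x => (h.deriv₀ j x).const_mul _)
    (fun j => by
      simp only [e]
      exact (h.decay_profS hε j).sub (h.decay_prof₂ hε h.decay₁ (-2) j))
    (hs'.add hs) x
  refine this.congr_deriv ?_
  simp only [e]
  refine HasSum.tsum_eq ?_
  simp only [sub_mul]
  exact (hasSum_oscSum (h.decay_profS hε) hs' x).sub
    (hasSum_oscSum (h.decay_prof₂ hε h.decay₁ (-2)) hs x)

/-- The size of the corrector in units of `ε²`. -/
noncomputable def size (θ : ℝ) (n : Idx → ℝ) : ℝ :=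
  2 * (1 / (2 * Real.pi * θ)) ^ 2 * (∑' j, n j) +
    ((1 / (2 * Real.pi * θ) + (1 / (2 * Real.pi * θ)) ^ 2) * ∑' j, n j) ^ 2

theorem corrector (h : SmoothProfile θ β lam Q₀ Q₁ Q₂ Q₃ n) (hε : 0 < ε) (hε1 : ε ≤ 1) {D : ℝ}
    (hD : size θ n ≤ D) :
    Corrector β (D * ε ^ 2) (oscSum lam ε Q₀) (oscSum lam ε (prof₂ 1 lam Q₀ ε))
      (oscSum lam ε (prof₂ (-2) lam Q₁ ε)) (oscSum lam ε (profS lam Q₀ Q₁ ε))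
      (oscSum lam ε (prof₂ 1 lam Q₂ ε)) := by
  have hα := h.freq_pos
  have hN : 0 ≤ ∑' j, n j := tsum_nonneg fun j => (h.decay₀ j).nonneg
  set α := 2 * Real.pi * θ with hαdef
  set N := ∑' j, n j with hNdef
  have hD' : 2 * (1 / α) ^ 2 * N + ((1 / α + (1 / α) ^ 2) * N) ^ 2 ≤ D := hD
  have h1 : 0 ≤ (1 / α) ^ 2 * N := by positivity
  have key : ∀ c : ℂ, ‖c‖ ≤ 2 → ‖c‖ * (ε / α) ^ 2 * N ≤ D * ε ^ 2 := fun c hc => by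
    calc ‖c‖ * (ε / α) ^ 2 * N = ‖c‖ * ((1 / α) ^ 2 * N) * ε ^ 2 := by ring
      _ ≤ D * ε ^ 2 := by
        refine mul_le_mul_of_nonneg_right ?_ (sq_nonneg ε)
        have := mul_le_mul_of_nonneg_right hc h1
        have := sq_nonneg ((1 / α + (1 / α) ^ 2) * N)
        linarith
  have hP := (h.decay_oscSum_prof₂ hε h.decay₀ 1).mono (key 1 (by simp))
  have hT := (h.decay_oscSum_prof₂ hε h.decay₁ (-2)).mono (key (-2) (by simp))
  have hR := (h.decay_oscSum_prof₂ hε h.decay₂ 1).mono (key 1 (by simp))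
  have hS := h.decay_oscSum_profS hε
  refine ⟨h.rate_pos, hT.continuous, hR.continuous, h.hasDerivAt_S hε, h.hasDerivAt_P hε, hP.bound,
    hT.bound, hR.bound, fun x => ?_⟩
  have hSS := (hS.mul hS).bound x
  rw [norm_mul, ← pow_two] at hSS
  refine hSS.trans (mul_le_mul_of_nonneg_right ?_ (Real.exp_nonneg _))
  rw [← pow_two]
  have h2 : ε / α + (ε / α) ^ 2 ≤ (1 / α + (1 / α) ^ 2) * ε := by
    have : ε ^ 2 ≤ ε := by nlinarith
    calc ε / α + (ε / α) ^ 2 = 1 / α * ε + (1 / α) ^ 2 * ε ^ 2 := by ring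
      _ ≤ 1 / α * ε + (1 / α) ^ 2 * ε := by gcongr
      _ = _ := by ring
  calc ((ε / α + (ε / α) ^ 2) * N) ^ 2 ≤ ((1 / α + (1 / α) ^ 2) * ε * N) ^ 2 := by gcongr
    _ = ((1 / α + (1 / α) ^ 2) * N) ^ 2 * ε ^ 2 := by ring
    _ ≤ D * ε ^ 2 := by
      refine mul_le_mul_of_nonneg_right ?_ (sq_nonneg ε)
      linarith

end SmoothProfile

/-! ### Homogenization of ∫(R - S²) by non-stationary phase. -/

namespace SmoothProfile

variable {θ β : ℝ} {lam : Idx → ℝ} {Q₀ Q₁ Q₂ Q₃ : Idx → ℝ → ℂ} {n : Idx → ℝ} {ε : ℝ}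

theorem one_div_abs_le (h : SmoothProfile θ β lam Q₀ Q₁ Q₂ Q₃ n) (hε : 0 < ε) {μ : ℝ}
    (hμ : θ ≤ |μ|) : 2 * Real.pi * μ / ε ≠ 0 ∧
      1 / |2 * Real.pi * μ / ε| ≤ ε / (2 * Real.pi * θ) := by
  have hθ := h.θ_pos
  have hμ0 : 0 < |μ| := hθ.trans_le hμ
  have e : |2 * Real.pi * μ / ε| = 2 * Real.pi * |μ| / ε := by
    rw [abs_div, abs_mul, abs_of_pos hε, abs_of_pos Real.two_pi_pos]
  refine ⟨abs_pos.1 (by rw [e]; positivity), ?_⟩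
  rw [e, one_div_div]
  gcongr

/-- The profile carries ε² already; one more integration by parts gains another ε. This is where the
third weak derivatives enter. -/
theorem norm_integral_prof₂_le (h : SmoothProfile θ β lam Q₀ Q₁ Q₂ Q₃ n) (hε : 0 < ε) :
    ‖∫ x, oscSum lam ε (prof₂ 1 lam Q₂ ε) x‖ ≤
      (ε / (2 * Real.pi * θ)) ^ 3 * (2 / β) * ∑' j, n j := by
  have hs := hasSum_integral_mul_oscSum (lam := lam) (ε := ε) (h.decay_prof₂ hε h.decay₂ 1)
    (h.summable.mul_left _) (g := fun _ => 1) (B := 1) continuous_const (by simp)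
  simp only [one_mul] at hs
  rw [← tsum_mul_left]
  refine hs.norm_le_of_bounded ((h.summable.mul_left _).hasSum) fun j => ?_
  have hβ := h.rate_pos
  obtain ⟨hω, hω'⟩ := h.one_div_abs_le hε (h.lam_ge j)
  have h1 := (h.weak j).norm_integral_exp_le hβ (Eventually.of_forall (h.decay₂ j).bound)
    (h.bound₃ j) hω
  have e : ∫ x, prof₂ 1 lam Q₂ ε j x * phase lam ε j x = ε ^ 2 / freq lam j ^ 2 *
      ∫ x : ℝ, Q₂ j x * Complex.exp (Complex.I * ((2 * Real.pi * lam j / ε : ℝ) : ℂ) * x) := by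
    rw [← integral_const_mul]
    congr 1 with x
    rw [prof₂, phase_eq]; ring
  have hn := (h.decay₀ j).nonneg
  have hα := h.freq_pos
  rw [e, norm_mul]
  calc _ ≤ (ε / (2 * Real.pi * θ)) ^ 2 * (ε / (2 * Real.pi * θ) * (n j * (2 / β))) := by
        gcongr
        · exact h.norm_div_freq_sq_le hε j
        · exact h1.trans (mul_le_mul_of_nonneg_right hω' (by positivity))
    _ = _ := by ring

/-- The correlation of two profiles oscillating at different frequencies is small. -/
theorem norm_integral_correlation_le (h : SmoothProfile θ β lam Q₀ Q₁ Q₂ Q₃ n) (hε : 0 < ε)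
    {j l : Idx} (hjl : j ≠ l) :
    ‖∫ x, starRingEnd ℂ (Q₀ l x * phase lam ε l x) * (Q₀ j x * phase lam ε j x)‖ ≤
      ε / (2 * Real.pi * θ) * (4 / β) * n l * n j := by
  have hβ := h.rate_pos
  have hl := (h.decay₀ l).nonneg
  have hj := (h.decay₀ j).nonneg
  obtain ⟨hω, hω'⟩ := h.one_div_abs_le hε (h.gap j l hjl)
  have hf := (h.decay₀ l).conj.mul (h.decay₀ j)
  have hf' := ((h.decay₁ l).conj.mul (h.decay₀ j)).add ((h.decay₀ l).conj.mul (h.decay₁ j))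
  have hd : ∀ x, HasDerivAt (fun x => starRingEnd ℂ (Q₀ l x) * Q₀ j x)
      (starRingEnd ℂ (Q₁ l x) * Q₀ j x + starRingEnd ℂ (Q₀ l x) * Q₁ j x) x := fun x =>
    (h.deriv₀ l x).star.mul (h.deriv₀ j x)
  have h1 := (hasWeakDeriv_of_hasDerivAt hd hf'.continuous).norm_integral_exp_le hβ
    (Eventually.of_forall (hf.mono (by linarith [mul_nonneg hl hj] :
      n l * n j ≤ n l * n j + n l * n j)).bound) (Eventually.of_forall hf'.bound) hω
  have e : ∀ x, starRingEnd ℂ (Q₀ l x * phase lam ε l x) * (Q₀ j x * phase lam ε j x) =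
      starRingEnd ℂ (Q₀ l x) * Q₀ j x *
        Complex.exp (Complex.I * ((2 * Real.pi * (lam j - lam l) / ε : ℝ) : ℂ) * x) := fun x => by
    rw [phase_eq, phase_eq, map_mul, ← Complex.exp_conj]
    have : Complex.exp (Complex.I * ((2 * Real.pi * (lam j - lam l) / ε : ℝ) : ℂ) * x) =
        Complex.exp (starRingEnd ℂ (Complex.I * ((2 * Real.pi * lam l / ε : ℝ) : ℂ) * x)) *
          Complex.exp (Complex.I * ((2 * Real.pi * lam j / ε : ℝ) : ℂ) * x) := by
      rw [← Complex.exp_add]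
      congr 1
      rw [map_mul, map_mul, Complex.conj_I, Complex.conj_ofReal, Complex.conj_ofReal]
      push_cast; ring
    rw [this]; ring
  simp only [e]
  refine h1.trans ((mul_le_mul_of_nonneg_right hω' (by positivity)).trans_eq ?_)
  ring

/-- Because V is real it may be replaced by its conjugate, so mode l of the second factor is paired
with conjugated modes of V. Only j = l does not oscillate; the frequency gap makes all others O(ε).
No relation between the labels of conjugate frequencies is needed. -/
theorem norm_integral_potential_mul_le (h : SmoothProfile θ β lam Q₀ Q₁ Q₂ Q₃ n) (hε : 0 < ε)
    (hreal : ∀ x, starRingEnd ℂ (oscSum lam ε Q₀ x) = oscSum lam ε Q₀ x) (l : Idx) :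
    ‖(∫ x, oscSum lam ε Q₀ x * (Q₀ l x * phase lam ε l x)) - ((∫ x, ‖Q₀ l x‖ ^ 2 : ℝ) : ℂ)‖ ≤
      ε / (2 * Real.pi * θ) * (4 / β) * n l * ∑' j, n j := by
  have hβ := h.rate_pos
  have hα := h.freq_pos
  have hl := (h.decay₀ l).nonneg
  have hg := (isExpDecaying_mul_phase (lam := lam) (ε := ε) (h.decay₀ l) l).conj
  have hs := hasSum_integral_mul_oscSum (lam := lam) (ε := ε) h.decay₀ h.summable hg.continuous
    hg.bound_const
  have hdiag : ∫ x, starRingEnd ℂ (Q₀ l x * phase lam ε l x) * (Q₀ l x * phase lam ε l x) =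
      ((∫ x, ‖Q₀ l x‖ ^ 2 : ℝ) : ℂ) := by
    rw [← integral_complex_ofReal]
    congr 1 with x
    rw [← Complex.normSq_eq_conj_mul_self, Complex.normSq_eq_norm_sq, norm_mul, norm_phase, mul_one]
  have hs2 := hs.sub (hasSum_ite_eq l ((∫ x, ‖Q₀ l x‖ ^ 2 : ℝ) : ℂ))
  have hb := hs2.norm_le_of_bounded (h.summable.mul_left
    (ε / (2 * Real.pi * θ) * (4 / β) * n l)).hasSum fun j => by
      by_cases hj : j = l
      · subst hj
        have := (h.decay₀ j).nonneg
        rw [hdiag, if_pos rfl, sub_self, norm_zero]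
        positivity
      · rw [if_neg hj, sub_zero]
        exact h.norm_integral_correlation_le hε hj
  rw [tsum_mul_left] at hb
  refine le_trans (le_of_eq ?_) hb
  rw [← Complex.norm_conj, map_sub, ← integral_conj, Complex.conj_ofReal]
  congr 3 with x
  rw [map_mul, hreal, mul_comm]

theorem integrable_sq (h : SmoothProfile θ β lam Q₀ Q₁ Q₂ Q₃ n) (j : Idx) :
    Integrable fun x => ‖Q₀ j x‖ ^ 2 := by
  have := ((h.decay₀ j).mul (h.decay₀ j)).integrable.norm
  simpa only [norm_mul, ← pow_two, norm_pow] using this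

theorem integral_sq_le (h : SmoothProfile θ β lam Q₀ Q₁ Q₂ Q₃ n) (j : Idx) :
    ∫ x, ‖Q₀ j x‖ ^ 2 ≤ n j * n j * (2 / β) := by
  have := ((h.decay₀ j).mul (h.decay₀ j)).integral_norm_le
  simpa only [norm_mul, ← pow_two, norm_pow] using this

theorem summable_sq (h : SmoothProfile θ β lam Q₀ Q₁ Q₂ Q₃ n) : Summable fun j => n j * n j := by
  refine Summable.of_nonneg_of_le (fun j => mul_self_nonneg _) (fun j => ?_)
    (h.summable.mul_left (∑' j, n j))
  exact mul_le_mul_of_nonneg_right (h.summable.le_tsum j fun i _ => (h.decay₀ i).nonneg)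
    (h.decay₀ j).nonneg

theorem one_div_lam_sq_le (h : SmoothProfile θ β lam Q₀ Q₁ Q₂ Q₃ n) (j : Idx) {a : ℝ}
    (ha : 0 ≤ a) : a / lam j ^ 2 ≤ a / θ ^ 2 := by
  have hθ := h.θ_pos
  refine div_le_div_of_nonneg_left ha (by positivity) ?_
  rw [← sq_abs (lam j)]
  exact pow_le_pow_left₀ hθ.le (h.lam_ge j) 2

theorem hasSum_integral_effPotential (h : SmoothProfile θ β lam Q₀ Q₁ Q₂ Q₃ n) :
    HasSum (fun j => 1 / (2 * Real.pi) ^ 2 * ((∫ x, ‖Q₀ j x‖ ^ 2) / lam j ^ 2))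
      (∫ x, effPotential lam Q₀ x) := by
  have hs := hasSum_integral_of_summable_integral_norm (μ := volume)
    (F := fun j x => ‖Q₀ j x‖ ^ 2 / lam j ^ 2) (fun j => (h.integrable_sq j).div_const _) ?_
  · have := hs.mul_left (1 / (2 * Real.pi) ^ 2)
    simp only [integral_div] at this
    simpa only [effPotential, integral_const_mul] using this
  · simp only [norm_div, norm_pow, Real.norm_eq_abs, sq_abs, integral_div]
    refine Summable.of_nonneg_of_le (fun j => div_nonneg (integral_nonneg fun x => by positivity)
      (sq_nonneg _)) (fun j => ?_) ((h.summable_sq.mul_right (2 / β)).div_const (θ ^ 2))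
    refine (h.one_div_lam_sq_le j (integral_nonneg fun x => by positivity)).trans ?_
    have := h.integral_sq_le j
    gcongr

/-- `∫ V P = -ε² ∫ Λ_eff + O(ε³)`. -/
theorem norm_integral_potential_mul_P_le (h : SmoothProfile θ β lam Q₀ Q₁ Q₂ Q₃ n) (hε : 0 < ε)
    (hreal : ∀ x, starRingEnd ℂ (oscSum lam ε Q₀ x) = oscSum lam ε Q₀ x) :
    ‖(∫ x, oscSum lam ε Q₀ x * oscSum lam ε (prof₂ 1 lam Q₀ ε) x) +
        ((ε ^ 2 * ∫ x, effPotential lam Q₀ x : ℝ) : ℂ)‖ ≤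
      (ε / (2 * Real.pi * θ)) ^ 3 * (4 / β) * (∑' j, n j) ^ 2 := by
  have hα := h.freq_pos
  have hβ := h.rate_pos
  have hV := h.decay_potential ε
  have hN := hV.nonneg
  have hs1 := hasSum_integral_mul_oscSum (lam := lam) (ε := ε) (h.decay_prof₂ hε h.decay₀ 1)
    (h.summable.mul_left _) hV.continuous hV.bound_const
  have hs2 : HasSum (fun j => ((ε ^ 2 * (1 / (2 * Real.pi) ^ 2 *
      ((∫ x, ‖Q₀ j x‖ ^ 2) / lam j ^ 2)) : ℝ) : ℂ))
      ((ε ^ 2 * ∫ x, effPotential lam Q₀ x : ℝ) : ℂ) :=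
    Complex.hasSum_ofReal.2 (h.hasSum_integral_effPotential.mul_left _)
  -- Since (2πiλ_l)² = -(2π)²λ_l², the diagonal term is exactly minus the l-th term of ε²∫Λ_eff.
  have e : ∀ l, (∫ x, oscSum lam ε Q₀ x * (prof₂ 1 lam Q₀ ε l x * phase lam ε l x)) +
      ((ε ^ 2 * (1 / (2 * Real.pi) ^ 2 * ((∫ x, ‖Q₀ l x‖ ^ 2) / lam l ^ 2)) : ℝ) : ℂ) =
      ε ^ 2 / freq lam l ^ 2 * ((∫ x, oscSum lam ε Q₀ x * (Q₀ l x * phase lam ε l x)) -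
        ((∫ x, ‖Q₀ l x‖ ^ 2 : ℝ) : ℂ)) := fun l => by
    have e1 : ∫ x, oscSum lam ε Q₀ x * (prof₂ 1 lam Q₀ ε l x * phase lam ε l x) =
        ε ^ 2 / freq lam l ^ 2 * ∫ x, oscSum lam ε Q₀ x * (Q₀ l x * phase lam ε l x) := by
      rw [← integral_const_mul]
      congr 1 with x
      rw [prof₂]; ring
    rw [e1, mul_sub, sub_eq_add_neg, freq_sq, add_right_inj]
    push_cast
    rw [div_neg, neg_mul, neg_neg]
    ring
  have hb := (hs1.add hs2).norm_le_of_bounded ((h.summable.mul_right (∑' j, n j)).mul_left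
    ((ε / (2 * Real.pi * θ)) ^ 3 * (4 / β))).hasSum fun l => by
      rw [e, norm_mul]
      have hl := (h.decay₀ l).nonneg
      calc _ ≤ (ε / (2 * Real.pi * θ)) ^ 2 *
            (ε / (2 * Real.pi * θ) * (4 / β) * n l * ∑' j, n j) := by
            gcongr
            · exact h.norm_div_freq_sq_le hε l
            · exact h.norm_integral_potential_mul_le hε hreal l
        _ = _ := by ring
  rwa [tsum_mul_left, tsum_mul_right, ← pow_two] at hb

/-- The constant in the homogenization estimate. -/
noncomputable def homConst (θ β : ℝ) (n : Idx → ℝ) : ℝ :=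
  (1 / (2 * Real.pi * θ)) ^ 3 * (2 / β) * (∑' j, n j) +
    (1 / (2 * Real.pi * θ)) ^ 3 * (4 / β) * (∑' j, n j) ^ 2 +
    ((1 / (2 * Real.pi * θ)) ^ 2 * ∑' j, n j) ^ 2 * (2 / β) +
    2 * (1 / (2 * Real.pi * θ) + (1 / (2 * Real.pi * θ)) ^ 2) * (1 / (2 * Real.pi * θ)) ^ 2 *
      (∑' j, n j) ^ 2 * (2 / β)

/-- `∫ (R - S²) = -ε² ∫ Λ_eff + O(ε³)`. -/
theorem norm_integral_sub_sq_le (h : SmoothProfile θ β lam Q₀ Q₁ Q₂ Q₃ n) (hε : 0 < ε)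
    (hε1 : ε ≤ 1) (hreal : ∀ x, starRingEnd ℂ (oscSum lam ε Q₀ x) = oscSum lam ε Q₀ x) :
    ‖(∫ x, (oscSum lam ε (prof₂ 1 lam Q₂ ε) x - oscSum lam ε (profS lam Q₀ Q₁ ε) x ^ 2)) +
        ((ε ^ 2 * ∫ x, effPotential lam Q₀ x : ℝ) : ℂ)‖ ≤ homConst θ β n * ε ^ 3 := by
  have hα := h.freq_pos
  have hβ := h.rate_pos
  have hV := h.decay_potential ε
  have hN := hV.nonneg
  have hP := h.decay_oscSum_prof₂ hε h.decay₀ 1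
  have hT := h.decay_oscSum_prof₂ hε h.decay₁ (-2)
  have hR := h.decay_oscSum_prof₂ hε h.decay₂ 1
  have hS := h.decay_oscSum_profS hε
  have b1 := h.norm_integral_prof₂_le hε
  have b2 := h.norm_integral_potential_mul_P_le hε hreal
  have b3 := (hR.mul hP).norm_integral_le
  have b4 := (hS.mul hT).norm_integral_le
  set V := oscSum lam ε Q₀
  set P := oscSum lam ε (prof₂ 1 lam Q₀ ε)
  set T := oscSum lam ε (prof₂ (-2) lam Q₁ ε)
  set R := oscSum lam ε (prof₂ 1 lam Q₂ ε)
  set S := oscSum lam ε (profS lam Q₀ Q₁ ε)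
  set L := ∫ x, effPotential lam Q₀ x
  -- ∫S² is traded for ∫VP: S - T is P', and the derivative of S is V - R.
  have hparts : ∫ x, S x * (S x - T x) = -∫ x, (V x - R x) * P x :=
    integral_mul_deriv_eq_deriv_mul_of_integrable (fun x _ => h.hasDerivAt_S hε x)
      (fun x _ => h.hasDerivAt_P hε x) (hS.mul (hS.sub hT)).integrable
      ((hV.sub hR).mul hP).integrable (hS.mul hP).integrable
  have iVP := (hV.mul hP).integrable
  have iRP := (hR.mul hP).integrable
  have iSS := (hS.mul hS).integrable
  have iST := (hS.mul hT).integrable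
  simp only [mul_sub, sub_mul] at hparts
  rw [integral_sub iSS iST, integral_sub iVP iRP] at hparts
  have e : (∫ x, (R x - S x ^ 2)) + ((ε ^ 2 * L : ℝ) : ℂ) =
      (∫ x, R x) + ((∫ x, V x * P x) + ((ε ^ 2 * L : ℝ) : ℂ)) - (∫ x, R x * P x) -
        ∫ x, S x * T x := by
    simp only [pow_two (S _)]
    rw [integral_sub hR.integrable iSS]
    linear_combination -hparts
  rw [e]
  set α := 2 * Real.pi * θ
  set N := ∑' j, n j
  have h34 : ε ^ 4 ≤ ε ^ 3 := pow_le_pow_of_le_one hε.le hε1 (by norm_num)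
  have hS1 : ε / α + (ε / α) ^ 2 ≤ (1 / α + (1 / α) ^ 2) * ε := by
    have : ε ^ 2 ≤ ε := by nlinarith
    calc ε / α + (ε / α) ^ 2 = 1 / α * ε + (1 / α) ^ 2 * ε ^ 2 := by ring
      _ ≤ 1 / α * ε + (1 / α) ^ 2 * ε := by gcongr
      _ = _ := by ring
  calc _ ≤ (ε / α) ^ 3 * (2 / β) * N + (ε / α) ^ 3 * (4 / β) * N ^ 2 +
        ‖(1 : ℂ)‖ * (ε / α) ^ 2 * N * (‖(1 : ℂ)‖ * (ε / α) ^ 2 * N) * (2 / β) +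
        (ε / α + (ε / α) ^ 2) * N * (‖(-2 : ℂ)‖ * (ε / α) ^ 2 * N) * (2 / β) :=
        (norm_sub_le _ _).trans (add_le_add ((norm_sub_le _ _).trans (add_le_add
          ((norm_add_le _ _).trans (add_le_add b1 b2)) b3)) b4)
    _ ≤ (ε / α) ^ 3 * (2 / β) * N + (ε / α) ^ 3 * (4 / β) * N ^ 2 +
        1 * (ε / α) ^ 2 * N * (1 * (ε / α) ^ 2 * N) * (2 / β) +
        ((1 / α + (1 / α) ^ 2) * ε) * N * (2 * (ε / α) ^ 2 * N) * (2 / β) := by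
        rw [norm_one, norm_neg, Complex.norm_ofNat]
        gcongr
    _ = (1 / α) ^ 3 * (2 / β) * N * ε ^ 3 + (1 / α) ^ 3 * (4 / β) * N ^ 2 * ε ^ 3 +
        ((1 / α) ^ 2 * N) ^ 2 * (2 / β) * ε ^ 4 +
        2 * (1 / α + (1 / α) ^ 2) * (1 / α) ^ 2 * N ^ 2 * (2 / β) * ε ^ 3 := by ring
    _ ≤ (1 / α) ^ 3 * (2 / β) * N * ε ^ 3 + (1 / α) ^ 3 * (4 / β) * N ^ 2 * ε ^ 3 +
        ((1 / α) ^ 2 * N) ^ 2 * (2 / β) * ε ^ 3 +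
        2 * (1 / α + (1 / α) ^ 2) * (1 / α) ^ 2 * N ^ 2 * (2 / β) * ε ^ 3 := by gcongr
    _ = _ := by rw [homConst]; ring

end SmoothProfile

/-! ### Second-order linear equations -/

/-- `u` solves `u'' = W u`, with derivative `u₁`. -/
structure IsSolution (W u u₁ : ℝ → ℂ) : Prop where
  deriv : ∀ x, HasDerivAt u (u₁ x) x
  deriv₁ : ∀ x, HasDerivAt u₁ (W x * u x) x

namespace IsSolution

variable {W u u₁ v v₁ : ℝ → ℂ}

theorem const_mul (h : IsSolution W v v₁) (c : ℂ) :
    IsSolution W (fun x => c * v x) (fun x => c * v₁ x) :=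
  ⟨fun x => (h.deriv x).const_mul c, fun x => ((h.deriv₁ x).const_mul c).congr_deriv (by ring)⟩

theorem continuous (h : IsSolution W u u₁) : Continuous u :=
  continuous_iff_continuousAt.2 fun x => (h.deriv x).continuousAt

theorem continuous₁ (h : IsSolution W u u₁) : Continuous u₁ :=
  continuous_iff_continuousAt.2 fun x => (h.deriv₁ x).continuousAt

theorem unique {C : ℝ} (hW : ∀ x, ‖W x‖ ≤ C) (hu : IsSolution W u u₁) (hv : IsSolution W v v₁)
    (h0 : u 0 = v 0) (h1 : u₁ 0 = v₁ 0) : u = v ∧ u₁ = v₁ := by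
  have hC : 0 ≤ C := (norm_nonneg _).trans (hW 0)
  let F : ℝ → ℂ × ℂ → ℂ × ℂ := fun t p => (p.2, W t * p.1)
  have hF : ∀ t, LipschitzOnWith (max 1 C.toNNReal) (F t) univ := fun t => by
    refine (LipschitzWith.of_dist_le_mul fun p r => ?_).lipschitzOnWith
    have hm : ((max 1 C.toNNReal : NNReal) : ℝ) = max 1 C := by
      rw [NNReal.coe_max, NNReal.coe_one, Real.coe_toNNReal _ hC]
    rw [hm]
    rw [dist_eq_norm, dist_eq_norm, Prod.norm_def, Prod.norm_def]
    simp only [F, Prod.fst_sub, Prod.snd_sub, ← mul_sub, norm_mul]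
    have a1 := le_max_left 1 C
    have a2 := le_max_right 1 C
    have b1 := le_max_left ‖p.1 - r.1‖ ‖p.2 - r.2‖
    have b2 := le_max_right ‖p.1 - r.1‖ ‖p.2 - r.2‖
    refine max_le ?_ ?_
    · calc ‖p.2 - r.2‖ = 1 * ‖p.2 - r.2‖ := (one_mul _).symm
        _ ≤ _ := mul_le_mul a1 b2 (norm_nonneg _) (by linarith)
    · exact mul_le_mul ((hW t).trans a2) b1 (norm_nonneg _) (by linarith)
  have key : (fun t => (u t, u₁ t)) = fun t => (v t, v₁ t) :=
    ODE_solution_unique_univ (t₀ := 0) (v := F) hF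
      (fun t => ⟨(hu.deriv t).prodMk (hu.deriv₁ t), mem_univ _⟩)
      (fun t => ⟨(hv.deriv t).prodMk (hv.deriv₁ t), mem_univ _⟩) (by simp [h0, h1])
  exact ⟨funext fun t => congrArg Prod.fst (congrFun key t),
    funext fun t => congrArg Prod.snd (congrFun key t)⟩

theorem eq_zero {C : ℝ} (hW : ∀ x, ‖W x‖ ≤ C) (hu : IsSolution W u u₁)
    (h0 : u 0 = 0) (h1 : u₁ 0 = 0) (x : ℝ) : u x = 0 := by
  have := (hu.unique hW (hu.const_mul 0) (by simp [h0]) (by simp [h1])).1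
  simpa using congrFun this x

/-- Solutions with vanishing Wronskian are proportional. -/
theorem exists_eq_const_mul {C : ℝ} (hW : ∀ x, ‖W x‖ ≤ C) (hu : IsSolution W u u₁)
    (hv : IsSolution W v v₁) (hv0 : ∃ x, v x ≠ 0) (h : u 0 * v₁ 0 - v 0 * u₁ 0 = 0) :
    ∃ c : ℂ, (∀ x, u x = c * v x) ∧ ∀ x, u₁ x = c * v₁ x := by
  obtain ⟨c, h0, h1⟩ : ∃ c : ℂ, u 0 = c * v 0 ∧ u₁ 0 = c * v₁ 0 := by
    by_cases a : v 0 = 0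
    · have b : v₁ 0 ≠ 0 := fun b => by
        obtain ⟨x, hx⟩ := hv0
        exact hx (hv.eq_zero hW a b x)
      refine ⟨u₁ 0 / v₁ 0, ?_, by field_simp⟩
      rw [a, zero_mul, sub_zero] at h
      rw [a, mul_zero]
      exact (mul_eq_zero.1 h).resolve_right b
    · refine ⟨u 0 / v 0, by field_simp, ?_⟩
      rw [div_mul_eq_mul_div, eq_div_iff a]
      linear_combination -h
  obtain ⟨e0, e1⟩ := hu.unique hW (hv.const_mul c) h0 h1
  exact ⟨c, congrFun e0, congrFun e1⟩

end IsSolution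

/-! ### Bound states -/

section BoundState

variable {N β : ℝ} {V : ℝ → ℂ} {k : ℂ}

theorem isSolution_modulated (hV : IsExpDecaying N β V) (hk : 0 < k.im) :
    IsSolution (fun x => V x - k ^ 2)
      (fun x : ℝ => Complex.exp (Complex.I * k * x) * modJost V k x)
      (fun x : ℝ => Complex.exp (Complex.I * k * x) *
        (Complex.I * k * modJost V k x - modJostTail V k x)) :=
  ⟨hasDerivAt_modulated hV hk, hasDerivAt_modulated_deriv hV hk⟩

theorem IsSolution.comp_neg {W u u₁ : ℝ → ℂ} (h : IsSolution W u u₁) :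
    IsSolution (fun x => W (-x)) (fun x => u (-x)) (fun x => -u₁ (-x)) := by
  refine ⟨fun x => ((h.deriv (-x)).scomp x (hasDerivAt_neg x)).congr_deriv (by simp),
    fun x => ((h.deriv₁ (-x)).scomp x (hasDerivAt_neg x)).neg.congr_deriv (by simp)⟩

theorem exists_bound_modulated (hV : IsExpDecaying N β V) (hk : 0 < k.im) :
    ∃ B : ℝ, ∀ x : ℝ, 0 ≤ x →
      ‖Complex.exp (Complex.I * k * x) * modJost V k x‖ ≤ B * Real.exp (-(k.im * x)) ∧
      ‖Complex.exp (Complex.I * k * x) * (Complex.I * k * modJost V k x - modJostTail V k x)‖ ≤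
        B * Real.exp (-(k.im * x)) := by
  have hβ := hV.rate_pos
  set B := modJostBound N β ‖k‖ 0
  have hn : ∀ x : ℝ, ‖Complex.exp (Complex.I * k * x)‖ = Real.exp (-(k.im * x)) := fun x => by
    rw [Complex.norm_exp]; simp
  have hB : 0 ≤ B := (norm_nonneg _).trans (norm_modJost_le hV hk (le_refl (0 : ℝ)))
  refine ⟨max B (‖k‖ * B + N * B * (1 / β)), fun x hx => ⟨?_, ?_⟩⟩
  · rw [norm_mul, hn, mul_comm]
    exact mul_le_mul_of_nonneg_right ((norm_modJost_le hV hk hx).trans (le_max_left _ _))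
      (Real.exp_nonneg _)
  · rw [norm_mul, hn, mul_comm]
    refine mul_le_mul_of_nonneg_right (le_trans ?_ (le_max_right _ _)) (Real.exp_nonneg _)
    refine (norm_sub_le _ _).trans (add_le_add ?_ ?_)
    · rw [norm_mul, norm_mul, Complex.norm_I, one_mul]
      exact mul_le_mul_of_nonneg_left (norm_modJost_le hV hk hx) (norm_nonneg _)
    · refine (norm_modJostTail_le hV hk hx).trans ?_
      have := hV.nonneg
      gcongr
      exact Real.exp_le_one_iff.2 (neg_nonpos.2 (mul_nonneg hβ.le hx))

/-- The zero function violates the inhomogeneous Volterra equation. -/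
theorem exists_modulated_ne_zero (hV : IsExpDecaying N β V) (hk : 0 < k.im) :
    ∃ x : ℝ, Complex.exp (Complex.I * k * x) * modJost V k x ≠ 0 := by
  by_contra! hzero
  have h0 : ∀ x, modJost V k x = 0 := fun x =>
    (mul_eq_zero.1 (hzero x)).resolve_left (Complex.exp_ne_zero _)
  have := modJost_eq hV hk 0
  simp [h0] at this

/-- If the Wronskian of the Jost solutions vanishes, the equation has an exponentially decaying
solution. -/
theorem exists_boundState (hV : IsExpDecaying N β V) (hk : 0 < k.im)
    (hW : jostWronskian V k = 0) :
    ∃ (f f₁ : ℝ → ℂ) (M : ℝ), IsSolution (fun x => V x - k ^ 2) f f₁ ∧ (∃ x, f x ≠ 0) ∧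
      IsExpDecaying M k.im f ∧ IsExpDecaying M k.im f₁ := by
  have hV' := hV.comp_neg
  have hb : ∀ x, ‖V x - k ^ 2‖ ≤ N + ‖k ^ 2‖ := fun x =>
    (norm_sub_le _ _).trans (add_le_add_left (hV.bound_const x) _)
  have hf := isSolution_modulated hV hk
  have hg := (isSolution_modulated hV' hk).comp_neg
  simp only [neg_neg] at hg
  obtain ⟨x₀, hx₀⟩ := exists_modulated_ne_zero hV' hk
  -- A vanishing Wronskian makes f_+ a multiple of f_-; it then decays at +∞ by its own bound and at
  -- -∞ by that of f_-.
  obtain ⟨c, h0, h1⟩ := hf.exists_eq_const_mul hb hg ⟨-x₀, by simpa using hx₀⟩ (by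
    rw [← hW, jostWronskian]
    simp
    ring)
  obtain ⟨B₁, hB₁⟩ := exists_bound_modulated hV hk
  obtain ⟨B₂, hB₂⟩ := exists_bound_modulated hV' hk
  have hc := norm_nonneg c
  refine ⟨_, _, max B₁ (‖c‖ * B₂), hf, exists_modulated_ne_zero hV hk, ⟨hk, hf.continuous, fun x => ?_⟩,
    ⟨hk, hf.continuous₁, fun x => ?_⟩⟩
  · rcases le_total 0 x with hx | hx
    · rw [abs_of_nonneg hx]
      exact (hB₁ x hx).1.trans (mul_le_mul_of_nonneg_right (le_max_left _ _) (Real.exp_nonneg _))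
    · rw [abs_of_nonpos hx, h0 x, norm_mul]
      refine (mul_le_mul_of_nonneg_left (hB₂ (-x) (neg_nonneg.2 hx)).1 hc).trans ?_
      rw [← mul_assoc]
      exact mul_le_mul_of_nonneg_right (le_max_right _ _) (Real.exp_nonneg _)
  · rcases le_total 0 x with hx | hx
    · rw [abs_of_nonneg hx]
      exact (hB₁ x hx).2.trans (mul_le_mul_of_nonneg_right (le_max_left _ _) (Real.exp_nonneg _))
    · rw [abs_of_nonpos hx, h1 x, norm_mul, norm_neg]
      refine (mul_le_mul_of_nonneg_left (hB₂ (-x) (neg_nonneg.2 hx)).2 hc).trans ?_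
      rw [← mul_assoc]
      exact mul_le_mul_of_nonneg_right (le_max_right _ _) (Real.exp_nonneg _)

theorem IsExpDecaying.memLp_two {f : ℝ → ℂ} (hf : IsExpDecaying N β f) : MemLp f 2 := by
  rw [memLp_two_iff_integrable_sq_norm hf.continuous.aestronglyMeasurable]
  have := (hf.mul hf).integrable.norm
  simpa only [norm_mul, ← pow_two, norm_pow] using this

theorem mem_eigenspace_schrodinger_iff (V : ℝ → ℂ) (E : ℂ) (u : L2) :
    u ∈ eigenspace (schrodingerOp V) E ↔ ∃ u₁ u₂ : L2, HasWeakDeriv u u₁ ∧ HasWeakDeriv u₁ u₂ ∧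
      ∀ᵐ x : ℝ, u₂ x = (V x - E) * u x := by
  rw [eigenspace, schrodingerOp_graph]
  have key : ∀ u₂ : L2, (∀ᵐ x : ℝ, (E • u) x = -u₂ x + V x * u x) ↔
      ∀ᵐ x : ℝ, u₂ x = (V x - E) * u x := fun u₂ => by
    refine eventually_congr ?_
    filter_upwards [Lp.coeFn_smul E u] with x hx
    rw [hx, Pi.smul_apply, smul_eq_mul]
    constructor
    · intro h; linear_combination h
    · intro h; linear_combination h
  constructor
  · rintro ⟨u₁, u₂, h1, h2, h3⟩
    exact ⟨u₁, u₂, h1, h2, (key u₂).1 h3⟩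
  · rintro ⟨u₁, u₂, h1, h2, h3⟩
    exact ⟨u₁, u₂, h1, h2, (key u₂).2 h3⟩

/-- A function in the eigenspace has a classical representative. -/
theorem exists_isSolution_of_mem_eigenspace (hV : Continuous V) {E : ℂ} {u : L2}
    (hu : u ∈ eigenspace (schrodingerOp V) E) :
    ∃ U U₁ : ℝ → ℂ, u =ᵐ[volume] U ∧ IsSolution (fun x => V x - E) U U₁ ∧ MemLp U 2 ∧ MemLp U₁ 2 := by
  obtain ⟨u₁, u₂, h1, h2, h3⟩ := (mem_eigenspace_schrodinger_iff V E u).1 hu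
  obtain ⟨U, hU, cU⟩ := h1.exists_continuous
  have e2 : u₂ =ᵐ[volume] fun x => (V x - E) * U x := by
    filter_upwards [h3, hU] with x hx hx'
    rw [hx, hx']
  obtain ⟨U₁, hU₁, d1⟩ := h2.exists_hasDerivAt e2 (by fun_prop)
  have cU₁ : Continuous U₁ := continuous_iff_continuousAt.2 fun x => (d1 x).continuousAt
  obtain ⟨U', hU', d0⟩ := h1.exists_hasDerivAt hU₁ cU₁
  have cU' : Continuous U' := continuous_iff_continuousAt.2 fun x => (d0 x).continuousAt
  have : U' = U := (cU'.ae_eq_iff_eq volume cU).1 (hU'.symm.trans hU)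
  subst this
  exact ⟨U', U₁, hU, ⟨d0, d1⟩, (Lp.memLp u).ae_eq hU, (Lp.memLp u₁).ae_eq hU₁⟩

/-- The Wronskian of an eigenfunction with the bound state is constant, and integrable as a sum of
products of L² functions. A constant integrable on the line is 0, so the two are proportional. -/
theorem simple_eigenvalue_of_boundState (hV : IsExpDecaying N β V) {E : ℂ} {f f₁ : ℝ → ℂ}
    {M κ : ℝ} (hf : IsSolution (fun x => V x - E) f f₁) (hf0 : ∃ x, f x ≠ 0)
    (hd : IsExpDecaying M κ f) (hd₁ : IsExpDecaying M κ f₁) :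
    IsSimpleEigenvalue (schrodingerOp V) E ∧ ∀ u ∈ eigenspace (schrodingerOp V) E,
      ∃ M' : ℝ, ∀ᵐ x : ℝ, ‖u x‖ ≤ M' * Real.exp (-(κ * |x|)) := by
  have hb : ∀ x, ‖V x - E‖ ≤ N + ‖E‖ := fun x =>
    (norm_sub_le _ _).trans (add_le_add_left (hV.bound_const x) _)
  have hVc := hV.continuous
  have hd₂ : IsExpDecaying ((N + ‖E‖) * M) κ (fun x => (V x - E) * f x) :=
    hd.mul_bounded (by fun_prop) hb
  set φ : L2 := hd.memLp_two.toLp f with hφ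
  have eφ : φ =ᵐ[volume] f := MemLp.coeFn_toLp _
  have hφmem : φ ∈ eigenspace (schrodingerOp V) E := by
    rw [mem_eigenspace_schrodinger_iff]
    refine ⟨hd₁.memLp_two.toLp f₁, hd₂.memLp_two.toLp _, ?_, ?_, ?_⟩
    · exact (hasWeakDeriv_of_hasDerivAt hf.deriv hd₁.continuous).congr eφ.symm
        (MemLp.coeFn_toLp _).symm
    · exact (hasWeakDeriv_of_hasDerivAt hf.deriv₁ hd₂.continuous).congr (MemLp.coeFn_toLp _).symm
        (MemLp.coeFn_toLp _).symm
    · filter_upwards [eφ, MemLp.coeFn_toLp hd₂.memLp_two] with x h1 h2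
      rw [h1, h2]
  have hφ0 : φ ≠ 0 := by
    intro h
    have h1 : f =ᵐ[volume] fun _ => 0 := eφ.symm.trans (by rw [h]; exact Lp.coeFn_zero ℂ 2 volume)
    have h2 := (hd.continuous.ae_eq_iff_eq volume continuous_const).1 h1
    obtain ⟨x, hx⟩ := hf0
    exact hx (congrFun h2 x)
  have hspan : ∀ u ∈ eigenspace (schrodingerOp V) E, ∃ c : ℂ, u = c • φ := by
    intro u hu
    obtain ⟨U, U₁, hU, hs, m0, m1⟩ := exists_isSolution_of_mem_eigenspace hVc hu
    have hder : ∀ x, HasDerivAt (fun x => U x * f₁ x - f x * U₁ x) 0 x := fun x =>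
      (((hs.deriv x).mul (hf.deriv₁ x)).sub ((hf.deriv x).mul (hs.deriv₁ x))).congr_deriv (by ring)
    have hconst : ∀ x, U x * f₁ x - f x * U₁ x = U 0 * f₁ 0 - f 0 * U₁ 0 := fun x =>
      is_const_of_deriv_eq_zero (fun x => (hder x).differentiableAt) (fun x => (hder x).deriv) x 0
    have hint : Integrable fun x => U x * f₁ x - f x * U₁ x :=
      (m0.integrable_mul hd₁.memLp_two).sub (hd.memLp_two.integrable_mul m1)
    rw [funext hconst, integrable_const_iff] at hint
    have hw : U 0 * f₁ 0 - f 0 * U₁ 0 = 0 := hint.resolve_right fun h => by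
      have := h.measure_univ_lt_top
      simp at this
    obtain ⟨c, hc, -⟩ := hs.exists_eq_const_mul hb hf hf0 hw
    refine ⟨c, Lp.ext ?_⟩
    filter_upwards [hU, eφ, Lp.coeFn_smul c φ] with x h1 h2 h3
    rw [h1, h3, hc, Pi.smul_apply, h2, smul_eq_mul]
  refine ⟨?_, fun u hu => ?_⟩
  · have : eigenspace (schrodingerOp V) E = Submodule.span ℂ {φ} := by
      refine le_antisymm (fun u hu => ?_) ?_
      · obtain ⟨c, rfl⟩ := hspan u hu
        exact Submodule.smul_mem _ _ (Submodule.mem_span_singleton_self φ)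
      · rw [Submodule.span_singleton_le_iff_mem]; exact hφmem
    rw [IsSimpleEigenvalue, this]
    exact finrank_span_singleton hφ0
  · obtain ⟨c, rfl⟩ := hspan u hu
    refine ⟨‖c‖ * M, ?_⟩
    filter_upwards [eφ, Lp.coeFn_smul c φ] with x h2 h3
    rw [h3, Pi.smul_apply, h2, smul_eq_mul]
    exact (hd.const_mul c).bound x

end BoundState

/-! ### Dependence on the potential up to null sets -/

theorem schrodingerGraph_congr {V W : ℝ → ℂ} (h : V =ᵐ[volume] W) :
    schrodingerGraph V = schrodingerGraph W := by
  have key : ∀ {V W : ℝ → ℂ}, V =ᵐ[volume] W → schrodingerGraph V ≤ schrodingerGraph W := by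
    rintro V W h p ⟨u₁, u₂, h1, h2, h3⟩
    refine ⟨u₁, u₂, h1, h2, ?_⟩
    filter_upwards [h, h3] with x hx h3
    rw [h3, hx]
  exact le_antisymm (key h) (key h.symm)

theorem isJostPlus_congr {V W : ℝ → ℂ} (h : V =ᵐ[volume] W) (k : ℂ) :
    IsJostPlus V k = IsJostPlus W k := by
  have key : ∀ {V W : ℝ → ℂ}, V =ᵐ[volume] W → ∀ f, IsJostPlus V k f → IsJostPlus W k f := by
    intro V W h f hf
    have e : ∀ x : ℝ, (fun y : ℝ => volterraKernel k (y - x) * V y * f y) =ᵐ[volume.restrict (Ioi x)]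
        fun y : ℝ => volterraKernel k (y - x) * W y * f y := fun x => by
      filter_upwards [ae_restrict_of_ae h] with y hy
      rw [hy]
    exact ⟨hf.continuous, fun x => (hf.integrable x).congr (e x), fun x => by
      rw [hf.volterra x, integral_congr_ae (e x)]⟩
  exact funext fun f => propext ⟨key h f, key h.symm f⟩

theorem ae_comp_neg {V W : ℝ → ℂ} (h : V =ᵐ[volume] W) :
    (fun x => V (-x)) =ᵐ[volume] fun x => W (-x) :=
  (Measure.measurePreserving_neg (volume : Measure ℝ)).quasiMeasurePreserving.ae h

/-- The potential occurs only under integral signs, so the predicates defining the Jost solutions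
coincide and `Classical.epsilon` selects the same functions, for every k. -/
theorem transmission_congr {V W : ℝ → ℂ} (h : V =ᵐ[volume] W) (k : ℂ) :
    transmission V k = transmission W k := by
  have h1 : IsJostMinus V k = IsJostMinus W k := funext fun f => by
    rw [isJostMinus_iff, isJostMinus_iff, isJostPlus_congr (ae_comp_neg h)]
  rw [transmission, transmission, jostPlus, jostPlus, jostMinus, jostMinus, isJostPlus_congr h, h1]

/-! ### Zeros of the Wronskian and poles of the transmission coefficient -/

section Pole

variable {N β : ℝ} {V : ℝ → ℂ} {k : ℂ}

theorem isOpen_upperHalfPlane : IsOpen {k : ℂ | 0 < k.im} :=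
  isOpen_lt continuous_const Complex.continuous_im

theorem hasPoleAt_transmission (hV : IsExpDecaying N β V) (hk : 0 < k.im)
    (h0 : jostWronskian V k = 0) (hne : ∃ k' : ℂ, 0 < k'.im ∧ jostWronskian V k' ≠ 0) :
    HasPoleAt (transmission V) k := by
  have han : AnalyticOnNhd ℂ (jostWronskian V) {k | 0 < k.im} :=
    (differentiableOn_jostWronskian hV).analyticOnNhd isOpen_upperHalfPlane
  have hmer : MeromorphicAt (jostWronskian V) k := (han k hk).meromorphicAt
  have hnum : AnalyticAt ℂ (fun z : ℂ => -(2 * Complex.I * z)) k := by fun_prop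
  have hk0 : k ≠ 0 := fun h => by simp [h] at hk
  have hev : transmission V =ᶠ[𝓝 k] fun z => -(2 * Complex.I * z) / jostWronskian V z := by
    filter_upwards [isOpen_upperHalfPlane.mem_nhds hk] with z hz
    exact transmission_eq hV hz
  have hev' := hev.filter_mono (nhdsWithin_le_nhds (s := {k}ᶜ))
  refine ⟨(hnum.meromorphicAt.div hmer).congr hev'.symm, ?_⟩
  -- Infinite order would make the Wronskian vanish on the whole, connected, half plane.
  have htop : meromorphicOrderAt (jostWronskian V) k ≠ ⊤ := by
    intro htop
    obtain ⟨k', hk', hW⟩ := hne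
    rw [(han k hk).meromorphicOrderAt_eq, ENat.map_eq_top_iff, analyticOrderAt_eq_top] at htop
    exact hW (han.eqOn_zero_of_preconnected_of_eventuallyEq_zero
      (convex_halfSpace_im_gt 0).isPreconnected hk htop hk')
  have hpos : 0 < meromorphicOrderAt (jostWronskian V) k := by
    rw [(han k hk).meromorphicOrderAt_eq]
    have : analyticOrderAt (jostWronskian V) k ≠ 0 := by
      rw [Ne, (han k hk).analyticOrderAt_eq_zero]
      exact fun h => h h0
    cases h : analyticOrderAt (jostWronskian V) k with
    | top => simp
    | coe m =>
      rw [h] at this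
      have hm : m ≠ 0 := fun hm => this (by simp [hm])
      simp only [ENat.map_natCast]
      exact_mod_cast Nat.pos_of_ne_zero hm
  have hnum0 : meromorphicOrderAt (fun z : ℂ => -(2 * Complex.I * z)) k = 0 := by
    rw [hnum.meromorphicOrderAt_eq, hnum.analyticOrderAt_eq_zero.2 (by simp [hk0])]
    rfl
  rw [meromorphicOrderAt_congr hev',
    show (fun z => -(2 * Complex.I * z) / jostWronskian V z) =
      (fun z : ℂ => -(2 * Complex.I * z)) * (jostWronskian V)⁻¹ from
      funext fun z => div_eq_mul_inv _ _,
    meromorphicOrderAt_mul hnum.meromorphicAt hmer.inv, hnum0, zero_add, meromorphicOrderAt_inv]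
  lift meromorphicOrderAt (jostWronskian V) k to ℤ using htop with m
  norm_cast at hpos ⊢
  omega

/-- If `W(iκ)` is close to `2(κ - a)` near `a`, then it has a zero near `a`. -/
theorem exists_zero_jostWronskian (hV : IsExpDecaying N β V)
    (hreal : ∀ x, starRingEnd ℂ (V x) = V x) {a r : ℝ} (hr : 0 < r) (hra : r < a)
    (h : ∀ κ ∈ Icc (a - r) (a + r), ‖jostWronskian V (Complex.I * κ) - 2 * (κ - a)‖ < 2 * r) :
    ∃ κ ∈ Icc (a - r) (a + r), jostWronskian V (Complex.I * κ) = 0 ∧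
      HasPoleAt (transmission V) (Complex.I * κ) := by
  have him : ∀ κ : ℝ, (Complex.I * κ).im = κ := fun κ => by simp
  have hre : ∀ κ ∈ Icc (a - r) (a + r),
      |(jostWronskian V (Complex.I * κ)).re - 2 * (κ - a)| < 2 * r := fun κ hκ => by
    refine lt_of_le_of_lt ?_ (h κ hκ)
    refine le_trans (le_of_eq ?_) (Complex.abs_re_le_norm _)
    simp
  have hcont : ContinuousOn (fun κ : ℝ => (jostWronskian V (Complex.I * κ)).re)
      (Icc (a - r) (a + r)) := by
    refine Complex.continuous_re.comp_continuousOn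
      ((differentiableOn_jostWronskian hV).continuousOn.comp (by fun_prop) fun κ hκ => ?_)
    change 0 < (Complex.I * (κ : ℂ)).im
    rw [him]
    linarith [hκ.1]
  -- At the endpoints 2(κ - a) equals ∓2r, so the strict bound forces a change of sign.
  have hl := abs_lt.1 (hre (a - r) ⟨le_refl _, by linarith⟩)
  have hu := abs_lt.1 (hre (a + r) ⟨by linarith, le_refl _⟩)
  obtain ⟨κ, hκ, hκ0⟩ := intermediate_value_Icc (by linarith) hcont
    (show (0 : ℝ) ∈ Icc _ _ from ⟨by linarith [hl.2], by linarith [hu.1]⟩)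
  have hW : jostWronskian V (Complex.I * κ) = 0 :=
    Complex.ext hκ0 (Complex.conj_eq_iff_im.1 (conj_jostWronskian hreal κ))
  refine ⟨κ, hκ, hW, hasPoleAt_transmission hV (by rw [him]; linarith [hκ.1]) hW
    ⟨Complex.I * ((a + r : ℝ) : ℂ), by rw [him]; linarith, fun h0 => ?_⟩⟩
  rw [h0, Complex.zero_re] at hu
  linarith [hu.1]

end Pole

/-! ### The oscillatory potential -/

section Osc

variable {θ β : ℝ} {lam : Idx → ℝ} {q Q₀ Q₁ Q₂ Q₃ : Idx → ℝ → ℂ} {n : Idx → ℝ} {ε : ℝ}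

theorem oscPotential_ae_eq (h : ∀ j, q j =ᵐ[volume] Q₀ j) (lam : Idx → ℝ) (ε : ℝ) :
    oscPotential lam q ε =ᵐ[volume] oscSum lam ε Q₀ := by
  filter_upwards [ae_all_iff.2 h] with x hx
  simp only [oscPotential, twoScale, oscSum, phase, hx]

theorem integral_effPotential_congr (h : ∀ j, q j =ᵐ[volume] Q₀ j) (lam : Idx → ℝ) :
    ∫ x, effPotential lam q x = ∫ x, effPotential lam Q₀ x := by
  refine integral_congr_ae ?_
  filter_upwards [ae_all_iff.2 h] with x hx
  simp only [effPotential, hx]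

theorem SmoothProfile.integral_effPotential_pos (h : SmoothProfile θ β lam Q₀ Q₁ Q₂ Q₃ n)
    (hQ : ∃ j, ¬ (Q₀ j =ᵐ[volume] 0)) : 0 < ∫ x, effPotential lam Q₀ x := by
  obtain ⟨j, hj⟩ := hQ
  have hs := h.hasSum_integral_effPotential
  have hnn : ∀ l, 0 ≤ 1 / (2 * Real.pi) ^ 2 * ((∫ x, ‖Q₀ l x‖ ^ 2) / lam l ^ 2) := fun l =>
    mul_nonneg (by positivity) (div_nonneg (integral_nonneg fun x => by positivity) (sq_nonneg _))
  refine lt_of_lt_of_le ?_ (le_hasSum hs j fun l _ => hnn l)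
  have hlam : 0 < lam j ^ 2 := by
    rw [← sq_abs]; exact pow_pos (h.θ_pos.trans_le (h.lam_ge j)) 2
  have hpos : 0 < ∫ x, ‖Q₀ j x‖ ^ 2 := by
    refine lt_of_le_of_ne (integral_nonneg fun x => by positivity) fun h0 => hj ?_
    rw [eq_comm, integral_eq_zero_iff_of_nonneg (fun x => by positivity) (h.integrable_sq j)] at h0
    filter_upwards [h0] with x hx
    simpa using hx
  positivity

/-- The Wronskian of the Jost solutions of an oscillatory potential close to the spectral edge. -/
theorem SmoothProfile.norm_jostWronskian_sub_le (h : SmoothProfile θ β lam Q₀ Q₁ Q₂ Q₃ n)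
    (hε : 0 < ε) (hε1 : ε ≤ 1)
    (hreal : ∀ x, starRingEnd ℂ (oscSum lam ε Q₀ x) = oscSum lam ε Q₀ x) {D κ : ℝ}
    (hD : size θ n ≤ D) (hκ : 0 < κ) (hκD : κ ≤ D * ε ^ 2)
    (hDε : halfLineConst β * (D * ε ^ 2) ≤ 1 / 4) :
    ‖jostWronskian (oscSum lam ε Q₀) (Complex.I * κ) -
        2 * (κ - (ε ^ 2 / 2 * ∫ x, effPotential lam Q₀ x : ℝ))‖ ≤
      (|8 * halfLineConst β ^ 2 + 2 * halfLineConst₂ β| * D ^ 2 + |homConst θ β n|) * ε ^ 3 := by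
  have b1 := (h.corrector hε hε1 hD).norm_jostWronskian_sub_le (h.decay_potential ε) hκ hκD hDε
  have b2 := h.norm_integral_sub_sq_le hε hε1 hreal
  set J := ∫ x, (oscSum lam ε (prof₂ 1 lam Q₂ ε) x - oscSum lam ε (profS lam Q₀ Q₁ ε) x ^ 2)
  set L := ∫ x, effPotential lam Q₀ x
  set W := jostWronskian (oscSum lam ε Q₀) (Complex.I * κ)
  have e : W - 2 * (κ - (ε ^ 2 / 2 * L : ℝ)) = (W - (2 * κ + J)) + (J + ((ε ^ 2 * L : ℝ) : ℂ)) := by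
    push_cast; ring
  rw [e]
  refine (norm_add_le _ _).trans ?_
  have h34 : ε ^ 4 ≤ ε ^ 3 := pow_le_pow_of_le_one hε.le hε1 (by norm_num)
  calc _ ≤ _ := add_le_add b1 b2
    _ ≤ |8 * halfLineConst β ^ 2 + 2 * halfLineConst₂ β| * (D * ε ^ 2) ^ 2 +
        |homConst θ β n| * ε ^ 3 := by
        gcongr <;> exact le_abs_self _
    _ = |8 * halfLineConst β ^ 2 + 2 * halfLineConst₂ β| * D ^ 2 * ε ^ 4 +
        |homConst θ β n| * ε ^ 3 := by ring
    _ ≤ |8 * halfLineConst β ^ 2 + 2 * halfLineConst₂ β| * D ^ 2 * ε ^ 3 +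
        |homConst θ β n| * ε ^ 3 := by gcongr
    _ = _ := by ring

/-- A pole of the transmission coefficient close to `i ε²/2 ∫ Λ_eff`. -/
theorem SmoothProfile.exists_pole (h : SmoothProfile θ β lam Q₀ Q₁ Q₂ Q₃ n)
    (hL : 0 < ∫ x, effPotential lam Q₀ x) :
    ∃ ε₀ C : ℝ, 0 < ε₀ ∧ 0 < C ∧ ∀ ε : ℝ, 0 < ε → ε < ε₀ →
      (∀ x, starRingEnd ℂ (oscSum lam ε Q₀ x) = oscSum lam ε Q₀ x) →
      ∃ κ : ℝ, 0 < κ ∧ κ ≤ ε ^ 2 * (∫ x, effPotential lam Q₀ x) ∧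
        |κ - ε ^ 2 / 2 * ∫ x, effPotential lam Q₀ x| ≤ C * ε ^ 3 ∧
        jostWronskian (oscSum lam ε Q₀) (Complex.I * κ) = 0 ∧
        HasPoleAt (transmission (oscSum lam ε Q₀)) (Complex.I * κ) := by
  set L := ∫ x, effPotential lam Q₀ x
  -- D dominates both the corrector and L, so that δ = Dε² also bounds every κ ≤ ε²L.
  set D := |size θ n| + L + 1
  have hD0 : 0 < D := by positivity
  have hK := one_le_halfLineConst h.rate_pos
  set K := halfLineConst β
  -- The summand 1 makes C positive and the later comparison with 2C strict.
  set C := |8 * K ^ 2 + 2 * halfLineConst₂ β| * D ^ 2 + |homConst θ β n| + 1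
  have hC : 0 < C := by positivity
  -- The three bounds on ε give ε⁴ ≤ ε³, then Cε³ < ε²L/2 so that the search interval lies in κ > 0,
  -- and finally Kδ ≤ 1/4.
  refine ⟨min 1 (min (L / (4 * C)) (1 / (4 * K * D))), C, by positivity, hC,
    fun ε hε hlt hreal => ?_⟩
  obtain ⟨h1, hlt⟩ := lt_min_iff.1 hlt
  obtain ⟨h2, h3⟩ := lt_min_iff.1 hlt
  rw [lt_div_iff₀ (by positivity)] at h2 h3
  have hε2 : ε ^ 2 ≤ ε := by nlinarith
  have hCε : C * ε ^ 3 < ε ^ 2 / 2 * L := by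
    have : ε ^ 2 * (C * ε) < ε ^ 2 * (L / 2) := by
      apply mul_lt_mul_of_pos_left _ (by positivity); linarith
    linarith
  have hDε : K * (D * ε ^ 2) ≤ 1 / 4 := by
    have : K * D * ε ^ 2 ≤ K * D * ε := by gcongr
    linarith
  obtain ⟨κ, hκ, hW, hp⟩ := exists_zero_jostWronskian (h.decay_potential ε) hreal
    (a := ε ^ 2 / 2 * L) (r := C * ε ^ 3) (by positivity) hCε fun κ hκ => by
      have hup : κ ≤ ε ^ 2 * L := by linarith [hκ.2]
      refine lt_of_le_of_lt (h.norm_jostWronskian_sub_le hε h1.le hreal (D := D)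
        ((le_abs_self _).trans (by simp only [D]; linarith)) (by linarith [hκ.1])
        (hup.trans ?_) hDε) ?_
      · rw [mul_comm]
        refine mul_le_mul_of_nonneg_right ?_ (by positivity)
        simp only [D]
        linarith [abs_nonneg (size θ n)]
      · have : 0 < ε ^ 3 := by positivity
        have hCC : |8 * K ^ 2 + 2 * halfLineConst₂ β| * D ^ 2 + |homConst θ β n| < 2 * C := by
          linarith
        rw [← mul_assoc]
        exact mul_lt_mul_of_pos_right hCC this
  exact ⟨κ, by linarith [hκ.1], by linarith [hκ.2],
    abs_le.2 ⟨by linarith [hκ.1], by linarith [hκ.2]⟩, hW, hp⟩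

/-- Reality is given for almost every x; continuity of the representative extends it to all x. -/
theorem SmoothProfile.conj_oscSum (h : SmoothProfile θ β lam Q₀ Q₁ Q₂ Q₃ n)
    (hq : ∀ j, q j =ᵐ[volume] Q₀ j)
    (hreal : ∀ᵐ x : ℝ, ∀ y : ℝ, (twoScale lam q x y).im = 0) (ε x : ℝ) :
    starRingEnd ℂ (oscSum lam ε Q₀ x) = oscSum lam ε Q₀ x := by
  have hc := (h.decay_potential ε).continuous
  have : (fun x => starRingEnd ℂ (oscSum lam ε Q₀ x)) = oscSum lam ε Q₀ := by
    refine ((Complex.continuous_conj.comp hc).ae_eq_iff_eq volume hc).1 ?_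
    filter_upwards [oscPotential_ae_eq hq lam ε, hreal] with x h1 h2
    rw [Function.comp_apply, ← h1]
    exact Complex.conj_eq_iff_im.2 (h2 _)
  exact congrFun this x

end Osc

end EdgeBifurcation

/-! ### From the pole to the eigenvalue. -/

theorem mainTheorem2
    (lam : EdgeBifurcation.Idx → ℝ) (q : EdgeBifurcation.Idx → ℝ → ℂ) (θ β : ℝ)
    (hθ : 0 < θ) (hβ : 0 < β)
    (hgap : ∀ j l : EdgeBifurcation.Idx, j ≠ l → θ ≤ |lam j - lam l|)
    (hlam : ∀ j : EdgeBifurcation.Idx, θ ≤ |lam j|)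
    (hnorm : ∑' j : EdgeBifurcation.Idx, EdgeBifurcation.sobolevNorm 3 β (q j) < ⊤)
    (hreal : ∀ᵐ x : ℝ, ∀ y : ℝ, (EdgeBifurcation.twoScale lam q x y).im = 0)
    (hq : ∃ j : EdgeBifurcation.Idx, ¬ (q j =ᵐ[volume] 0)) :
    ∃ ε₀ C : ℝ, 0 < ε₀ ∧ 0 < C ∧ ∀ ε : ℝ, 0 < ε → ε < ε₀ →
      ∃ (k : ℂ) (E : ℝ),
        0 < k.im ∧
        EdgeBifurcation.HasPoleAt
          (EdgeBifurcation.transmission (EdgeBifurcation.oscPotential lam q ε)) k ∧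
        ‖k - Complex.I * ((ε ^ 2 / 2 * ∫ x, EdgeBifurcation.effPotential lam q x : ℝ) : ℂ)‖
          ≤ C * ε ^ 3 ∧
        (E : ℂ) = k ^ 2 ∧
        E < 0 ∧
        |E + ε ^ 4 / 4 * (∫ x, EdgeBifurcation.effPotential lam q x) ^ 2| ≤ C * ε ^ 5 ∧
        EdgeBifurcation.IsSimpleEigenvalue
          (EdgeBifurcation.schrodingerOp (EdgeBifurcation.oscPotential lam q ε)) (E : ℂ) ∧
        ∀ u ∈ EdgeBifurcation.eigenspace
            (EdgeBifurcation.schrodingerOp (EdgeBifurcation.oscPotential lam q ε)) (E : ℂ),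
          ∃ M : ℝ, ∀ᵐ x : ℝ, ‖u x‖ ≤ M * Real.exp (-(Real.sqrt |E| * |x|)) := by
  obtain ⟨Q₀, Q₁, Q₂, Q₃, n, h, hQ⟩ := EdgeBifurcation.exists_smoothProfile hθ hβ hgap hlam hnorm
  have hQ0 : ∃ j, ¬ (Q₀ j =ᵐ[volume] 0) := hq.imp fun j hj h0 => hj ((hQ j).trans h0)
  have hL := h.integral_effPotential_pos hQ0
  rw [EdgeBifurcation.integral_effPotential_congr hQ lam]
  obtain ⟨ε₀, C, hε₀, hC, hmain⟩ := h.exists_pole hL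
  set L := ∫ x, EdgeBifurcation.effPotential lam Q₀ x
  -- The factor 1 + 2L absorbs κ + ε²L/2 ≤ (3/2)ε²L, which appears when the error in κ is passed on
  -- to E = -κ².
  refine ⟨ε₀, C * (1 + 2 * L), hε₀, by positivity, fun ε hε hlt => ?_⟩
  obtain ⟨κ, hκ, hκL, hκC, hW, hp⟩ := hmain ε hε hlt (h.conj_oscSum hQ hreal ε)
  have hV := h.decay_potential ε
  have hae := EdgeBifurcation.oscPotential_ae_eq hQ lam ε
  have him : (Complex.I * (κ : ℂ)).im = κ := by simp
  have hk2 : (((-κ ^ 2 : ℝ)) : ℂ) = (Complex.I * κ) ^ 2 := by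
    rw [mul_pow, Complex.I_sq]; push_cast; ring
  have hsqrt : Real.sqrt |(-κ ^ 2)| = κ := by
    rw [abs_neg, abs_of_nonneg (sq_nonneg κ), Real.sqrt_sq hκ.le]
  have hε3 : 0 < ε ^ 3 := by positivity
  obtain ⟨f, f₁, M, hf, hf0, hd, hd₁⟩ :=
    EdgeBifurcation.exists_boundState hV (by rw [him]; exact hκ) hW
  rw [him] at hd hd₁
  rw [← hk2] at hf
  have hop : EdgeBifurcation.schrodingerOp (EdgeBifurcation.oscPotential lam q ε) =
      EdgeBifurcation.schrodingerOp (EdgeBifurcation.oscSum lam ε Q₀) := by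
    rw [EdgeBifurcation.schrodingerOp, EdgeBifurcation.schrodingerOp,
      EdgeBifurcation.schrodingerGraph_congr hae]
  obtain ⟨hs, hdec⟩ := EdgeBifurcation.simple_eigenvalue_of_boundState hV hf hf0 hd hd₁
  refine ⟨Complex.I * κ, -κ ^ 2, by rw [him]; exact hκ, ?_, ?_, hk2,
    neg_neg_of_pos (by positivity), ?_, ?_, ?_⟩
  · rw [show EdgeBifurcation.transmission (EdgeBifurcation.oscPotential lam q ε) =
      EdgeBifurcation.transmission (EdgeBifurcation.oscSum lam ε Q₀) from
      funext (EdgeBifurcation.transmission_congr hae)]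
    exact hp
  · rw [← mul_sub, norm_mul, Complex.norm_I, one_mul, ← Complex.ofReal_sub, Complex.norm_real,
      Real.norm_eq_abs]
    refine hκC.trans (mul_le_mul_of_nonneg_right ?_ hε3.le)
    exact le_mul_of_one_le_right hC.le (by linarith)
  · rw [show -κ ^ 2 + ε ^ 4 / 4 * L ^ 2 = -((κ - ε ^ 2 / 2 * L) * (κ + ε ^ 2 / 2 * L)) by ring,
      abs_neg, abs_mul, abs_of_nonneg (show 0 ≤ κ + ε ^ 2 / 2 * L by positivity)]
    have hε2L : 0 ≤ ε ^ 2 * L := by positivity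
    calc _ ≤ C * ε ^ 3 * (ε ^ 2 * (1 + 2 * L)) :=
          mul_le_mul hκC (by nlinarith [sq_nonneg ε]) (by positivity) (by positivity)
      _ = _ := by ring
  · rw [hop]; exact hs
  · rw [hop, hsqrt]; exact hdec
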